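/- **Setting.** Let $n\ge 2$, let $X\subset\mathbb R^n$ be a bounded open set with $C^1$ boundary $\partial X$ (locally $X=\{\rho<0\}$ for a $C^1$ function $\rho$ with $\nabla\rho\neq0$), outward unit normal $\nu$ and surface measure $\mu$ on $\partial X$, and let $T>0$. Let $\sigma:X\times\mathbb S^{n-1}\to[0,\infty)$ and $k:X\times\mathbb S^{n-1}\times\mathbb S^{n-1}\to[0,\infty)$ be measurable with $\sigma\in L^\infty(X\times\mathbb S^{n-1})$. Put $\Gamma_\pm=\{(x,v)\in\partial X\times\mathbb S^{n-1}: \pm\nu(x)\cdot v>0\}$ and $\mathbb S^{n-1}_{x,+}=\{v\in\mathbb S^{n-1}:\nu(x)\cdot v>0\}$, let $S$ be a bounded continuous real function on $\Gamma_-$ and $W$ a bounded continuous real function on $\Gamma_+$. Put $\tau_-(x,v)=\inf\{s>0: x-sv\notin X\}$; let $\Theta(x,y)=1$ if $x+p(y-x)\in X$ for all $p\in(0,1]$ and $\Theta(x,y)=0$ otherwise; and for $N\ge3$ let $$E(p_1,\dots,p_N)=\exp\Big(-\sum_{i=1}^{N-1}\int_0^{|p_i-p_{i+1}|}\sigma(p_i-s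 u_i,u_i)\,ds\Big)\,\Theta(p_N,p_{N-1})\prod_{i=1}^{N-2}\Theta(p_i,p_{i+1}),\qquad u_i=\tfrac{p_i-p_{i+1}}{|p_i-p_{i+1}|}.$$ **The kernels.** Let $m\ge2$, $\tau\in\mathbb R$ and $x,x'\in\partial X$. For $y=(y_2,\dots,y_m)\in(\mathbb R^n)^{m-1}$ and $v\in\mathbb S^{n-1}$ put $$t=\tau-\sum_{i=2}^m|y_i|,\qquad w=x-x'-\sum_{i=2}^m y_i,\qquad s_1=\frac{|w-tv|^2}{2(t-w\cdot v)},$$ $$z_1=x-(t-s_1)v,\qquad z_i=x'+\sum_{l=i}^m y_l\ \ (2\le i\le m),$$ $$v_0=v,\qquad v_1=\frac{w-(t-s_1)v}{s_1},\qquad v_i=\frac{y_i}{|y_i|}\ \ (2\le i\le m).$$ The kernel of the part of the angularly averaged albedo operator that accounts for exactly $m$ collisions is $$\gamma_m(\tau,x,x')=\int\!\!\int_{\mathbb S^{n-1}_{x,+}}(\nu(x)\cdot v)\,W(x,v)\,\frac{2^{n-2}(t-w\cdot v)^{n-3}}{|y_2|^{n-1}\cdots|y_m|^{n-1}\,|w-tv|^{2n-4}}\,\chi_{(0,\tau_-(x,v))}(t-s_1)\,E(x,z_1,\dots,z_m,x')\,\prod_{i=1}^m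 k(z_i,v_i,v_{i-1})\;S(x',v_m)\,|\nu(x')\cdot v_m|\,dv\,dy,$$ where the outer integral is over all $y$ with $\sum_{i=2}^m|y_i|+|w|<\tau$ and $z_2,\dots,z_m\in X$. Let $\Gamma_2=\sum_{m\ge2}\gamma_m$. Below, $L^\infty$ refers to $(0,T)\times\partial X\times\partial X$ with the measure $d\tau\,d\mu(x)\,d\mu(x')$. **Theorem.** Assume that $k\in L^\infty(X\times\mathbb S^{n-1}\times\mathbb S^{n-1})$. Then, for almost every $(\tau,x,x')\in(0,T)\times\partial X\times\partial X$, the integrals that define $\gamma_m(\tau,x,x')$, $m\ge2$, and the series $\Gamma_2(\tau,x,x')$ converge absolutely, and $$\Gamma_2(\tau,x,x')\in L^\infty\quad\text{when } n=2;$$ $$\frac{\tau|x-x'|\,\Gamma_2(\tau,x,x')}{(\tau-|x-x'|)\Big(1+\ln\frac{\tau+|x-x'|}{\tau-|x-x'|}\Big)^2}\in L^\infty\quad\text{when } n=3;$$ $$\frac{\tau|x-x'|^{n-2}}{\tau-|x-x'|}\,\Gamma_2(\tau,x,x')\in L^\infty\quad\text{when } n\ge4.$$ If in addition there is $\delta>0$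 such that $k(y,v',v)=0$ for almost every $(y,v',v)$ with $\inf_{x\in\partial X}|x-y|<\delta$, then $$(\tau-|x-x'|)^{-1}\Big(1+\ln\frac{\tau+|x-x'|}{\tau-|x-x'|}\Big)^{-1}\Gamma_2(\tau,x,x')\in L^\infty\quad\text{when } n=3;$$ $$(\tau-|x-x'|)^{\frac{1-n}2}\,\Gamma_2(\tau,x,x')\in L^\infty\quad\text{when } n\ge4.$$ (For $\tau\le|x-x'|$ one has $\Gamma_2(\tau,x,x')=0$, and the weighted expressions are read as $0$.) -/

import Mathlib

open Set Filter MeasureTheory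
open scoped Topology ENNReal

namespace Transport

/-- The Euclidean space `ℝⁿ`. -/
abbrev Euc (n : ℕ) : Type := EuclideanSpace ℝ (Fin n)

/-- The unit sphere `𝕊ⁿ⁻¹` of `ℝⁿ`. -/
abbrev Sph (n : ℕ) : Type := ↥(Metric.sphere (0 : Euc n) 1)

/-- The surface measure `dv` on `𝕊ⁿ⁻¹` (total mass `n` times the volume of the unit ball). -/
noncomputable abbrev sphereMeasure (n : ℕ) : Measure (Sph n) :=
  (volume : Measure (Euc n)).toSphere

/-- The surface measure `dμ` on `∂X`: the `(n-1)`-dimensional Hausdorff measure, in its Euclidean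
normalization, restricted to the boundary. -/
noncomputable def surfaceMeasure {n : ℕ} (X : Set (Euc n)) : Measure (Euc n) :=
  (Measure.euclideanHausdorffMeasure (n - 1)).restrict (frontier X)

/-- The measure `dx dv` on `X × 𝕊ⁿ⁻¹`. -/
noncomputable def phaseMeasure {n : ℕ} (X : Set (Euc n)) : Measure (Euc n × Sph n) :=
  (volume.restrict X).prod (sphereMeasure n)

/-- The measure `dx dv' dv` on `X × 𝕊ⁿ⁻¹ × 𝕊ⁿ⁻¹`. -/
noncomputable def collisionMeasure {n : ℕ} (X : Set (Euc n)) : Measure (Euc n × Sph n × Sph n) :=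
  (volume.restrict X).prod ((sphereMeasure n).prod (sphereMeasure n))

/-- The measure `dτ dμ(x) dμ(x')` on `(0,T) × ∂X × ∂X`. -/
noncomputable def dataMeasure {n : ℕ} (X : Set (Euc n)) (T : ℝ) : Measure (ℝ × Euc n × Euc n) :=
  (volume.restrict (Ioo 0 T)).prod ((surfaceMeasure X).prod (surfaceMeasure X))

/-! ### The boundary -/

/-- `N` is the outward unit normal of `X` at the boundary point `x`: near `x` the set `X` is
`{ρ < 0}` for a `C¹` function `ρ` with `ρ x = 0` whose gradient at `x` is a positive multiple of
the unit vector `N`. -/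
def IsOutwardUnitNormal {n : ℕ} (X : Set (Euc n)) (x N : Euc n) : Prop :=
  ‖N‖ = 1 ∧ ∃ ρ : Euc n → ℝ, ContDiffAt ℝ 1 ρ x ∧ ρ x = 0 ∧
    (∃ c : ℝ, 0 < c ∧ gradient ρ x = c • N) ∧ ∀ᶠ y in 𝓝 x, (y ∈ X ↔ ρ y < 0)

/-- `X` has a `C¹` boundary. -/
def HasC1Boundary {n : ℕ} (X : Set (Euc n)) : Prop :=
  ∀ x ∈ frontier X, ∃ N, IsOutwardUnitNormal X x N

open Classical in
/-- The outward unit normal `ν(x)` (the value `0` is taken where there is none). -/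
noncomputable def normal {n : ℕ} (X : Set (Euc n)) (x : Euc n) : Euc n :=
  if h : ∃ N, IsOutwardUnitNormal X x N then h.choose else 0

/-- `Γ₊`, the outgoing boundary set. -/
def outgoing {n : ℕ} (X : Set (Euc n)) : Set (Euc n × Euc n) :=
  {p | p.1 ∈ frontier X ∧ ‖p.2‖ = 1 ∧ 0 < inner ℝ (normal X p.1) p.2}

/-- `Γ₋`, the incoming boundary set. -/
def incoming {n : ℕ} (X : Set (Euc n)) : Set (Euc n × Euc n) :=
  {p | p.1 ∈ frontier X ∧ ‖p.2‖ = 1 ∧ inner ℝ (normal X p.1) p.2 < 0}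

/-- The backward travel time `τ₋(x,v) = inf {s > 0 | x - s v ∉ X}`. -/
noncomputable def travelTimeBack {n : ℕ} (X : Set (Euc n)) (x v : Euc n) : ℝ :=
  sInf {s : ℝ | 0 < s ∧ x - s • v ∉ X}

/-! ### Attenuation along a broken path -/

open Classical in
/-- `Θ(x,y) = 1` if `x + p (y - x) ∈ X` for all `p ∈ (0,1]`, and `0` otherwise. -/
noncomputable def visible {n : ℕ} (X : Set (Euc n)) (x y : Euc n) : ℝ :=
  if ∀ p ∈ Ioc (0 : ℝ) 1, x + p • (y - x) ∈ X then 1 else 0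

/-- `∫₀^{|a-b|} σ(a - s u, u) ds` with `u = (a-b)/|a-b|`. -/
noncomputable def opticalLength {n : ℕ} (σ : Euc n → Euc n → ℝ) (a b : Euc n) : ℝ :=
  ∫ s in (0 : ℝ)..‖a - b‖, σ (a - s • (‖a - b‖⁻¹ • (a - b))) (‖a - b‖⁻¹ • (a - b))

/-- The attenuation `E(p₀, …, p_{N+1})` along a broken path with `N + 1` segments. All segments
but the last one are tested for visibility from their first point, the last one from its last
point. -/
noncomputable def attenuation {n : ℕ} (X : Set (Euc n)) (σ : Euc n → Euc n → ℝ) {N : ℕ}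
    (p : Fin (N + 2) → Euc n) : ℝ :=
  Real.exp (-∑ i : Fin (N + 1), opticalLength σ (p i.castSucc) (p i.succ)) *
    visible X (p (Fin.last (N + 1))) (p (Fin.last N).castSucc) *
    ∏ i : Fin N, visible X (p i.castSucc.castSucc) (p i.succ.castSucc)

/-! ### The kernels

In the definitions below a particle starts at `x'`, is scattered `j + 1` times and leaves at `x`.
The vectors `y 0, …, y (j-1)` are `y₂, …, y_{j+1}`: `y i` is the displacement between two
consecutive collisions, or from `x'` to the first collision if `i = j - 1`. -/

/-- The set of `y = (y_i)` with `∑ |y_i| + |z - z' - ∑ y_i| < μ`. -/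
def ellipsoid {n : ℕ} (j : ℕ) (μ : ℝ) (z z' : Euc n) : Set (Fin j → Euc n) :=
  {y | ∑ i, ‖y i‖ + ‖z - z' - ∑ i, y i‖ < μ}

/-- The collision points `x' + ∑_{l ≥ i} y_l`: all collision points but the one before leaving. -/
noncomputable def earlyPoint {n j : ℕ} (x' : Euc n) (y : Fin j → Euc n) (i : Fin j) : Euc n :=
  x' + ∑ l ∈ Finset.Ici i, y l

/-- The time `t = τ - ∑ |y_i|` left after the displacements `y`. -/
noncomputable def leftTime {n j : ℕ} (τ : ℝ) (y : Fin j → Euc n) : ℝ :=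
  τ - ∑ i, ‖y i‖

/-- The vector `w = x - x' - ∑ y_i` left to travel after the displacements `y`. -/
noncomputable def leftVec {n j : ℕ} (x x' : Euc n) (y : Fin j → Euc n) : Euc n :=
  x - x' - ∑ i, y i

/-- `s₁ = |w - t v|² / (2 (t - w · v))`, the length of the path before the last collision. -/
noncomputable def lastLeg {n j : ℕ} (τ : ℝ) (x x' : Euc n) (y : Fin j → Euc n) (v : Euc n) : ℝ :=
  ‖leftVec x x' y - leftTime τ y • v‖ ^ 2 / (2 * (leftTime τ y - inner ℝ (leftVec x x' y) v))

/-- The last collision point `x - (t - s₁) v`. -/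
noncomputable def lastPoint {n j : ℕ} (τ : ℝ) (x x' : Euc n) (y : Fin j → Euc n) (v : Euc n) :
    Euc n :=
  x - (leftTime τ y - lastLeg τ x x' y v) • v

/-- The direction `v₁ = (w - (t - s₁) v) / s₁` before the last collision. -/
noncomputable def lastDir {n j : ℕ} (τ : ℝ) (x x' : Euc n) (y : Fin j → Euc n) (v : Euc n) :
    Euc n :=
  (lastLeg τ x x' y v)⁻¹ •
    (leftVec x x' y - (leftTime τ y - lastLeg τ x x' y v) • v)

/-- All collision points, the last collision first. -/
noncomputable def points {n j : ℕ} (τ : ℝ) (x x' : Euc n) (y : Fin j → Euc n) (v : Euc n) :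
    Fin (j + 1) → Euc n :=
  Fin.cons (lastPoint τ x x' y v) (earlyPoint x' y)

/-- All directions of travel `v, v₁, v₂ = y₂/|y₂|, …, v_{j+1} = y_{j+1}/|y_{j+1}|`, the last
direction of travel first. -/
noncomputable def directions {n j : ℕ} (τ : ℝ) (x x' : Euc n) (y : Fin j → Euc n) (v : Euc n) :
    Fin (j + 2) → Euc n :=
  Fin.cons v (Fin.cons (lastDir τ x x' y v) (fun i => ‖y i‖⁻¹ • y i))

/-- The broken path from `x` back to `x'`. -/
noncomputable def brokenPath {n j : ℕ} (τ : ℝ) (x x' : Euc n) (y : Fin j → Euc n) (v : Euc n) :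
    Fin (j + 1 + 2) → Euc n :=
  Fin.cons x (Fin.snoc (points τ x x' y v) x')

open Classical in
/-- The function that is integrated with respect to `dy dv` in the kernel `γ_{j+1}`. -/
noncomputable def kernelIntegrand {n : ℕ} (X : Set (Euc n)) (σ : Euc n → Euc n → ℝ)
    (k : Euc n → Euc n → Euc n → ℝ) (S W : Euc n → Euc n → ℝ) (j : ℕ)
    (τ : ℝ) (x x' : Euc n) (y : Fin j → Euc n) (v : Euc n) : ℝ :=
  inner ℝ (normal X x) v * W x v *
    (2 ^ (n - 2) * (leftTime τ y - inner ℝ (leftVec x x' y) v) ^ ((n : ℤ) - 3) /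
      ((∏ i, ‖y i‖ ^ (n - 1)) * ‖leftVec x x' y - leftTime τ y • v‖ ^ (2 * n - 4))) *
    (if leftTime τ y - lastLeg τ x x' y v ∈ Ioo 0 (travelTimeBack X x v) then 1 else 0) *
    attenuation X σ (brokenPath τ x x' y v) *
    (∏ i : Fin (j + 1), k (points τ x x' y v i) (directions τ x x' y v i.succ)
      (directions τ x x' y v i.castSucc)) *
    S x' (directions τ x x' y v (Fin.last (j + 1))) *
    |inner ℝ (normal X x') (directions τ x x' y v (Fin.last (j + 1)))|

/-- The domain of integration in the kernel `γ_{j+1}`. -/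
def kernelDomain {n : ℕ} (X : Set (Euc n)) (j : ℕ) (τ : ℝ) (x x' : Euc n) :
    Set ((Fin j → Euc n) × Sph n) :=
  {q | q.1 ∈ ellipsoid j τ x x' ∧ (∀ i, earlyPoint x' q.1 i ∈ X) ∧
    0 < inner ℝ (normal X x) (q.2 : Euc n)}

/-- The integral that defines `γ_{j+1}(τ,x,x')` converges absolutely. -/
def KernelConverges {n : ℕ} (X : Set (Euc n)) (σ : Euc n → Euc n → ℝ)
    (k : Euc n → Euc n → Euc n → ℝ) (S W : Euc n → Euc n → ℝ) (j : ℕ)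
    (τ : ℝ) (x x' : Euc n) : Prop :=
  IntegrableOn (fun q : (Fin j → Euc n) × Sph n => kernelIntegrand X σ k S W j τ x x' q.1 q.2)
    (kernelDomain X j τ x x') (volume.prod (sphereMeasure n))

/-- The kernel `γ_{j+1}(τ,x,x')` of the part of the averaged albedo operator that accounts for
exactly `j + 1` collisions. -/
noncomputable def scatteringKernel {n : ℕ} (X : Set (Euc n)) (σ : Euc n → Euc n → ℝ)
    (k : Euc n → Euc n → Euc n → ℝ) (S W : Euc n → Euc n → ℝ) (j : ℕ)
    (τ : ℝ) (x x' : Euc n) : ℝ :=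
  ∫ q in kernelDomain X j τ x x', kernelIntegrand X σ k S W j τ x x' q.1 q.2
    ∂((volume : Measure (Fin j → Euc n)).prod (sphereMeasure n))

/-- The multiple scattering kernel `Γ₂ = ∑_{m ≥ 2} γ_m`. -/
noncomputable def multipleScattering {n : ℕ} (X : Set (Euc n)) (σ : Euc n → Euc n → ℝ)
    (k : Euc n → Euc n → Euc n → ℝ) (S W : Euc n → Euc n → ℝ)
    (τ : ℝ) (x x' : Euc n) : ℝ :=
  ∑' i : ℕ, scatteringKernel X σ k S W (i + 1) τ x x'

/-- `supp k` is contained in `{y ∈ X | inf_{x ∈ ∂X} |x - y| ≥ δ}` for some `δ > 0`. -/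
def VanishesNearBoundary {n : ℕ} (X : Set (Euc n)) (k : Euc n → Euc n → Euc n → ℝ) : Prop :=
  ∃ δ : ℝ, 0 < δ ∧ ∀ᵐ p ∂(collisionMeasure X),
    Metric.infDist p.1 (frontier X) < δ → k p.1 p.2.1 p.2.2 = 0

end Transport

open scoped Pointwise

namespace Transport

/-! Everything is bounded absolutely. With bounded coefficients the integrand of `γ_{j+2}` is at
most a constant times `K^(j+2)` times the product of the `|y_i|^(1-n)` and a density in `v`
depending only on the remaining time `t` and the remaining displacement `w`. The mean of that
density over the sphere is at most `C t^(1-n) φ((t-|w|)/t)` (`lintegral_scatterDensity_le`). Here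
`φ` is `coneProfile`: `η^(-1/2)` for n = 2, `2 - log η` for n = 3, and 1 for n ≥ 4.

What remains is the potential of a chain of j+1 displacements `y_i` and one final piece of duration
`t`, adding up to time `τ`. Of these j+2 pieces one lasts at least `τ/(j+2)`, and its factor is
replaced by a constant multiple of `τ^(1-n)`. If that piece is one of the `y_i`, then `t^(1-n) ≤
|w|^(1-n)` and the reflection exchanging `y_i` with `w` (`lintegral_swap`) brings back the other
case. A single displacement is then integrated in polar coordinates about a focus of the ellipsoid
`|y| + |z-y| < τ`. The delay is concave on each ray and `φ` loses at most an integrable inverse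
square root, so the outcome is `(τ-|z|) φ²` (`lintegral_radialWeight_delay_le`). Each further
displacement only costs an integration over the remaining time, because the delay can only shrink
(`lintegral_chain_le`). The nested time integrals produce `(sτ)^j/j!`, with `s` the area of the
sphere, so the series over collisions converges. The stated weights are the reciprocals of
`τ^(1-n)(τ-d)φ²`, `d = |x-x'|`, up to factors of the form `(d/τ)^a ≤ 1`.

If `k` vanishes within δ of the boundary, the first displacement and the final duration are both at
least δ, so both of their singular factors are bounded. The base case becomes an unweighted integral
over the ellipsoid, of size `(τ-|z|)^((n-1)/2) φ` (`lintegral_delay_le`).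

The remaining difficulty is measure theoretic. The bound and the support of `k` hold only almost
everywhere, whereas the path parameters and boundary data parametrize the collisions in a
constrained way. `ae_collisions` shows that for almost all data almost every broken path avoids a
given null set of collisions. It rests on Fubini and on the fact that a line through almost every
boundary point, in a transversal direction, meets a null set of space in a null set
(`ae_surface_ae_line`). The coefficients can therefore be replaced by Borel functions bounded
everywhere. -/

theorem nontrivial_euc {n : ℕ} (hn : 2 ≤ n) : Nontrivial (Euc n) := by
  have : Nonempty (Fin n) := ⟨⟨0, by omega⟩⟩
  infer_instance

/-! ### Polar coordinates and integrals over the sphere -/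

/-- Integration in polar coordinates. -/
theorem lintegral_polar {n : ℕ} (hn : 2 ≤ n) {f : Euc n → ℝ≥0∞} (hf : Measurable f) :
    ∫⁻ y, f y = ∫⁻ v : Sph n, (∫⁻ r in Ioi (0 : ℝ),
      ENNReal.ofReal (r ^ (n - 1)) * f (r • (v : Euc n))) ∂(sphereMeasure n) := by
  have := nontrivial_euc hn
  have hmp := (volume : Measure (Euc n)).measurePreserving_homeomorphUnitSphereProd
  have h1 : ∫⁻ y, f y = ∫⁻ y : ({(0 : Euc n)}ᶜ : Set (Euc n)), f y.1
      ∂(volume.comap Subtype.val) := by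
    rw [lintegral_subtype_comap (measurableSet_singleton _).compl f, restrict_compl_singleton]
  have h2 : ∀ y : ({(0 : Euc n)}ᶜ : Set (Euc n)), f y.1 =
      (fun q : Sph n × Ioi (0 : ℝ) => f (q.2.1 • (q.1 : Euc n)))
        (homeomorphUnitSphereProd (Euc n) y) := by
    intro y
    have hy : ‖(y : Euc n)‖ ≠ 0 := norm_ne_zero_iff.2 y.2
    simp [smul_smul, hy]
  have hmeas : Measurable fun q : Sph n × Ioi (0 : ℝ) => f (q.2.1 • (q.1 : Euc n)) := by
    fun_prop
  rw [h1, lintegral_congr h2, hmp.lintegral_comp hmeas, lintegral_prod _ hmeas.aemeasurable]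
  refine lintegral_congr fun v => ?_
  have hm2 : Measurable fun r : Ioi (0 : ℝ) => f (r.1 • (v : Euc n)) := by fun_prop
  rw [Measure.volumeIoiPow, lintegral_withDensity_eq_lintegral_mul _ (by fun_prop) hm2]
  simp only [Pi.mul_apply, finrank_euclideanSpace, Fintype.card_fin]
  exact lintegral_subtype_comap measurableSet_Ioi
    fun r => ENNReal.ofReal (r ^ (n - 1)) * f (r • (v : Euc n))

/-- The weight `‖u‖ ^ (1 - n)`. -/
noncomputable def radialWeight {n : ℕ} (u : Euc n) : ℝ≥0∞ := (ENNReal.ofReal (‖u‖ ^ (n - 1)))⁻¹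

@[fun_prop]
theorem measurable_radialWeight {n : ℕ} : Measurable (radialWeight (n := n)) := by
  unfold radialWeight
  fun_prop

/-- The weight is the inverse of the polar Jacobian. The factors `|y_i|^(1-n)` of the kernel thus
disappear in polar coordinates. -/
theorem lintegral_radialWeight_mul {n : ℕ} (hn : 2 ≤ n) {f : Euc n → ℝ≥0∞} (hf : Measurable f) :
    ∫⁻ y, radialWeight y * f y = ∫⁻ v : Sph n, (∫⁻ r in Ioi (0 : ℝ), f (r • (v : Euc n)))
      ∂(sphereMeasure n) := by
  rw [lintegral_polar hn (by fun_prop)]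
  refine lintegral_congr fun v => setLIntegral_congr_fun measurableSet_Ioi fun r hr => ?_
  have hr' : 0 < r := hr
  have hv : ‖(v : Euc n)‖ = 1 := by simp
  have hnorm : ‖r • (v : Euc n)‖ = r := by rw [norm_smul, hv, mul_one, Real.norm_of_nonneg hr'.le]
  simp only [radialWeight, hnorm]
  rw [← mul_assoc, ENNReal.mul_inv_cancel, one_mul]
  · simpa using pow_pos hr' _
  · exact ENNReal.ofReal_ne_top

/-- The measure of a cap is `n` times the volume of the cone over it. For r ≤ 1 about `1/r` balls of
radius `2r`, centred on the axis of the cone, cover that cone. -/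
theorem sphere_cap_le {n : ℕ} (hn : 2 ≤ n) :
    ∃ C : ℝ, 0 < C ∧ ∀ (e : Sph n) (r : ℝ), 0 < r →
      sphereMeasure n {v | ‖(v : Euc n) - e‖ < r} ≤ ENNReal.ofReal (C * r ^ (n - 1)) := by
  have := nontrivial_euc hn
  set b : ℝ := (volume : Measure (Euc n)).real (Metric.ball 0 1) with hb
  have hvol : ∀ (x : Euc n) (r : ℝ), 0 < r →
      volume (Metric.ball x r) = ENNReal.ofReal (r ^ n * b) := by
    intro x r hr
    rw [Measure.addHaar_ball_of_pos _ _ hr, finrank_euclideanSpace, Fintype.card_fin,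
      ENNReal.ofReal_mul (by positivity), hb, ofReal_measureReal]
  have hb0 : 0 < b := by
    rw [hb]; exact ENNReal.toReal_pos (Metric.isOpen_ball.measure_pos _ (by simp)).ne' (by finiteness)
  have hcap : ∀ (e : Sph n) (r : ℝ), 0 < r → r ≤ 1 →
      sphereMeasure n {v | ‖(v : Euc n) - e‖ < r} ≤
        ENNReal.ofReal (n * (2 * (2 ^ n * b)) * r ^ (n - 1)) := by
    intro e r hr hr1
    rw [Measure.toSphere_apply' _ (measurableSet_lt (by fun_prop) measurable_const),
      finrank_euclideanSpace, Fintype.card_fin]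
    set N : ℕ := ⌈1 / r⌉₊
    have hsub : Ioo (0 : ℝ) 1 • (Subtype.val '' {v : Sph n | ‖(v : Euc n) - e‖ < r}) ⊆
        ⋃ k ∈ Finset.range N, Metric.ball ((k * r) • (e : Euc n)) (2 * r) := by
      rintro _ ⟨s, hs, _, ⟨v, hv, rfl⟩, rfl⟩
      simp only [mem_ofPred_eq] at hv
      set k : ℕ := ⌊s / r⌋₊
      have hk1 : (k : ℝ) * r ≤ s := by
        have := Nat.floor_le (div_nonneg hs.1.le hr.le)
        rwa [le_div_iff₀ hr] at this
      have hk2 : s < (k + 1) * r := by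
        have := Nat.lt_floor_add_one (s / r)
        rwa [div_lt_iff₀ hr] at this
      have hkN : k < N := by
        have h1 : (k : ℝ) < 1 / r := by
          rw [lt_div_iff₀ hr]; linarith [hs.2]
        exact_mod_cast h1.trans_le (Nat.le_ceil _)
      simp only [mem_iUnion, Finset.mem_range, Metric.mem_ball, dist_eq_norm]
      refine ⟨k, hkN, ?_⟩
      have he : ‖(e : Euc n)‖ = 1 := by simp
      have heq : s • (v : Euc n) - (k * r) • (e : Euc n) =
          s • ((v : Euc n) - e) + (s - k * r) • (e : Euc n) := by module
      calc ‖s • (v : Euc n) - (k * r) • (e : Euc n)‖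
          ≤ ‖s • ((v : Euc n) - e)‖ + ‖(s - k * r) • (e : Euc n)‖ := by
            rw [heq]; exact norm_add_le _ _
        _ = s * ‖(v : Euc n) - e‖ + (s - k * r) := by
            rw [norm_smul, norm_smul, he, Real.norm_of_nonneg hs.1.le,
              Real.norm_of_nonneg (by linarith), mul_one]
        _ < 2 * r := by nlinarith [hs.1, hs.2, norm_nonneg ((v : Euc n) - e)]
    calc (n : ℝ≥0∞) * volume (Ioo (0 : ℝ) 1 • (Subtype.val '' {v : Sph n | ‖(v : Euc n) - e‖ < r}))
        ≤ n * ∑ k ∈ Finset.range N, volume (Metric.ball ((k * r) • (e : Euc n)) (2 * r)) := by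
          gcongr
          exact (measure_mono hsub).trans (measure_biUnion_finset_le _ _)
      _ = ENNReal.ofReal (n * (N * ((2 * r) ^ n * b))) := by
          simp only [hvol _ (2 * r) (by positivity), Finset.sum_const, Finset.card_range,
            nsmul_eq_mul]
          rw [ENNReal.ofReal_mul (p := (n : ℝ)) (by positivity),
            ENNReal.ofReal_mul (p := (N : ℝ)) (by positivity),
            ENNReal.ofReal_natCast, ENNReal.ofReal_natCast]
      _ ≤ ENNReal.ofReal (n * (2 * (2 ^ n * b)) * r ^ (n - 1)) := by
          apply ENNReal.ofReal_le_ofReal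
          have hN : (N : ℝ) * r ≤ 2 := by
            have := (Nat.ceil_lt_add_one (a := 1 / r) (by positivity)).le
            calc (N : ℝ) * r ≤ (1 / r + 1) * r := by gcongr
              _ = 1 + r := by field_simp
              _ ≤ 2 := by linarith
          have hrn : r ^ n = r * r ^ (n - 1) := by
            rw [← pow_succ', Nat.sub_add_cancel (by omega)]
          rw [mul_pow, hrn]
          calc (n : ℝ) * (N * (2 ^ n * (r * r ^ (n - 1)) * b))
              = n * (2 ^ n * r ^ (n - 1) * b) * (N * r) := by ring
            _ ≤ n * (2 ^ n * r ^ (n - 1) * b) * 2 := by gcongr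
            _ = _ := by ring
  set m : ℝ := (sphereMeasure n).real univ with hm
  -- The total mass `m` of the sphere is added to settle the case r ≥ 1.
  refine ⟨n * (2 * (2 ^ n * b)) + m, ?_, fun e r hr => ?_⟩
  · have : 0 ≤ m := measureReal_nonneg
    have : (0 : ℝ) < n := by exact_mod_cast (by omega : 0 < n)
    positivity
  have hm0 : 0 ≤ m := measureReal_nonneg
  rcases le_total r 1 with h | h
  · refine (hcap e r hr h).trans (ENNReal.ofReal_le_ofReal ?_)
    gcongr
    linarith
  · calc _ ≤ sphereMeasure n univ := measure_mono (subset_univ _)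
      _ = ENNReal.ofReal m := by rw [hm, ofReal_measureReal]
      _ ≤ _ := by
        apply ENNReal.ofReal_le_ofReal
        have h1 : 1 ≤ r ^ (n - 1) := one_le_pow₀ h
        have : 0 ≤ (n : ℝ) * (2 * (2 ^ n * b)) := by positivity
        nlinarith

theorem sphere_pole_null {n : ℕ} (hn : 2 ≤ n) (e : Sph n) :
    sphereMeasure n {v | ‖(v : Euc n) - e‖ ≤ 0} = 0 := by
  obtain ⟨C, hC, hcap⟩ := sphere_cap_le hn
  have hlim : Tendsto (fun r : ℝ => ENNReal.ofReal (C * r ^ (n - 1))) (𝓝[>] 0) (𝓝 0) := by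
    have hc : Continuous fun r : ℝ => ENNReal.ofReal (C * r ^ (n - 1)) :=
      ENNReal.continuous_ofReal.comp (by fun_prop)
    have := (hc.tendsto 0).mono_left (nhdsWithin_le_nhds (s := Ioi (0 : ℝ)))
    rwa [zero_pow (by omega), mul_zero, ENNReal.ofReal_zero] at this
  refine le_antisymm (ge_of_tendsto hlim ?_) bot_le
  filter_upwards [self_mem_nhdsWithin] with r hr
  exact (measure_mono (t := {v : Sph n | ‖(v : Euc n) - e‖ < r})
    fun v (hv : ‖(v : Euc n) - e‖ ≤ 0) => show ‖(v : Euc n) - e‖ < r from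
      lt_of_le_of_lt hv hr).trans (hcap e r hr)

/-- Functions that decrease with the distance from a pole, integrated over the sphere. -/
theorem lintegral_sphere_antitone_le {n : ℕ} (hn : 2 ≤ n) :
    ∃ C : ℝ, 0 < C ∧ ∀ (e : Sph n) (φ : ℝ → ℝ), Measurable φ → AntitoneOn φ (Ici 0) →
      (∀ s, 0 ≤ φ s) →
      ∫⁻ v : Sph n, ENNReal.ofReal (φ ‖(v : Euc n) - e‖) ∂(sphereMeasure n) ≤
        ENNReal.ofReal C * ∫⁻ s in Ioc (0 : ℝ) 2, ENNReal.ofReal (s ^ (n - 2) * φ s) := by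
  obtain ⟨C, hC, hcap⟩ := sphere_cap_le hn
  have hn1 : (0 : ℝ) < (n - 1 : ℕ) := by exact_mod_cast (by omega : 0 < n - 1)
  refine ⟨C * 4 ^ (n - 1) * (n - 1 : ℕ), by positivity, fun e φ hφ hanti hpos => ?_⟩
  -- A one-dimensional model: `Ioc 0 s` has mass `s^(n-1)/(n-1)`, comparable to the bound for a cap
  -- of radius `s`. The layer-cake formula on both sides reduces the claim to superlevel sets, which
  -- are contained in caps on one side and contain intervals on the other.
  set ν : Measure ℝ := (volume.restrict (Ioc (0 : ℝ) 2)).withDensity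
    fun s => ENNReal.ofReal (s ^ (n - 2)) with hν
  have hνI : ∀ s : ℝ, 0 < s → s ≤ 2 → ν (Ioc 0 s) = ENNReal.ofReal (s ^ (n - 1) / (n - 1 : ℕ)) := by
    intro s hs hs2
    rw [hν, withDensity_apply _ measurableSet_Ioc, Measure.restrict_restrict measurableSet_Ioc,
      inter_eq_left.2 (Ioc_subset_Ioc_right hs2),
      ← ofReal_integral_eq_lintegral_ofReal (intervalIntegral.intervalIntegrable_pow _).1,
      ← intervalIntegral.integral_of_le hs.le, integral_pow]
    · have : n - 2 + 1 = n - 1 := by omega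
      have h2 : ((n - 2 : ℕ) : ℝ) + 1 = (n - 1 : ℕ) := by rw [← this]; push_cast; ring
      rw [h2, this, zero_pow (by omega), sub_zero]
    · filter_upwards [ae_restrict_mem measurableSet_Ioc] with y hy
      exact pow_nonneg hy.1.le _
  have hR : ∫⁻ s in Ioc (0 : ℝ) 2, ENNReal.ofReal (s ^ (n - 2) * φ s) =
      ∫⁻ s, ENNReal.ofReal (φ s) ∂ν := by
    rw [hν, lintegral_withDensity_eq_lintegral_mul _ (by fun_prop) (by fun_prop)]
    refine setLIntegral_congr_fun measurableSet_Ioc fun s hs => ?_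
    simp only [Pi.mul_apply]
    rw [ENNReal.ofReal_mul (pow_nonneg hs.1.le _)]
  rw [hR, lintegral_eq_lintegral_meas_lt _ (Eventually.of_forall fun v => hpos _)
    (by fun_prop), lintegral_eq_lintegral_meas_lt _ (Eventually.of_forall fun v => hpos _)
    (by fun_prop), ← lintegral_const_mul' _ _ ENNReal.ofReal_ne_top]
  refine lintegral_mono fun t => ?_
  simp only
  set A : Set ℝ := {s | 0 ≤ s ∧ s ≤ 2 ∧ t < φ s} with hA
  have hρ2 : ∀ v : Sph n, ‖(v : Euc n) - e‖ ≤ 2 := fun v => by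
    have := norm_sub_le (v : Euc n) e
    have h1 : ‖(v : Euc n)‖ = 1 := by simp
    have h2 : ‖(e : Euc n)‖ = 1 := by simp
    linarith
  have hbdd : BddAbove A := ⟨2, fun s hs => hs.2.1⟩
  set r := sSup A
  have hle : ∀ v : Sph n, t < φ ‖(v : Euc n) - e‖ → ‖(v : Euc n) - e‖ ≤ r := fun v hv =>
    le_csSup hbdd ⟨norm_nonneg _, hρ2 v, hv⟩
  rcases le_or_gt r 0 with hr | hr
  · have : sphereMeasure n {v | t < φ ‖(v : Euc n) - e‖} = 0 :=
      measure_mono_null (fun v hv => (hle v hv).trans hr) (sphere_pole_null hn e)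
    rw [this]
    exact zero_le
  · have hne : A.Nonempty := by
      by_contra h
      rw [not_nonempty_iff_eq_empty] at h
      simp [r, h] at hr
    -- The supremum `r` of the superlevel set need not be attained. A point `s` of it beyond `r/2`
    -- is enough, since the cap then has radius less than `4s`.
    obtain ⟨s, hs, hsr⟩ := exists_lt_of_lt_csSup hne (by linarith : r / 2 < sSup A)
    have h1 : ν (Ioc 0 s) ≤ ν {s | t < φ s} := measure_mono fun u hu =>
      lt_of_lt_of_le hs.2.2 (hanti hu.1.le (hs.1) hu.2)
    calc sphereMeasure n {v | t < φ ‖(v : Euc n) - e‖}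
        ≤ sphereMeasure n {v | ‖(v : Euc n) - e‖ < 4 * s} :=
          measure_mono fun v hv => by
            have := hle v hv
            simp only [mem_ofPred_eq]
            linarith
      _ ≤ ENNReal.ofReal (C * (4 * s) ^ (n - 1)) := hcap e _ (by linarith)
      _ = ENNReal.ofReal (C * 4 ^ (n - 1) * (n - 1 : ℕ)) * ν (Ioc 0 s) := by
          rw [hνI s (by linarith) hs.2.1, ← ENNReal.ofReal_mul (by positivity)]
          congr 1
          rw [mul_pow]
          field_simp
      _ ≤ _ := by gcongr


/-! ### The light cone profile and its scaling -/

/-- The profile of the singularity of the single scattering kernel at the light cone. -/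
noncomputable def coneProfile (n : ℕ) (η : ℝ) : ℝ :=
  if n = 2 then (√η)⁻¹ else if n = 3 then 2 - Real.log η else 1

@[fun_prop]
theorem measurable_coneProfile {n : ℕ} : Measurable (coneProfile n) := by
  unfold coneProfile
  split_ifs <;> fun_prop

theorem one_le_coneProfile (n : ℕ) {η : ℝ} (h0 : 0 < η) (h1 : η ≤ 1) : 1 ≤ coneProfile n η := by
  unfold coneProfile
  split_ifs
  · rw [one_le_inv₀ (Real.sqrt_pos.2 h0)]
    exact Real.sqrt_le_one.2 h1
  · have := Real.log_nonpos h0.le h1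
    linarith
  · rfl

theorem coneProfile_anti (n : ℕ) {a b : ℝ} (h0 : 0 < a) (h : a ≤ b) :
    coneProfile n b ≤ coneProfile n a := by
  unfold coneProfile
  split_ifs
  · have := Real.sqrt_pos.2 h0
    gcongr
  · have := Real.log_le_log h0 h
    linarith
  · rfl

/-- Approaching the cone by a factor `u` costs at most `u^(-1/2)` in every dimension: exactly this
for n = 2, and by `-log √u ≤ (√u)⁻¹ - 1` for n = 3. The loss is integrable in `u`, so integration
along rays preserves the profile. -/
theorem coneProfile_mul_le (n : ℕ) {c u : ℝ} (hc0 : 0 < c) (hc1 : c ≤ 1) (hu0 : 0 < u)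
    (hu1 : u ≤ 1) : coneProfile n (c * u) ≤ (√u)⁻¹ * coneProfile n c := by
  have hs0 : 0 < √u := Real.sqrt_pos.2 hu0
  have hs1 : 1 ≤ (√u)⁻¹ := by
    rw [one_le_inv₀ hs0]
    exact Real.sqrt_le_one.2 hu1
  unfold coneProfile
  split_ifs
  · rw [Real.sqrt_mul hc0.le, mul_inv, mul_comm]
  · rw [Real.log_mul hc0.ne' hu0.ne']
    have h1 : -Real.log u ≤ 2 * ((√u)⁻¹ - 1) := by
      have := Real.log_le_sub_one_of_pos (inv_pos.2 hs0)
      rw [Real.log_inv, Real.log_sqrt hu0.le] at this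
      linarith
    have := Real.log_nonpos hc0.le hc1
    nlinarith
  · linarith

/-- `|w - tv|²` degenerates at scale `η²` rather than `η`. For n ≥ 3 this is harmless, as the
profile is at most logarithmic. -/
theorem coneProfile_sq_le (n : ℕ) (hn : 3 ≤ n) {η : ℝ} (h0 : 0 < η) (h1 : η ≤ 1) :
    coneProfile n (η ^ 2) ≤ 2 * coneProfile n η := by
  have := Real.log_nonpos h0.le h1
  unfold coneProfile
  split_ifs
  · omega
  · rw [Real.log_pow]
    push_cast
    linarith
  · norm_num

/-- The squared profile loses at most `b/a`, which the linear factor gives back. The monotonicity is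
what the induction over chains asks of its majorant. -/
theorem mul_coneProfile_sq_mono (n : ℕ) {a b : ℝ} (ha : 0 < a) (hab : a ≤ b) (hb : b ≤ 1) :
    a * coneProfile n a ^ 2 ≤ b * coneProfile n b ^ 2 := by
  have hb0 : 0 < b := ha.trans_le hab
  have h := coneProfile_mul_le n hb0 hb (div_pos ha hb0) (div_le_one_of_le₀ hab hb0.le)
  rw [mul_div_cancel₀ _ hb0.ne'] at h
  have h1 := one_le_coneProfile n ha (hab.trans hb)
  calc a * coneProfile n a ^ 2 ≤ a * ((√(a / b))⁻¹ * coneProfile n b) ^ 2 := by gcongr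
    _ = _ := by
      rw [mul_pow, inv_pow, Real.sq_sqrt (by positivity)]
      field_simp

/-- The profile of the volume of thin ellipsoids. -/
theorem sqrt_pow_mul_coneProfile_mono (n : ℕ) (hn : 2 ≤ n) {a b : ℝ} (ha : 0 < a) (hab : a ≤ b)
    (hb : b ≤ 1) :
    √a ^ (n - 1) * coneProfile n a ≤ √b ^ (n - 1) * coneProfile n b := by
  have hb0 : 0 < b := ha.trans_le hab
  have h := coneProfile_mul_le n hb0 hb (div_pos ha hb0) (div_le_one_of_le₀ hab hb0.le)
  rw [mul_div_cancel₀ _ hb0.ne', Real.sqrt_div' _ hb0.le, inv_div] at h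
  have h1 := one_le_coneProfile n hb0 hb
  have hsa := Real.sqrt_pos.2 ha
  have hs := Real.sqrt_le_sqrt hab
  obtain ⟨m, hm⟩ : ∃ m, n - 1 = m + 1 := ⟨n - 2, by omega⟩
  rw [hm]
  -- One of the n - 1 ≥ 1 square roots absorbs the loss `√b / √a` of the profile.
  calc √a ^ (m + 1) * coneProfile n a ≤ √a ^ (m + 1) * (√b / √a * coneProfile n b) := by gcongr
    _ = √a ^ m * √b * coneProfile n b := by
      rw [pow_succ]; field_simp
    _ ≤ √b ^ m * √b * coneProfile n b := by gcongr
    _ = _ := by rw [pow_succ]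

/-! ### One-dimensional integrals -/

theorem lintegral_inv_add_sq_le {h : ℝ} (hh : 0 < h) :
    ∫⁻ s in Ioc (0 : ℝ) 2, ENNReal.ofReal ((h + s ^ 2)⁻¹) ≤ ENNReal.ofReal (2 * (√h)⁻¹) := by
  have hs := Real.sqrt_pos.2 hh
  have hsq := Real.sq_sqrt hh.le
  have hint : ∫ s in (0 : ℝ)..2, (h + s ^ 2)⁻¹ = (√h)⁻¹ * Real.arctan (2 / √h) := by
    rw [intervalIntegral.integral_eq_sub_of_hasDerivAt
      (f := fun s => (√h)⁻¹ * Real.arctan (s / √h))]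
    · simp
    · intro s _
      have := ((hasDerivAt_id' s).div_const (√h)).arctan.const_mul (√h)⁻¹
      refine this.congr_deriv ?_
      rw [div_pow, hsq]
      field_simp
      rw [hsq]
    · apply Continuous.intervalIntegrable
      refine Continuous.inv₀ (by fun_prop) fun s => by positivity
  rw [← ofReal_integral_eq_lintegral_ofReal, ← intervalIntegral.integral_of_le (by norm_num), hint]
  · apply ENNReal.ofReal_le_ofReal
    rw [mul_comm]
    gcongr
    have := Real.arctan_lt_pi_div_two (2 / √h)
    linarith [Real.pi_le_four]
  · have : Continuous fun s : ℝ => (h + s ^ 2)⁻¹ :=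
      Continuous.inv₀ (by fun_prop) fun s => by positivity
    exact (this.intervalIntegrable 0 2).1
  · exact Eventually.of_forall fun s => by positivity

theorem lintegral_self_mul_inv_add_sq_le {h : ℝ} (hh : 0 < h) (h1 : h ≤ 1) :
    ∫⁻ s in Ioc (0 : ℝ) 2, ENNReal.ofReal (s * (h + s ^ 2)⁻¹) ≤ ENNReal.ofReal (2 - Real.log h) := by
  have hc : Continuous fun s : ℝ => s * (h + s ^ 2)⁻¹ :=
    Continuous.mul (by fun_prop) (Continuous.inv₀ (by fun_prop) fun s => by positivity)
  have hint : ∫ s in (0 : ℝ)..2, s * (h + s ^ 2)⁻¹ = 2⁻¹ * Real.log (h + 4) - 2⁻¹ * Real.log h := by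
    rw [intervalIntegral.integral_eq_sub_of_hasDerivAt (f := fun s => 2⁻¹ * Real.log (h + s ^ 2))]
    · norm_num
    · intro s _
      have hp : h + s ^ 2 ≠ 0 := by positivity
      have := (((hasDerivAt_id' s).fun_pow 2).const_add h).log hp |>.const_mul (2⁻¹ : ℝ)
      refine this.congr_deriv ?_
      field_simp
      norm_num
    · exact hc.intervalIntegrable _ _
  rw [← ofReal_integral_eq_lintegral_ofReal (hc.intervalIntegrable 0 2).1,
    ← intervalIntegral.integral_of_le (by norm_num), hint]
  · apply ENNReal.ofReal_le_ofReal
    have := Real.log_le_sub_one_of_pos (by linarith : 0 < h + 4)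
    have := Real.log_nonpos hh.le h1
    linarith
  · filter_upwards [ae_restrict_mem measurableSet_Ioc] with s hs
    have := hs.1
    positivity

/-- The potential of a thin neighbourhood of a pole, squared distance. -/
theorem lintegral_sphere_inv_add_sq_le {n : ℕ} (hn : 2 ≤ n) :
    ∃ C : ℝ, 0 < C ∧ ∀ (e : Sph n) (h : ℝ), 0 < h → h ≤ 1 →
      ∫⁻ v : Sph n, ENNReal.ofReal ((h + ‖(v : Euc n) - e‖ ^ 2)⁻¹) ∂(sphereMeasure n) ≤
        ENNReal.ofReal (C * coneProfile n h) := by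
  obtain ⟨C, hC, H⟩ := lintegral_sphere_antitone_le hn
  refine ⟨C * 2 ^ n, by positivity, fun e h hh h1 => ?_⟩
  have hanti : AntitoneOn (fun s : ℝ => (h + s ^ 2)⁻¹) (Ici 0) := fun a ha b hb hab => by
    have : 0 ≤ a := ha
    simp only
    gcongr
  refine (H e (fun s => (h + s ^ 2)⁻¹) (by fun_prop) hanti (fun s => by positivity)).trans ?_
  rw [mul_assoc, ENNReal.ofReal_mul hC.le]
  gcongr
  have hcp := one_le_coneProfile n hh h1
  rcases (by omega : n = 2 ∨ n = 3 ∨ 4 ≤ n) with rfl | rfl | h4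
  · simp only [Nat.sub_self, pow_zero, one_mul]
    refine (lintegral_inv_add_sq_le hh).trans (ENNReal.ofReal_le_ofReal ?_)
    simp only [coneProfile, if_true]
    gcongr
    norm_num
  · simp only [Nat.reduceSub, pow_one]
    refine (lintegral_self_mul_inv_add_sq_le hh h1).trans (ENNReal.ofReal_le_ofReal ?_)
    simp only [coneProfile] at hcp ⊢
    norm_num at hcp ⊢
    linarith
  · calc ∫⁻ s in Ioc (0 : ℝ) 2, ENNReal.ofReal (s ^ (n - 2) * (h + s ^ 2)⁻¹)
        ≤ ∫⁻ s in Ioc (0 : ℝ) 2, ENNReal.ofReal (2 ^ (n - 4)) := by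
          refine setLIntegral_mono measurable_const fun s hs => ENNReal.ofReal_le_ofReal ?_
          have hs0 := hs.1
          have : n - 2 = (n - 4) + 2 := by omega
          rw [this, pow_add, mul_assoc]
          have h2 : s ^ 2 * (h + s ^ 2)⁻¹ ≤ 1 := by
            rw [mul_inv_le_iff₀ (by positivity)]; linarith
          calc s ^ (n - 4) * (s ^ 2 * (h + s ^ 2)⁻¹) ≤ 2 ^ (n - 4) * 1 := by
                have := hs.2
                gcongr
            _ = _ := mul_one _
      _ = ENNReal.ofReal (2 ^ (n - 4) * 2) := by
          rw [setLIntegral_const, Real.volume_Ioc, ← ENNReal.ofReal_mul (by positivity)]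
          norm_num
      _ ≤ ENNReal.ofReal (2 ^ n * coneProfile n h) := by
          apply ENNReal.ofReal_le_ofReal
          have : (2 : ℝ) ^ (n - 4) * 2 ≤ 2 ^ n := by
            rw [← pow_succ]
            exact pow_le_pow_right₀ (by norm_num) (by omega)
          nlinarith [show (0 : ℝ) < 2 ^ n by positivity]

/-- Scaling `s = √h u` predicts the power of `h`. With `q = √(h + s²)`, which dominates both `s` and
`√h`, all but two of the 2p factors `q` are spent on `s^(n-2)` and on `√h^(2p-n)`. The arctangent
integral remains. -/
theorem lintegral_sphere_inv_add_sq_pow_le {n : ℕ} (hn : 2 ≤ n) {p : ℕ} (hp : n ≤ 2 * p) :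
    ∃ C : ℝ, 0 < C ∧ ∀ (e : Sph n) (h : ℝ), 0 < h →
      ∫⁻ v : Sph n, ENNReal.ofReal (((h + ‖(v : Euc n) - e‖ ^ 2) ^ p)⁻¹) ∂(sphereMeasure n) ≤
        ENNReal.ofReal (C * (√h ^ (2 * p - (n - 1)))⁻¹) := by
  obtain ⟨C, hC, H⟩ := lintegral_sphere_antitone_le hn
  refine ⟨C * 2, by positivity, fun e h hh => ?_⟩
  have hanti : AntitoneOn (fun s : ℝ => ((h + s ^ 2) ^ p)⁻¹) (Ici 0) := fun a ha b hb hab => by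
    have : 0 ≤ a := ha
    simp only
    gcongr
  refine (H e (fun s => ((h + s ^ 2) ^ p)⁻¹) (by fun_prop) hanti (fun s => by positivity)).trans ?_
  rw [mul_assoc, ENNReal.ofReal_mul hC.le]
  gcongr
  have hs := Real.sqrt_pos.2 hh
  obtain ⟨m, hm⟩ : ∃ m, 2 * p = n + m := ⟨2 * p - n, by omega⟩
  have he : 2 * p - (n - 1) = m + 1 := by omega
  rw [he]
  calc ∫⁻ s in Ioc (0 : ℝ) 2, ENNReal.ofReal (s ^ (n - 2) * ((h + s ^ 2) ^ p)⁻¹)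
      ≤ ∫⁻ s in Ioc (0 : ℝ) 2, ENNReal.ofReal ((√h ^ m)⁻¹) * ENNReal.ofReal ((h + s ^ 2)⁻¹) := by
        refine setLIntegral_mono (by fun_prop) fun s hs' => ?_
        have hs0 := hs'.1
        rw [← ENNReal.ofReal_mul (by positivity)]
        apply ENNReal.ofReal_le_ofReal
        set q := √(h + s ^ 2) with hq
        have hq2 : h + s ^ 2 = q ^ 2 := (Real.sq_sqrt (by positivity)).symm
        have hqs : s ≤ q := Real.le_sqrt_of_sq_le (by linarith)
        have hqh : √h ≤ q := Real.sqrt_le_sqrt (by nlinarith)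
        have hq0 : 0 < q := hs.trans_le hqh
        rw [hq2, ← pow_mul, hm, ← mul_inv]
        rw [← div_eq_mul_inv, div_le_iff₀ (by positivity)]
        have : q ^ (n + m) = q ^ (n - 2) * (q ^ m * q ^ 2) := by
          rw [← pow_add, ← pow_add]; congr 1; omega
        rw [this]
        calc s ^ (n - 2) ≤ q ^ (n - 2) := by gcongr
          _ = (q ^ m * q ^ 2)⁻¹ * (q ^ (n - 2) * (q ^ m * q ^ 2)) := by field_simp
          _ ≤ (√h ^ m * q ^ 2)⁻¹ * (q ^ (n - 2) * (q ^ m * q ^ 2)) := by gcongr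
    _ = ENNReal.ofReal ((√h ^ m)⁻¹) * ∫⁻ s in Ioc (0 : ℝ) 2, ENNReal.ofReal ((h + s ^ 2)⁻¹) :=
        lintegral_const_mul' _ _ ENNReal.ofReal_ne_top
    _ ≤ ENNReal.ofReal ((√h ^ m)⁻¹) * ENNReal.ofReal (2 * (√h)⁻¹) := by
        gcongr
        exact lintegral_inv_add_sq_le hh
    _ = ENNReal.ofReal (2 * (√h ^ (m + 1))⁻¹) := by
        rw [← ENNReal.ofReal_mul (by positivity)]
        congr 1
        rw [pow_succ, mul_inv]
        ring


/-! ### The density of the last scattering event and its mean over directions -/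

theorem exists_unit_direction {n : ℕ} (hn : 2 ≤ n) (w : Euc n) :
    ∃ e : Sph n, w = ‖w‖ • (e : Euc n) := by
  have := nontrivial_euc hn
  rcases eq_or_ne w 0 with rfl | hw
  · obtain ⟨e, he⟩ := NormedSpace.sphere_nonempty (E := Euc n) (x := 0) |>.2 zero_le_one
    exact ⟨⟨e, he⟩, by simp⟩
  · have hw' : ‖w‖ ≠ 0 := norm_ne_zero_iff.2 hw
    exact ⟨⟨‖w‖⁻¹ • w, by simp [norm_smul, hw']⟩, by simp [smul_smul, hw']⟩

theorem norm_sph {n : ℕ} (v : Sph n) : ‖(v : Euc n)‖ = 1 := by simp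

/-- The chord `|v - e|` from the direction of `w` serves as coordinate on the sphere, because the
integrals above are expressed in it. -/
theorem sub_inner_eq {n : ℕ} {w : Euc n} {e : Sph n} (hw : w = ‖w‖ • (e : Euc n)) (t : ℝ)
    (v : Sph n) : t - inner ℝ w v = (t - ‖w‖) + ‖w‖ * ‖(v : Euc n) - e‖ ^ 2 / 2 := by
  have h1 : ‖(v : Euc n) - e‖ ^ 2 = 2 - 2 * inner ℝ (e : Euc n) v := by
    rw [norm_sub_sq_real, norm_sph, norm_sph, real_inner_comm]; ring
  have h2 : inner ℝ w (v : Euc n) = ‖w‖ * inner ℝ (e : Euc n) v := by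
    conv_lhs => rw [hw]
    rw [real_inner_smul_left]
  rw [h1, h2]; ring

theorem norm_sub_smul_sq {n : ℕ} (t : ℝ) (w : Euc n) (v : Sph n) :
    ‖w - t • (v : Euc n)‖ ^ 2 = ‖w‖ ^ 2 - 2 * t * inner ℝ w (v : Euc n) + t ^ 2 := by
  rw [norm_sub_sq_real, real_inner_smul_right, norm_smul, norm_sph, mul_one, Real.norm_eq_abs,
    sq_abs]; ring

theorem norm_sub_smul_sq_eq {n : ℕ} {w : Euc n} {e : Sph n} (hw : w = ‖w‖ • (e : Euc n)) (t : ℝ)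
    (v : Sph n) :
    ‖w - t • (v : Euc n)‖ ^ 2 = (t - ‖w‖) ^ 2 + t * ‖w‖ * ‖(v : Euc n) - e‖ ^ 2 := by
  have := sub_inner_eq hw t v
  rw [norm_sub_smul_sq]
  linear_combination 2 * t * this

theorem norm_sub_sph_sq_le {n : ℕ} (v e : Sph n) : ‖(v : Euc n) - e‖ ^ 2 ≤ 4 := by
  have := norm_sub_le (v : Euc n) e
  rw [norm_sph, norm_sph] at this
  nlinarith [norm_nonneg ((v : Euc n) - e)]

/-- For `|w| ≥ t/2` this is read off from the chord formula. For `|w| ≤ t/2` the term `t - |w| ≥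
t/2` alone suffices, as the squared chord is at most 4. -/
theorem le_sub_inner {n : ℕ} {w : Euc n} {e : Sph n} (hw : w = ‖w‖ • (e : Euc n)) {t : ℝ}
    (ht : ‖w‖ < t) (v : Sph n) :
    t / 10 * ((t - ‖w‖) / t + ‖(v : Euc n) - e‖ ^ 2) ≤ t - inner ℝ w v := by
  have h0 := norm_nonneg w
  have ht0 : 0 < t := h0.trans_lt ht
  have h4 := norm_sub_sph_sq_le v e
  have hq := sq_nonneg ‖(v : Euc n) - e‖
  rw [sub_inner_eq hw, mul_add, div_mul_div_comm, mul_comm t, mul_div_mul_right _ _ ht0.ne']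
  rcases le_total ‖w‖ (t / 2) with h | h <;> nlinarith

theorem le_norm_sub_smul_sq {n : ℕ} {w : Euc n} {e : Sph n} (hw : w = ‖w‖ • (e : Euc n)) {t : ℝ}
    (ht : ‖w‖ < t) (v : Sph n) :
    t ^ 2 / 20 * (((t - ‖w‖) / t) ^ 2 + ‖(v : Euc n) - e‖ ^ 2) ≤ ‖w - t • (v : Euc n)‖ ^ 2 := by
  have h0 := norm_nonneg w
  have ht0 : 0 < t := h0.trans_lt ht
  have h4 := norm_sub_sph_sq_le v e
  have hq := sq_nonneg ‖(v : Euc n) - e‖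
  rw [norm_sub_smul_sq_eq hw, mul_add]
  have : t ^ 2 / 20 * ((t - ‖w‖) / t) ^ 2 = (t - ‖w‖) ^ 2 / 20 := by field_simp
  rw [this]
  rcases le_total ‖w‖ (t / 2) with h | h
  · have h1 : (t / 2) ^ 2 ≤ (t - ‖w‖) ^ 2 := by gcongr; linarith
    nlinarith [mul_nonneg (mul_nonneg ht0.le h0) hq, mul_le_mul_of_nonneg_left h4 (sq_nonneg t)]
  · have h1 : t * (t / 2) ≤ t * ‖w‖ := by gcongr
    nlinarith [mul_le_mul_of_nonneg_right h1 hq, mul_nonneg (sq_nonneg t) hq, sq_nonneg (t - ‖w‖)]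

/-- The part of the kernel of a single scattering event that depends on the last direction. -/
noncomputable def scatterDensity {n : ℕ} (t : ℝ) (w : Euc n) (v : Sph n) : ℝ :=
  2 ^ (n - 2) * (t - inner ℝ w (v : Euc n)) ^ ((n : ℤ) - 3) / ‖w - t • (v : Euc n)‖ ^ (2 * n - 4)

theorem scatterDensity_two_le {w : Euc 2} {e : Sph 2} (hw : w = ‖w‖ • (e : Euc 2)) {t : ℝ}
    (ht : ‖w‖ < t) (v : Sph 2) :
    scatterDensity t w v ≤ 10 * t⁻¹ * ((t - ‖w‖) / t + ‖(v : Euc 2) - e‖ ^ 2)⁻¹ := by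
  have ht0 : 0 < t := (norm_nonneg w).trans_lt ht
  have h := le_sub_inner hw ht v
  have hη : 0 < (t - ‖w‖) / t := div_pos (by linarith) ht0
  have : scatterDensity t w v = (t - inner ℝ w (v : Euc 2))⁻¹ := by
    simp [scatterDensity]
  rw [this]
  calc (t - inner ℝ w (v : Euc 2))⁻¹ ≤ (t / 10 * ((t - ‖w‖) / t + ‖(v : Euc 2) - e‖ ^ 2))⁻¹ := by
        gcongr
    _ = _ := by rw [mul_inv, inv_div]; ring

/-- The numerator `(t - w·v)^(n-3)` is split into a power of the delay `t - |w|` and a power of `|w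
- tv|²/t` that cancels against the denominator. The two resulting terms are integrable in the chord
at scale `η`. -/
theorem scatterDensity_le {n : ℕ} (hn : 3 ≤ n) {w : Euc n} {e : Sph n}
    (hw : w = ‖w‖ • (e : Euc n)) {t : ℝ} (ht : ‖w‖ < t) (v : Sph n) :
    scatterDensity t w v ≤ 80 ^ n * (t ^ (n - 1))⁻¹ *
      (((t - ‖w‖) / t) ^ (n - 3) *
        ((((t - ‖w‖) / t) ^ 2 + ‖(v : Euc n) - e‖ ^ 2) ^ (n - 2))⁻¹ +
      (((t - ‖w‖) / t) ^ 2 + ‖(v : Euc n) - e‖ ^ 2)⁻¹) := by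
  have ht0 : 0 < t := (norm_nonneg w).trans_lt ht
  set η := (t - ‖w‖) / t with hηdef
  have hη : 0 < η := div_pos (by linarith) ht0
  have htη : t * η = t - ‖w‖ := by rw [hηdef]; field_simp
  set ρ := ‖(v : Euc n) - e‖
  have hQ := le_norm_sub_smul_sq hw ht v
  rw [← hηdef] at hQ
  obtain ⟨m, rfl⟩ : ∃ m, n = m + 3 := ⟨n - 3, by omega⟩
  have e1 : m + 3 - 3 = m := by omega
  have e2 : m + 3 - 2 = m + 1 := by omega
  have e3 : m + 3 - 1 = m + 2 := by omega
  have e4 : 2 * (m + 3) - 4 = 2 * (m + 1) := by omega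
  have e5 : ((m + 3 : ℕ) : ℤ) - 3 = m := by push_cast; ring
  unfold scatterDensity
  rw [e1, e2, e3, e4, e5, zpow_natCast, pow_mul]
  set P := η ^ 2 + ρ ^ 2
  have hP : 0 < P := by positivity
  set Q := ‖w - t • (v : Euc (m + 3))‖ ^ 2 with hQdef
  have hQ0 : 0 < Q := lt_of_lt_of_le (by positivity) hQ
  have ha : t - inner ℝ w (v : Euc (m + 3)) ≤ t * η + Q / t := by
    rw [sub_inner_eq hw, htη]
    have h1 : t * ‖w‖ * ρ ^ 2 ≤ Q := by
      rw [hQdef, norm_sub_smul_sq_eq hw]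
      nlinarith [sq_nonneg (t - ‖w‖)]
    have h2 : ‖w‖ * ρ ^ 2 ≤ Q / t := by
      rw [le_div_iff₀ ht0]; linarith
    have : 0 ≤ ‖w‖ * ρ ^ 2 := by positivity
    linarith
  have ha0 : 0 ≤ t - inner ℝ w (v : Euc (m + 3)) :=
    le_trans (by positivity) (le_sub_inner hw ht v)
  have hb : (t - inner ℝ w (v : Euc (m + 3))) ^ m ≤ 2 ^ m * ((t * η) ^ m + (Q / t) ^ m) := by
    have hA : 0 ≤ t * η := by positivity
    have hB : 0 ≤ Q / t := by positivity
    calc _ ≤ (t * η + Q / t) ^ m := by gcongr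
      _ ≤ (2 * max (t * η) (Q / t)) ^ m := by
          gcongr
          linarith [le_max_left (t * η) (Q / t), le_max_right (t * η) (Q / t)]
      _ = 2 ^ m * max (t * η) (Q / t) ^ m := mul_pow _ _ _
      _ ≤ _ := by
          gcongr
          rcases max_cases (t * η) (Q / t) with h | h <;> rw [h.1]
          · exact le_add_of_nonneg_right (by positivity)
          · exact le_add_of_nonneg_left (by positivity)
  have hQi : Q⁻¹ ≤ 20 * (t ^ 2)⁻¹ * P⁻¹ := by
    calc Q⁻¹ ≤ (t ^ 2 / 20 * P)⁻¹ := by gcongr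
      _ = _ := by rw [mul_inv, inv_div]; ring
  have hc : ((t * η) ^ m + (Q / t) ^ m) / Q ^ (m + 1) ≤
      20 ^ (m + 1) * (t ^ (m + 2))⁻¹ * (η ^ m * (P ^ (m + 1))⁻¹ + P⁻¹) := by
    have h1 : (t * η) ^ m / Q ^ (m + 1) ≤ 20 ^ (m + 1) * (t ^ (m + 2))⁻¹ * (η ^ m * (P ^ (m + 1))⁻¹) := by
      calc (t * η) ^ m / Q ^ (m + 1) = (t * η) ^ m * (Q⁻¹) ^ (m + 1) := by
            rw [div_eq_mul_inv, inv_pow]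
        _ ≤ (t * η) ^ m * (20 * (t ^ 2)⁻¹ * P⁻¹) ^ (m + 1) := by gcongr
        _ = _ := by
          rw [mul_pow, mul_pow, mul_pow, inv_pow, inv_pow, ← pow_mul]
          have : t ^ (2 * (m + 1)) = t ^ m * t ^ (m + 2) := by rw [← pow_add]; congr 1; omega
          rw [this]
          field_simp
    have h2 : (Q / t) ^ m / Q ^ (m + 1) ≤ 20 ^ (m + 1) * (t ^ (m + 2))⁻¹ * P⁻¹ := by
      calc (Q / t) ^ m / Q ^ (m + 1) = (t ^ m)⁻¹ * Q⁻¹ := by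
            rw [div_pow, pow_succ]; field_simp
        _ ≤ (t ^ m)⁻¹ * (20 * (t ^ 2)⁻¹ * P⁻¹) := by gcongr
        _ = 20 ^ 1 * (t ^ (m + 2))⁻¹ * P⁻¹ := by rw [pow_add, mul_inv]; ring
        _ ≤ _ := by
          gcongr
          · norm_num
          · omega
    rw [add_div, mul_add]
    exact add_le_add h1 h2
  calc 2 ^ (m + 1) * (t - inner ℝ w (v : Euc (m + 3))) ^ m / Q ^ (m + 1)
      ≤ 2 ^ (m + 1) * (2 ^ m * ((t * η) ^ m + (Q / t) ^ m)) / Q ^ (m + 1) := by gcongr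
    _ = 2 ^ (2 * m + 1) * (((t * η) ^ m + (Q / t) ^ m) / Q ^ (m + 1)) := by
        rw [two_mul, add_assoc, pow_add]; ring
    _ ≤ 2 ^ (2 * m + 1) * (20 ^ (m + 1) * (t ^ (m + 2))⁻¹ * (η ^ m * (P ^ (m + 1))⁻¹ + P⁻¹)) := by
        gcongr
    _ = (2 ^ (2 * m + 1) * 20 ^ (m + 1)) * ((t ^ (m + 2))⁻¹ * (η ^ m * (P ^ (m + 1))⁻¹ + P⁻¹)) := by
        ring
    _ ≤ 80 ^ (m + 3) * ((t ^ (m + 2))⁻¹ * (η ^ m * (P ^ (m + 1))⁻¹ + P⁻¹)) := by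
        gcongr
        calc (2 : ℝ) ^ (2 * m + 1) * 20 ^ (m + 1) ≤ 2 ^ (2 * (m + 1)) * 20 ^ (m + 1) := by
              gcongr
              · norm_num
              · omega
          _ = 80 ^ (m + 1) := by rw [pow_mul, ← mul_pow]; norm_num
          _ ≤ 80 ^ (m + 3) := by gcongr <;> norm_num
    _ = _ := by ring

/-- In dimension 2 the density is `1/(t - w·v)`, which degenerates at scale `η` and gives
`η^(-1/2)`. From dimension 3 on, the term `1/(η² + ρ²)`, with ρ the chord, gives the profile at
`η²`, comparable to that at `η`. For n ≥ 4 the other term is bounded because `η^(n-3)` exactly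
balances its singular integral. -/
theorem lintegral_scatterDensity_le {n : ℕ} (hn : 2 ≤ n) :
    ∃ C : ℝ, 0 < C ∧ ∀ (t : ℝ) (w : Euc n), ‖w‖ < t →
      ∫⁻ v : Sph n, ENNReal.ofReal (scatterDensity t w v) ∂(sphereMeasure n) ≤
        ENNReal.ofReal (C * (t ^ (n - 1))⁻¹ * coneProfile n ((t - ‖w‖) / t)) := by
  obtain ⟨C, hC, hJ⟩ := lintegral_sphere_inv_add_sq_le hn
  rcases hn.eq_or_lt with rfl | hn3
  · refine ⟨10 * C, by positivity, fun t w ht => ?_⟩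
    have ht0 : 0 < t := (norm_nonneg w).trans_lt ht
    obtain ⟨e, he⟩ := exists_unit_direction le_rfl w
    have hη : 0 < (t - ‖w‖) / t := div_pos (by linarith) ht0
    have hη1 : (t - ‖w‖) / t ≤ 1 := (div_le_one ht0).2 (by linarith [norm_nonneg w])
    calc _ ≤ ∫⁻ v : Sph 2, ENNReal.ofReal (10 * t⁻¹) *
            ENNReal.ofReal (((t - ‖w‖) / t + ‖(v : Euc 2) - e‖ ^ 2)⁻¹) ∂(sphereMeasure 2) := by
          refine lintegral_mono fun v => ?_
          rw [← ENNReal.ofReal_mul (by positivity)]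
          exact ENNReal.ofReal_le_ofReal (scatterDensity_two_le he ht v)
      _ ≤ ENNReal.ofReal (10 * t⁻¹) * ENNReal.ofReal (C * coneProfile 2 ((t - ‖w‖) / t)) := by
          rw [lintegral_const_mul' _ _ ENNReal.ofReal_ne_top]
          gcongr
          exact hJ e _ hη hη1
      _ = _ := by
          rw [← ENNReal.ofReal_mul (by positivity)]
          congr 1
          simp only [Nat.add_one_sub_one, pow_one]
          ring
  · have hn3' : 3 ≤ n := hn3
    have hA : ∃ D : ℝ, 0 < D ∧ ∀ (e : Sph n) (η : ℝ), 0 < η → η ≤ 1 →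
        ∫⁻ v : Sph n, ENNReal.ofReal (η ^ (n - 3) * ((η ^ 2 + ‖(v : Euc n) - e‖ ^ 2) ^ (n - 2))⁻¹)
          ∂(sphereMeasure n) ≤ ENNReal.ofReal (D * coneProfile n η) := by
      -- For n = 3 the exponent p = n - 2 violates n ≤ 2p. The term then coincides with `1/(η² +
      -- ρ²)` and is logarithmic.
      rcases hn3'.eq_or_lt with rfl | hn4
      · refine ⟨C * 2, by positivity, fun e η h0 h1 => ?_⟩
        simp only [Nat.sub_self, pow_zero, one_mul, Nat.reduceSub, pow_one]
        refine (hJ e _ (by positivity) (pow_le_one₀ h0.le h1)).trans (ENNReal.ofReal_le_ofReal ?_)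
        rw [mul_assoc]
        gcongr
        exact coneProfile_sq_le 3 le_rfl h0 h1
      · obtain ⟨D, hD, H⟩ := lintegral_sphere_inv_add_sq_pow_le hn (p := n - 2) (by omega)
        refine ⟨D, hD, fun e η h0 h1 => ?_⟩
        have h3 : 2 * (n - 2) - (n - 1) = n - 3 := by omega
        have := H e (η ^ 2) (by positivity)
        rw [Real.sqrt_sq h0.le, h3] at this
        calc _ = ENNReal.ofReal (η ^ (n - 3)) * ∫⁻ v : Sph n,
              ENNReal.ofReal (((η ^ 2 + ‖(v : Euc n) - e‖ ^ 2) ^ (n - 2))⁻¹) ∂(sphereMeasure n) := by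
              rw [← lintegral_const_mul' _ _ ENNReal.ofReal_ne_top]
              exact lintegral_congr fun v => ENNReal.ofReal_mul (by positivity)
          _ ≤ ENNReal.ofReal (η ^ (n - 3)) * ENNReal.ofReal (D * (η ^ (n - 3))⁻¹) := by gcongr
          _ = ENNReal.ofReal D := by
              rw [← ENNReal.ofReal_mul (by positivity)]
              congr 1
              field_simp
          _ ≤ _ := by
              apply ENNReal.ofReal_le_ofReal
              exact le_mul_of_one_le_right hD.le (one_le_coneProfile n h0 h1)
    obtain ⟨D, hD, hA⟩ := hA
    refine ⟨80 ^ n * (D + C * 2), by positivity, fun t w ht => ?_⟩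
    have ht0 : 0 < t := (norm_nonneg w).trans_lt ht
    obtain ⟨e, he⟩ := exists_unit_direction hn w
    set η := (t - ‖w‖) / t
    have hη : 0 < η := div_pos (by linarith) ht0
    have hη1 : η ≤ 1 := (div_le_one ht0).2 (by linarith [norm_nonneg w])
    have hcp := one_le_coneProfile n hη hη1
    have hB : ∫⁻ v : Sph n, ENNReal.ofReal ((η ^ 2 + ‖(v : Euc n) - e‖ ^ 2)⁻¹) ∂(sphereMeasure n) ≤
        ENNReal.ofReal (C * 2 * coneProfile n η) := by
      refine (hJ e _ (by positivity) (pow_le_one₀ hη.le hη1)).trans (ENNReal.ofReal_le_ofReal ?_)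
      rw [mul_assoc]
      gcongr
      exact coneProfile_sq_le n hn3' hη hη1
    calc _ ≤ ∫⁻ v : Sph n, ENNReal.ofReal (80 ^ n * (t ^ (n - 1))⁻¹) *
            (ENNReal.ofReal (η ^ (n - 3) * ((η ^ 2 + ‖(v : Euc n) - e‖ ^ 2) ^ (n - 2))⁻¹) +
            ENNReal.ofReal ((η ^ 2 + ‖(v : Euc n) - e‖ ^ 2)⁻¹)) ∂(sphereMeasure n) := by
          refine lintegral_mono fun v => ?_
          rw [← ENNReal.ofReal_add (by positivity) (by positivity),
            ← ENNReal.ofReal_mul (by positivity)]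
          exact ENNReal.ofReal_le_ofReal (scatterDensity_le hn3' he ht v)
      _ ≤ ENNReal.ofReal (80 ^ n * (t ^ (n - 1))⁻¹) *
            (ENNReal.ofReal (D * coneProfile n η) + ENNReal.ofReal (C * 2 * coneProfile n η)) := by
          rw [lintegral_const_mul' _ _ ENNReal.ofReal_ne_top, lintegral_add_left (by fun_prop)]
          gcongr
          exact hA e _ hη hη1
      _ = _ := by
          rw [← ENNReal.ofReal_add (by positivity) (by positivity),
            ← ENNReal.ofReal_mul (by positivity)]
          congr 1
          ring

/-! ### Ellipsoids in polar coordinates about a focus -/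

/-- The profile of the single scattering kernel at scale `T`, as a function of the time delay. -/
noncomputable def delayProfile (n : ℕ) (T : ℝ) (g : ℝ) : ℝ≥0∞ :=
  if 0 < g then ENNReal.ofReal (coneProfile n (g / T)) else 0

@[fun_prop]
theorem measurable_delayProfile {n : ℕ} {T : ℝ} : Measurable (delayProfile n T) := by
  unfold delayProfile
  exact Measurable.ite measurableSet_Ioi (by fun_prop) measurable_const

/-- The distance from a focus to the boundary of an ellipsoid, in the direction `v`. -/
noncomputable def focalRadius {n : ℕ} (τ : ℝ) (z : Euc n) (v : Sph n) : ℝ :=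
  (τ ^ 2 - ‖z‖ ^ 2) / (2 * (τ - inner ℝ z (v : Euc n)))

theorem inner_sph_le {n : ℕ} (z : Euc n) (v : Sph n) : inner ℝ z (v : Euc n) ≤ ‖z‖ := by
  have := real_inner_le_norm z (v : Euc n)
  rwa [norm_sph, mul_one] at this

theorem focalRadius_pos {n : ℕ} {τ : ℝ} {z : Euc n} (h : ‖z‖ < τ) (v : Sph n) :
    0 < focalRadius τ z v := by
  have := inner_sph_le z v
  have := norm_nonneg z
  apply div_pos <;> nlinarith

theorem delay_nonpos {n : ℕ} {τ : ℝ} {z : Euc n} (h : ‖z‖ < τ) (v : Sph n) {r : ℝ}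
    (hr : focalRadius τ z v ≤ r) : τ - r - ‖z - r • (v : Euc n)‖ ≤ 0 := by
  have h1 := inner_sph_le z v
  rw [focalRadius, div_le_iff₀ (by linarith)] at hr
  have h2 : (τ - r) ^ 2 ≤ ‖z - r • (v : Euc n)‖ ^ 2 := by
    rw [norm_sub_smul_sq]; nlinarith
  have := abs_le_of_sq_le_sq h2 (norm_nonneg _)
  linarith [le_abs_self (τ - r)]

/-- Along a ray from the focus the delay is concave, the norm being convex. It equals `τ - |z|` at
the focus and 0 at the focal radius, and hence lies above the chord. -/
theorem le_delay {n : ℕ} {τ : ℝ} {z : Euc n} (h : ‖z‖ < τ) (v : Sph n) {r : ℝ}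
    (hr0 : 0 ≤ r) (hr : r ≤ focalRadius τ z v) :
    (τ - ‖z‖) * (1 - r / focalRadius τ z v) ≤ τ - r - ‖z - r • (v : Euc n)‖ := by
  have hR := focalRadius_pos h v
  set R := focalRadius τ z v with hRdef
  have h1 := inner_sph_le z v
  have hRτ : R ≤ τ := by
    rw [hRdef, focalRadius, div_le_iff₀ (by linarith)]
    have h2 : -‖z‖ ≤ inner ℝ z (v : Euc n) := by
      have := (abs_le.1 (abs_real_inner_le_norm z (v : Euc n))).1
      rwa [norm_sph, mul_one] at this
    have := sq_nonneg (τ - ‖z‖)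
    nlinarith [norm_nonneg z]
  have hRn : ‖z - R • (v : Euc n)‖ = τ - R := by
    have : ‖z - R • (v : Euc n)‖ ^ 2 = (τ - R) ^ 2 := by
      have hR2 : R * (2 * (τ - inner ℝ z (v : Euc n))) = τ ^ 2 - ‖z‖ ^ 2 := by
        rw [hRdef, focalRadius, div_mul_cancel₀ _ (by linarith)]
      rw [norm_sub_smul_sq]; linarith
    exact (sq_eq_sq₀ (norm_nonneg _) (by linarith)).1 this
  set u := r / R with hu
  have hu0 : 0 ≤ u := by positivity
  have hu1 : u ≤ 1 := (div_le_one hR).2 hr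
  have hru : r = u * R := by rw [hu]; field_simp
  have : z - r • (v : Euc n) = (1 - u) • z + u • (z - R • (v : Euc n)) := by
    rw [hru]; module
  have h3 : ‖z - r • (v : Euc n)‖ ≤ (1 - u) * ‖z‖ + u * (τ - R) := by
    rw [this]
    refine (norm_add_le _ _).trans ?_
    rw [norm_smul, norm_smul, hRn, Real.norm_of_nonneg hu0, Real.norm_of_nonneg (by linarith)]
  have h4 : τ - r - ((1 - u) * ‖z‖ + u * (τ - R)) = (τ - ‖z‖) * (1 - u) := by rw [hru]; ring
  linarith

theorem lintegral_inv_sqrt_le {R : ℝ} (hR : 0 < R) :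
    ∫⁻ r in Ioo (0 : ℝ) R, ENNReal.ofReal ((√(1 - r / R))⁻¹) ≤ ENNReal.ofReal (2 * R) := by
  have hcont : ContinuousOn (fun r : ℝ => -(2 * R) * √(1 - r / R)) (Icc 0 R) := by fun_prop
  have hderiv : ∀ r ∈ Ioo (0 : ℝ) R,
      HasDerivAt (fun r : ℝ => -(2 * R) * √(1 - r / R)) ((√(1 - r / R))⁻¹) r := fun r hr => by
    have hu0 : 0 < 1 - r / R := by
      rw [sub_pos, div_lt_one hR]; exact hr.2
    have := ((((hasDerivAt_id' r).div_const R).const_sub 1).sqrt hu0.ne').const_mul (-(2 * R))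
    refine this.congr_deriv ?_
    field_simp
  -- The integrand blows up at `R`. Its integrability comes from being the nonnegative derivative of
  -- a function continuous up to `R`.
  have hint := intervalIntegral.integrableOn_deriv_of_nonneg hcont hderiv
    fun r _ => inv_nonneg.2 (Real.sqrt_nonneg _)
  have hval := intervalIntegral.integral_eq_sub_of_hasDerivAt_of_le hR.le hcont hderiv
    ((intervalIntegrable_iff_integrableOn_Ioc_of_le hR.le).2 hint)
  rw [intervalIntegral.integral_of_le hR.le] at hval
  rw [restrict_Ioo_eq_restrict_Ioc, ← ofReal_integral_eq_lintegral_ofReal hint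
    (Eventually.of_forall fun r => inv_nonneg.2 (Real.sqrt_nonneg _)), hval]
  simp [hR.ne']

/-- By the chord bound for the delay, the profile at `r` is at most its value at the focus times `(1
- r/R)^(-1/2)`, whose integral over the ray is `2R`. -/
theorem lintegral_radial_delay_le {n : ℕ} {T τ : ℝ} {z : Euc n} (hT : τ ≤ T)
    (h : ‖z‖ < τ) (v : Sph n) (m : ℕ) :
    ∫⁻ r in Ioi (0 : ℝ), ENNReal.ofReal (r ^ m) *
        delayProfile n T (τ - r - ‖z - r • (v : Euc n)‖) ≤
      ENNReal.ofReal (2 * focalRadius τ z v ^ (m + 1) * coneProfile n ((τ - ‖z‖) / T)) := by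
  have hR := focalRadius_pos h v
  set R := focalRadius τ z v with hRdef
  have hτ0 : 0 < τ := (norm_nonneg z).trans_lt h
  have hT0 : 0 < T := by linarith
  set c := (τ - ‖z‖) / T with hc
  have hc0 : 0 < c := div_pos (by linarith) hT0
  have hc1 : c ≤ 1 := (div_le_one hT0).2 (by linarith [norm_nonneg z])
  have hcp := one_le_coneProfile n hc0 hc1
  calc _ ≤ ∫⁻ r in Ioi (0 : ℝ), (Ioo 0 R).indicator (fun r =>
        ENNReal.ofReal (R ^ m * coneProfile n c) * ENNReal.ofReal ((√(1 - r / R))⁻¹)) r := by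
        refine setLIntegral_mono ?_ fun r hr => ?_
        · exact Measurable.indicator (by fun_prop) measurableSet_Ioo
        have hr0 : 0 < r := hr
        rcases lt_or_ge r R with hrR | hrR
        · rw [indicator_of_mem (show r ∈ Ioo 0 R from ⟨hr0, hrR⟩), ← ENNReal.ofReal_mul (by positivity)]
          unfold delayProfile
          split_ifs with hg
          · rw [← ENNReal.ofReal_mul (by positivity)]
            apply ENNReal.ofReal_le_ofReal
            have hu0 : 0 < 1 - r / R := by
              rw [sub_pos, div_lt_one hR]; exact hrR
            have hu1 : 1 - r / R ≤ 1 := by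
              have : 0 ≤ r / R := by positivity
              linarith
            have h1 : coneProfile n ((τ - r - ‖z - r • (v : Euc n)‖) / T) ≤
                (√(1 - r / R))⁻¹ * coneProfile n c := by
              refine (coneProfile_anti n (mul_pos hc0 hu0) ?_).trans
                (coneProfile_mul_le n hc0 hc1 hu0 hu1)
              rw [hc, div_mul_eq_mul_div]
              gcongr
              exact le_delay h v hr0.le hrR.le
            calc _ ≤ r ^ m * ((√(1 - r / R))⁻¹ * coneProfile n c) := by gcongr
              _ ≤ R ^ m * ((√(1 - r / R))⁻¹ * coneProfile n c) := by gcongr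
              _ = _ := by ring
          · simp
        · rw [delayProfile, if_neg (not_lt.2 (delay_nonpos h v hrR)), mul_zero]
          exact zero_le
    _ = ENNReal.ofReal (R ^ m * coneProfile n c) *
          ∫⁻ r in Ioo (0 : ℝ) R, ENNReal.ofReal ((√(1 - r / R))⁻¹) := by
        rw [setLIntegral_indicator measurableSet_Ioo, inter_eq_left.2 Ioo_subset_Ioi_self,
          lintegral_const_mul' _ _ ENNReal.ofReal_ne_top]
    _ ≤ ENNReal.ofReal (R ^ m * coneProfile n c) * ENNReal.ofReal (2 * R) := by
        gcongr
        exact lintegral_inv_sqrt_le hR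
    _ = _ := by
        rw [← ENNReal.ofReal_mul (by positivity)]
        congr 1
        ring

/-- Since `τ² - |z|² ≤ 2τ(τ - |z|)`, powers of the focal radius become the chord potentials already
integrated over the sphere. -/
theorem focalRadius_le {n : ℕ} {τ : ℝ} {z : Euc n} {e : Sph n} (he : z = ‖z‖ • (e : Euc n))
    (h : ‖z‖ < τ) (v : Sph n) :
    focalRadius τ z v ≤ 10 * (τ - ‖z‖) * ((τ - ‖z‖) / τ + ‖(v : Euc n) - e‖ ^ 2)⁻¹ := by
  have hτ0 : 0 < τ := (norm_nonneg z).trans_lt h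
  have h1 := le_sub_inner he h v
  have hη : 0 < (τ - ‖z‖) / τ := div_pos (by linarith) hτ0
  set P := (τ - ‖z‖) / τ + ‖(v : Euc n) - e‖ ^ 2
  have hP : 0 < P := by positivity
  rw [focalRadius, div_le_iff₀ (by nlinarith [mul_pos hτ0 hP])]
  have h2 : 10 * (τ - ‖z‖) * P⁻¹ * (2 * (τ / 10 * P)) = 2 * τ * (τ - ‖z‖) := by
    field_simp
  have h3 : 10 * (τ - ‖z‖) * P⁻¹ * (2 * (τ / 10 * P)) ≤
      10 * (τ - ‖z‖) * P⁻¹ * (2 * (τ - inner ℝ z (v : Euc n))) := by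
    have : 0 ≤ τ - ‖z‖ := by linarith
    gcongr
  nlinarith [norm_nonneg z]

theorem delayProfile_eq_zero {n : ℕ} {T τ : ℝ} {z y : Euc n} (h : τ ≤ ‖z‖) :
    delayProfile n T (τ - ‖y‖ - ‖z - y‖) = 0 := by
  rw [delayProfile, if_neg]
  have := norm_add_le y (z - y)
  rw [add_sub_cancel] at this
  linarith

/-- Two legs: the potential at a focus of the profile on an ellipsoid. -/
theorem lintegral_radialWeight_delay_le {n : ℕ} (hn : 2 ≤ n) :
    ∃ C : ℝ, 0 < C ∧ ∀ (T τ : ℝ) (z : Euc n), τ ≤ T →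
      ∫⁻ y, radialWeight y * delayProfile n T (τ - ‖y‖ - ‖z - y‖) ≤
        if 0 < τ - ‖z‖ then
          ENNReal.ofReal (C * (τ - ‖z‖) * coneProfile n ((τ - ‖z‖) / T) ^ 2) else 0 := by
  obtain ⟨C, hC, hJ⟩ := lintegral_sphere_inv_add_sq_le hn
  refine ⟨20 * C, by positivity, fun T τ z hT => ?_⟩
  split_ifs with h
  swap
  · simp [delayProfile_eq_zero (n := n) (T := T) (τ := τ) (z := z) (by linarith)]
  replace h : ‖z‖ < τ := by linarith
  have hτ0 : 0 < τ := (norm_nonneg z).trans_lt h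
  have hT0 : 0 < T := by linarith
  have hε : 0 < τ - ‖z‖ := by linarith
  have hc0 : 0 < (τ - ‖z‖) / T := div_pos (by linarith) hT0
  have hc1 : (τ - ‖z‖) / T ≤ 1 := (div_le_one hT0).2 (by linarith [norm_nonneg z])
  have hcp := one_le_coneProfile n hc0 hc1
  obtain ⟨e, he⟩ := exists_unit_direction hn z
  rw [lintegral_radialWeight_mul hn (by fun_prop)]
  -- The profile appears squared: once from each ray, and once from the mean of the focal radius
  -- over directions.
  calc _ ≤ ∫⁻ v : Sph n, ENNReal.ofReal (20 * (τ - ‖z‖) * coneProfile n ((τ - ‖z‖) / T)) *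
        ENNReal.ofReal (((τ - ‖z‖) / τ + ‖(v : Euc n) - e‖ ^ 2)⁻¹) ∂(sphereMeasure n) := by
        refine lintegral_mono fun v => ?_
        have h1 := lintegral_radial_delay_le hT h v 0
        simp only [pow_zero, ENNReal.ofReal_one, one_mul, zero_add, pow_one] at h1
        rw [← ENNReal.ofReal_mul (by positivity)]
        refine le_trans (le_of_eq ?_) (h1.trans (ENNReal.ofReal_le_ofReal ?_))
        · refine setLIntegral_congr_fun measurableSet_Ioi fun r hr => ?_
          rw [norm_smul, norm_sph, mul_one, Real.norm_of_nonneg (le_of_lt hr)]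
        · have := focalRadius_le he h v
          calc _ ≤ 2 * (10 * (τ - ‖z‖) * ((τ - ‖z‖) / τ + ‖(v : Euc n) - e‖ ^ 2)⁻¹) *
                coneProfile n ((τ - ‖z‖) / T) := by gcongr
            _ = _ := by ring
    _ ≤ ENNReal.ofReal (20 * (τ - ‖z‖) * coneProfile n ((τ - ‖z‖) / T)) *
        ENNReal.ofReal (C * coneProfile n ((τ - ‖z‖) / τ)) := by
        rw [lintegral_const_mul' _ _ ENNReal.ofReal_ne_top]
        gcongr
        exact hJ e _ (div_pos hε hτ0) ((div_le_one hτ0).2 (by linarith [norm_nonneg z]))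
    _ ≤ _ := by
        rw [← ENNReal.ofReal_mul (by positivity)]
        apply ENNReal.ofReal_le_ofReal
        have : coneProfile n ((τ - ‖z‖) / τ) ≤ coneProfile n ((τ - ‖z‖) / T) := by
          apply coneProfile_anti n hc0
          gcongr
        calc _ ≤ 20 * (τ - ‖z‖) * coneProfile n ((τ - ‖z‖) / T) *
              (C * coneProfile n ((τ - ‖z‖) / T)) := by gcongr
          _ = _ := by ring

/-- The integral of the profile on an ellipsoid. -/
theorem lintegral_delay_le {n : ℕ} (hn : 2 ≤ n) :
    ∃ C : ℝ, 0 < C ∧ ∀ (T τ : ℝ) (z : Euc n), τ ≤ T →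
      ∫⁻ y, delayProfile n T (τ - ‖y‖ - ‖z - y‖) ≤
        if 0 < τ - ‖z‖ then ENNReal.ofReal (C * √T ^ (n + 1) *
          (√(τ - ‖z‖) ^ (n - 1) * coneProfile n ((τ - ‖z‖) / T))) else 0 := by
  obtain ⟨C, hC, hJ⟩ := lintegral_sphere_inv_add_sq_pow_le hn (p := n) (by omega)
  refine ⟨2 * 10 ^ n * C, by positivity, fun T τ z hT => ?_⟩
  split_ifs with h
  swap
  · simp [delayProfile_eq_zero (n := n) (T := T) (τ := τ) (z := z) (by linarith)]
  replace h : ‖z‖ < τ := by linarith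
  have hτ0 : 0 < τ := (norm_nonneg z).trans_lt h
  have hT0 : 0 < T := by linarith
  have hε : 0 < τ - ‖z‖ := by linarith
  have hc0 : 0 < (τ - ‖z‖) / T := div_pos (by linarith) hT0
  have hc1 : (τ - ‖z‖) / T ≤ 1 := (div_le_one hT0).2 (by linarith [norm_nonneg z])
  have hcp := one_le_coneProfile n hc0 hc1
  have hη : 0 < (τ - ‖z‖) / τ := div_pos hε hτ0
  obtain ⟨e, he⟩ := exists_unit_direction hn z
  rw [lintegral_polar hn (by fun_prop)]
  calc _ ≤ ∫⁻ v : Sph n, ENNReal.ofReal (2 * 10 ^ n * (τ - ‖z‖) ^ n *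
          coneProfile n ((τ - ‖z‖) / T)) *
        ENNReal.ofReal ((((τ - ‖z‖) / τ + ‖(v : Euc n) - e‖ ^ 2) ^ n)⁻¹) ∂(sphereMeasure n) := by
        refine lintegral_mono fun v => ?_
        have h1 := lintegral_radial_delay_le hT h v (n - 1)
        rw [Nat.sub_add_cancel (by omega)] at h1
        rw [← ENNReal.ofReal_mul (by positivity)]
        refine le_trans (le_of_eq ?_) (h1.trans (ENNReal.ofReal_le_ofReal ?_))
        · refine setLIntegral_congr_fun measurableSet_Ioi fun r hr => ?_
          rw [norm_smul, norm_sph, mul_one, Real.norm_of_nonneg (le_of_lt hr)]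
        · have := focalRadius_le he h v
          have := (focalRadius_pos h v).le
          calc _ ≤ 2 * (10 * (τ - ‖z‖) * ((τ - ‖z‖) / τ + ‖(v : Euc n) - e‖ ^ 2)⁻¹) ^ n *
                coneProfile n ((τ - ‖z‖) / T) := by gcongr
            _ = _ := by rw [mul_pow, mul_pow, inv_pow]; ring
    _ ≤ ENNReal.ofReal (2 * 10 ^ n * (τ - ‖z‖) ^ n * coneProfile n ((τ - ‖z‖) / T)) *
        ENNReal.ofReal (C * (√((τ - ‖z‖) / τ) ^ (2 * n - (n - 1)))⁻¹) := by
        rw [lintegral_const_mul' _ _ ENNReal.ofReal_ne_top]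
        gcongr
        exact hJ e _ hη
    _ ≤ _ := by
        rw [← ENNReal.ofReal_mul (by positivity)]
        apply ENNReal.ofReal_le_ofReal
        -- Bookkeeping of powers: `(τ-|z|)^n` divided by `((τ-|z|)/τ)^((n+1)/2)` leaves
        -- `(τ-|z|)^((n-1)/2) τ^((n+1)/2)`.
        have e1 : 2 * n - (n - 1) = n + 1 := by omega
        rw [e1, Real.sqrt_div hε.le]
        set a := √(τ - ‖z‖) with ha
        have ha0 : 0 < a := Real.sqrt_pos.2 hε
        have haa : τ - ‖z‖ = a ^ 2 := (Real.sq_sqrt hε.le).symm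
        have hn' : (τ - ‖z‖) ^ n = a ^ (n - 1) * a ^ (n + 1) := by
          rw [haa, ← pow_mul, ← pow_add]; congr 1; omega
        rw [hn']
        have hs : √τ ≤ √T := Real.sqrt_le_sqrt hT
        have hsτ := Real.sqrt_pos.2 hτ0
        calc 2 * 10 ^ n * (a ^ (n - 1) * a ^ (n + 1)) * coneProfile n ((τ - ‖z‖) / T) *
              (C * ((a / √τ) ^ (n + 1))⁻¹)
            = 2 * 10 ^ n * C * √τ ^ (n + 1) * (a ^ (n - 1) * coneProfile n ((τ - ‖z‖) / T)) := by
              rw [div_pow, inv_div]; field_simp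
          _ ≤ _ := by gcongr


/-! ### Chains of displacements -/

theorem lintegral_fin_cons {n j : ℕ} {f : (Fin (j + 1) → Euc n) → ℝ≥0∞} (hf : Measurable f) :
    ∫⁻ y, f y = ∫⁻ u : Euc n, ∫⁻ y : Fin j → Euc n, f (Fin.cons u y) := by
  have hmp := volume_preserving_piFinSuccAbove (fun _ : Fin (j + 1) => Euc n) 0
  have hsymm := hmp.symm
  rw [← hsymm.lintegral_comp hf, Measure.volume_eq_prod]
  have hm : Measurable fun p : Euc n × (Fin j → Euc n) =>
      f ((MeasurableEquiv.piFinSuccAbove (fun _ : Fin (j + 1) => Euc n) 0).symm p) :=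
    hf.comp hsymm.measurable
  refine (lintegral_prod (μ := (volume : Measure (Euc n)))
    (ν := (volume : Measure (Fin j → Euc n))) _ hm.aemeasurable).trans ?_
  refine lintegral_congr fun u => lintegral_congr fun y => ?_
  congr 1
  exact Fin.insertNth_zero' u y

/-- In polar coordinates only `∫₀^τ (τ-r)^j dr` remains. This produces the factorial that makes the
series over collisions converge. -/
theorem lintegral_radialWeight_pow {n : ℕ} (hn : 2 ≤ n) (j : ℕ) (τ : ℝ) :
    ∫⁻ u : Euc n, radialWeight u *
      (if ‖u‖ < τ then ENNReal.ofReal (((sphereMeasure n).real univ * (τ - ‖u‖)) ^ j / j.factorial)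
        else 0) ≤
    ENNReal.ofReal (((sphereMeasure n).real univ * τ) ^ (j + 1) / (j + 1).factorial) := by
  set s := (sphereMeasure n).real univ with hs
  have hs0 : 0 ≤ s := measureReal_nonneg
  rw [lintegral_radialWeight_mul hn]
  swap
  · exact Measurable.ite (measurableSet_lt (by fun_prop) measurable_const) (by fun_prop)
      measurable_const
  rcases le_or_gt τ 0 with hτ | hτ
  · have : ∀ v : Sph n, ∫⁻ r in Ioi (0 : ℝ), (if ‖r • (v : Euc n)‖ < τ then
        ENNReal.ofReal ((s * (τ - ‖r • (v : Euc n)‖)) ^ j / j.factorial) else 0) = 0 := fun v => by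
      rw [lintegral_congr (g := fun _ => 0) fun r => if_neg (by
        have := norm_nonneg (r • (v : Euc n)); linarith), lintegral_zero]
    simp [this]
  · have key : ∀ v : Sph n, ∫⁻ r in Ioi (0 : ℝ), (if ‖r • (v : Euc n)‖ < τ then
        ENNReal.ofReal ((s * (τ - ‖r • (v : Euc n)‖)) ^ j / j.factorial) else 0) =
        ENNReal.ofReal (s ^ j * τ ^ (j + 1) / (j + 1).factorial) := fun v => by
      have h1 : ∀ r ∈ Ioi (0 : ℝ), (if ‖r • (v : Euc n)‖ < τ then
          ENNReal.ofReal ((s * (τ - ‖r • (v : Euc n)‖)) ^ j / j.factorial) else 0) =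
          (Iio τ).indicator (fun r => ENNReal.ofReal ((s * (τ - r)) ^ j / j.factorial)) r := by
        intro r hr
        rw [norm_smul, norm_sph, mul_one, Real.norm_of_nonneg (le_of_lt hr)]
        simp [indicator]
      have hc : Continuous fun r : ℝ => (s * (τ - r)) ^ j / j.factorial := by fun_prop
      have hval : ∫ r in (0 : ℝ)..τ, (s * (τ - r)) ^ j / j.factorial =
          s ^ j * τ ^ (j + 1) / (j + 1).factorial := by
        simp only [mul_pow]
        rw [intervalIntegral.integral_div, intervalIntegral.integral_const_mul,
          intervalIntegral.integral_comp_sub_left (fun x => x ^ j) τ, integral_pow]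
        rw [Nat.factorial_succ]
        have : (j.factorial : ℝ) ≠ 0 := by positivity
        push_cast
        simp
        field_simp
      rw [setLIntegral_congr_fun measurableSet_Ioi h1, setLIntegral_indicator measurableSet_Iio,
        Iio_inter_Ioi, restrict_Ioo_eq_restrict_Ioc,
        ← ofReal_integral_eq_lintegral_ofReal (hc.intervalIntegrable 0 τ).1,
        ← intervalIntegral.integral_of_le hτ.le, hval]
      filter_upwards [ae_restrict_mem measurableSet_Ioc] with r hr
      have : 0 ≤ τ - r := by linarith [hr.2]
      simp only [Pi.zero_apply]
      positivity
    rw [lintegral_congr key, lintegral_const, ← ofReal_measureReal, ← hs,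
      ← ENNReal.ofReal_mul (by positivity)]
    apply le_of_eq
    congr 1
    ring

/-- The displacements are peeled off one by one, leaving the last with its own weight `q`, which is
`radialWeight` in the general case and 1 in the interior case. The scale `T` stays fixed while `τ`
decreases, so that `F` and `H` do not change during the induction. -/
theorem lintegral_chain_le {n : ℕ} (hn : 2 ≤ n) {q : Euc n → ℝ≥0∞} (hq : Measurable q)
    {F : ℝ → ℝ≥0∞} (hF : Measurable F) {H : ℝ → ℝ≥0∞} {T : ℝ} (hH0 : ∀ a ≤ 0, H a = 0)
    (hHmono : ∀ a b, a ≤ b → b ≤ T → H a ≤ H b)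
    (hbase : ∀ (τ : ℝ) (z : Euc n), τ ≤ T → ∫⁻ y, q y * F (τ - ‖y‖ - ‖z - y‖) ≤ H (τ - ‖z‖))
    (j : ℕ) : ∀ (τ : ℝ) (z : Euc n), τ ≤ T →
    ∫⁻ y : Fin (j + 1) → Euc n, (∏ i : Fin j, radialWeight (y i.castSucc)) * q (y (Fin.last j)) *
        F (τ - ∑ i, ‖y i‖ - ‖z - ∑ i, y i‖) ≤
      ENNReal.ofReal (((sphereMeasure n).real univ * τ) ^ j / j.factorial) * H (τ - ‖z‖) := by
  induction j with
  | zero =>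
    intro τ z hτ
    have hmp := volume_preserving_funUnique (Fin 1) (Euc n)
    have hm : Measurable fun u : Euc n => q u * F (τ - ‖u‖ - ‖z - u‖) := by fun_prop
    have := hmp.lintegral_comp hm
    simp only [MeasurableEquiv.funUnique_apply] at this
    simp only [Finset.univ_eq_empty, Finset.prod_empty, one_mul, pow_zero, Nat.factorial_zero,
      Nat.cast_one, div_one, ENNReal.ofReal_one]
    refine le_trans (le_of_eq ?_) (hbase τ z hτ)
    rw [← this]
    refine lintegral_congr fun y => ?_
    simp [Fin.default_eq_zero]
  | succ j ih =>
    intro τ z hτ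
    set s := (sphereMeasure n).real univ with hs
    have hs0 : 0 ≤ s := measureReal_nonneg
    rw [lintegral_fin_cons (by fun_prop)]
    calc _ = ∫⁻ u : Euc n, radialWeight u * ∫⁻ y : Fin (j + 1) → Euc n,
          (∏ i : Fin j, radialWeight (y i.castSucc)) * q (y (Fin.last j)) *
            F ((τ - ‖u‖) - ∑ i, ‖y i‖ - ‖(z - u) - ∑ i, y i‖) := by
          refine lintegral_congr fun u => ?_
          rw [← lintegral_const_mul _ (by fun_prop)]
          refine lintegral_congr fun y => ?_
          have e1 : ∑ i, ‖(Fin.cons u y : Fin (j + 1 + 1) → Euc n) i‖ = ‖u‖ + ∑ i, ‖y i‖ := by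
            rw [Fin.sum_univ_succ]
            simp only [Fin.cons_zero, Fin.cons_succ]
          have e2 : ∑ i, (Fin.cons u y : Fin (j + 1 + 1) → Euc n) i = u + ∑ i, y i := by
            rw [Fin.sum_univ_succ]
            simp only [Fin.cons_zero, Fin.cons_succ]
          rw [e1, e2, Fin.prod_univ_succ, ← Fin.succ_last]
          simp only [Fin.castSucc_zero, Fin.cons_zero, Fin.cons_succ, ← Fin.succ_castSucc]
          rw [sub_sub τ ‖u‖, sub_sub z u, mul_assoc, mul_assoc, mul_assoc]
      _ ≤ ∫⁻ u : Euc n, radialWeight u * (if ‖u‖ < τ then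
            ENNReal.ofReal ((s * (τ - ‖u‖)) ^ j / j.factorial) else 0) * H (τ - ‖z‖) := by
          refine lintegral_mono fun u => ?_
          rw [mul_assoc]
          gcongr
          refine (ih (τ - ‖u‖) (z - u) (by linarith [norm_nonneg u])).trans ?_
          -- The triangle inequality: a detour by `u` can only reduce the delay, so a monotone `H`
          -- comes out of the integral over `u`.
          have htri : τ - ‖u‖ - ‖z - u‖ ≤ τ - ‖z‖ := by
            have := norm_add_le u (z - u)
            rw [add_sub_cancel] at this
            linarith
          split_ifs with hu
          · gcongr
            exact hHmono _ _ htri (by linarith [norm_nonneg z])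
          · rw [hH0 _ (by linarith [norm_nonneg (z - u)]), mul_zero]
            exact zero_le
      _ ≤ _ := by
          have hm : Measurable fun u : Euc n => radialWeight u * (if ‖u‖ < τ then
              ENNReal.ofReal ((s * (τ - ‖u‖)) ^ j / j.factorial) else 0) :=
            measurable_radialWeight.mul (Measurable.ite
              (measurableSet_lt (by fun_prop) measurable_const) (by fun_prop) measurable_const)
          rw [lintegral_mul_const _ hm]
          gcongr
          exact lintegral_radialWeight_pow hn j τ

/-- With the other displacements fixed, the reflection exchanging `y_i` and `z - Σ y_l` preserves
Lebesgue measure as well as the total length. It only moves the missing weight from one leg to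
another. -/
theorem lintegral_swap {n j : ℕ} (i : Fin j) {F : ℝ → ℝ≥0∞} (hF : Measurable F) (τ : ℝ)
    (z : Euc n) :
    ∫⁻ y : Fin j → Euc n, radialWeight (z - ∑ l, y l) *
        (∏ l ∈ Finset.univ.erase i, radialWeight (y l)) * F (τ - ∑ l, ‖y l‖ - ‖z - ∑ l, y l‖) =
      ∫⁻ y : Fin j → Euc n, (∏ l, radialWeight (y l)) * F (τ - ∑ l, ‖y l‖ - ‖z - ∑ l, y l‖) := by
  simp only [volume_pi]
  refine lintegral_eq_of_lmarginal_eq {i} (by fun_prop) (by fun_prop) ?_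
  simp only [lmarginal_singleton]
  funext x
  set c := z - ∑ l ∈ Finset.univ.erase i, x l with hc
  have hmem := Finset.mem_univ i
  have hsum : ∀ u : Euc n, ∑ l, Function.update x i u l = u + ∑ l ∈ Finset.univ.erase i, x l := by
    intro u
    rw [← Finset.add_sum_erase _ _ hmem, Function.update_self]
    congr 1
    exact Finset.sum_congr rfl fun l hl => by
      rw [Function.update_of_ne (Finset.ne_of_mem_erase hl)]
  have hsumn : ∀ u : Euc n, ∑ l, ‖Function.update x i u l‖ =
      ‖u‖ + ∑ l ∈ Finset.univ.erase i, ‖x l‖ := by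
    intro u
    rw [← Finset.add_sum_erase _ _ hmem, Function.update_self]
    congr 1
    exact Finset.sum_congr rfl fun l hl => by
      rw [Function.update_of_ne (Finset.ne_of_mem_erase hl)]
  have hprod : ∀ u : Euc n, ∏ l ∈ Finset.univ.erase i, radialWeight (Function.update x i u l) =
      ∏ l ∈ Finset.univ.erase i, radialWeight (x l) := fun u =>
    Finset.prod_congr rfl fun l hl => by
      rw [Function.update_of_ne (Finset.ne_of_mem_erase hl)]
  have hprod' : ∀ u : Euc n, ∏ l, radialWeight (Function.update x i u l) =
      radialWeight u * ∏ l ∈ Finset.univ.erase i, radialWeight (x l) := fun u => by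
    rw [← Finset.mul_prod_erase _ _ hmem, Function.update_self, hprod]
  have hz : ∀ u : Euc n, z - (u + ∑ l ∈ Finset.univ.erase i, x l) = c - u := fun u => by
    rw [hc]; abel
  simp only [hsum, hsumn, hprod, hprod', hz]
  rw [← lintegral_sub_left_eq_self _ c]
  refine lintegral_congr fun u => ?_
  rw [sub_sub_cancel]
  congr 2
  ring

theorem radialWeight_ge {n : ℕ} {u : Euc n} {t : ℝ} (ht : ‖u‖ ≤ t) :
    (ENNReal.ofReal (t ^ (n - 1)))⁻¹ ≤ radialWeight u := by
  unfold radialWeight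
  gcongr

/-- One of the legs is at least as long as the average. -/
theorem prod_radialWeight_le {n j : ℕ} {τ : ℝ} {z : Euc n} {y : Fin j → Euc n} (hτ : 0 < τ)
    (hg : 0 < τ - ∑ i, ‖y i‖ - ‖z - ∑ i, y i‖) :
    (ENNReal.ofReal ((τ - ∑ i, ‖y i‖) ^ (n - 1)))⁻¹ * ∏ i, radialWeight (y i) ≤
      ENNReal.ofReal (((j + 1) / τ) ^ (n - 1)) * (∏ i, radialWeight (y i) +
        ∑ i, radialWeight (z - ∑ l, y l) * ∏ l ∈ Finset.univ.erase i, radialWeight (y l)) := by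
  set t := τ - ∑ i, ‖y i‖ with ht
  have hwt : ‖z - ∑ i, y i‖ ≤ t := by linarith
  have ht0 : 0 < t := by linarith [norm_nonneg (z - ∑ i, y i)]
  have hbound : ∀ a : ℝ, τ / (j + 1) ≤ a →
      (ENNReal.ofReal (a ^ (n - 1)))⁻¹ ≤ ENNReal.ofReal (((j + 1) / τ) ^ (n - 1)) := by
    intro a ha
    have h1 : 0 < τ / ((j : ℝ) + 1) := by positivity
    have ha0 : 0 < a := h1.trans_le ha
    rw [← ENNReal.ofReal_inv_of_pos (by positivity), ← inv_pow]
    apply ENNReal.ofReal_le_ofReal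
    gcongr
    rw [← inv_div]
    gcongr
  by_cases h : τ / (j + 1) ≤ t
  · exact mul_le_mul' (hbound t h) le_self_add
  · have : ∃ i, τ / (j + 1) ≤ ‖y i‖ := by
      by_contra! hcon
      have hsum : ∑ i, ‖y i‖ ≤ j * (τ / (j + 1)) := by
        refine (Finset.sum_le_card_nsmul _ _ _ fun i _ => (hcon i).le).trans ?_
        simp
      have : (j : ℝ) * (τ / (j + 1)) + τ / (j + 1) = τ := by field_simp
      rw [not_le] at h
      linarith
    obtain ⟨i, hi⟩ := this
    -- The final duration is short, so its factor is traded for the larger weight of the vector `w`,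
    -- of length at most `t`. The bounded factor is now that of the long leg `y i`.
    calc _ ≤ radialWeight (z - ∑ l, y l) * ∏ i, radialWeight (y i) := by
          gcongr
          exact radialWeight_ge hwt
      _ = radialWeight (y i) * (radialWeight (z - ∑ l, y l) *
          ∏ l ∈ Finset.univ.erase i, radialWeight (y l)) := by
          rw [← Finset.mul_prod_erase _ _ (Finset.mem_univ i)]
          ring
      _ ≤ _ := by
          refine mul_le_mul' (hbound _ hi) ?_
          exact (Finset.single_le_sum (f := fun i => radialWeight (z - ∑ l, y l) *
            ∏ l ∈ Finset.univ.erase i, radialWeight (y l)) (fun _ _ => zero_le)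
            (Finset.mem_univ i)).trans le_add_self

/-- The potential of a chain of at least three legs. -/
theorem lintegral_multipleLegs_le {n : ℕ} (hn : 2 ≤ n) :
    ∃ C : ℝ, 0 < C ∧ ∀ (j : ℕ) (τ : ℝ) (z : Euc n), ‖z‖ < τ →
      ∫⁻ y : Fin (j + 1) → Euc n, (ENNReal.ofReal ((τ - ∑ i, ‖y i‖) ^ (n - 1)))⁻¹ *
          (∏ i, radialWeight (y i)) * delayProfile n τ (τ - ∑ i, ‖y i‖ - ‖z - ∑ i, y i‖) ≤
        ENNReal.ofReal (C * (j + 2) ^ n * (((sphereMeasure n).real univ * τ) ^ j / j.factorial) *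
          ((τ ^ (n - 1))⁻¹ * ((τ - ‖z‖) * coneProfile n ((τ - ‖z‖) / τ) ^ 2))) := by
  obtain ⟨C, hC, hbase⟩ := lintegral_radialWeight_delay_le hn
  refine ⟨C, hC, fun j τ z hz => ?_⟩
  set s := (sphereMeasure n).real univ with hs
  have hs0 : 0 ≤ s := measureReal_nonneg
  have hτ : 0 < τ := (norm_nonneg z).trans_lt hz
  have hε : 0 < τ - ‖z‖ := by linarith
  set F := delayProfile n τ with hFdef
  have hF : Measurable F := measurable_delayProfile
  set H : ℝ → ℝ≥0∞ := fun a => if 0 < a then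
    ENNReal.ofReal (C * a * coneProfile n (a / τ) ^ 2) else 0 with hH
  have hH0 : ∀ a ≤ 0, H a = 0 := fun a ha => if_neg (not_lt.2 ha)
  have hHmono : ∀ a b, a ≤ b → b ≤ τ → H a ≤ H b := by
    intro a b hab hb
    rcases le_or_gt a 0 with ha | ha
    · rw [hH0 a ha]; exact zero_le
    · simp only [hH, if_pos ha, if_pos (ha.trans_le hab)]
      apply ENNReal.ofReal_le_ofReal
      have := mul_coneProfile_sq_mono n (div_pos ha hτ) (by gcongr : a / τ ≤ b / τ)
        ((div_le_one hτ).2 hb)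
      calc C * a * coneProfile n (a / τ) ^ 2 = C * τ * (a / τ * coneProfile n (a / τ) ^ 2) := by
            field_simp
        _ ≤ C * τ * (b / τ * coneProfile n (b / τ) ^ 2) := by gcongr
        _ = _ := by field_simp
  have hchain := lintegral_chain_le hn (q := radialWeight) (by fun_prop) hF hH0 hHmono
    (fun τ' z' h => hbase τ τ' z' h) j τ z le_rfl
  set I := ∫⁻ y : Fin (j + 1) → Euc n, (∏ i, radialWeight (y i)) *
    F (τ - ∑ i, ‖y i‖ - ‖z - ∑ i, y i‖) with hI
  have hchain' : I ≤ ENNReal.ofReal ((s * τ) ^ j / j.factorial) * H (τ - ‖z‖) := by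
    simpa only [hI, Fin.prod_univ_castSucc] using hchain
  calc _ ≤ ∫⁻ y : Fin (j + 1) → Euc n, ENNReal.ofReal ((((j + 1 : ℕ) + 1) / τ) ^ (n - 1)) *
        ((∏ i, radialWeight (y i)) * F (τ - ∑ i, ‖y i‖ - ‖z - ∑ i, y i‖) +
        ∑ i, radialWeight (z - ∑ l, y l) * (∏ l ∈ Finset.univ.erase i, radialWeight (y l)) *
          F (τ - ∑ i, ‖y i‖ - ‖z - ∑ i, y i‖)) := by
        refine lintegral_mono fun y => ?_
        rcases le_or_gt (τ - ∑ i, ‖y i‖ - ‖z - ∑ i, y i‖) 0 with hg | hg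
        · have : F (τ - ∑ i, ‖y i‖ - ‖z - ∑ i, y i‖) = 0 := if_neg (not_lt.2 hg)
          simp [this]
        · rw [← Finset.sum_mul, ← add_mul, ← mul_assoc]
          exact mul_le_mul_left (prod_radialWeight_le hτ hg) _
    -- After the reflections the j + 2 terms, one for each possible long piece, are all equal to
    -- `I`.
    _ = ENNReal.ofReal ((((j + 1 : ℕ) + 1) / τ) ^ (n - 1)) * ((j + 2 : ℕ) * I) := by
        rw [lintegral_const_mul' _ _ ENNReal.ofReal_ne_top, lintegral_add_left (by fun_prop),
          lintegral_finsetSum _ (by fun_prop)]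
        simp only [lintegral_swap _ hF, ← hI, Finset.sum_const, Finset.card_univ, Fintype.card_fin,
          nsmul_eq_mul]
        congr 1
        push_cast
        ring
    _ ≤ ENNReal.ofReal ((((j + 1 : ℕ) + 1) / τ) ^ (n - 1)) * ((j + 2 : ℕ) *
        (ENNReal.ofReal ((s * τ) ^ j / j.factorial) *
          ENNReal.ofReal (C * (τ - ‖z‖) * coneProfile n ((τ - ‖z‖) / τ) ^ 2))) := by
        gcongr
        refine hchain'.trans (le_of_eq ?_)
        simp only [hH, if_pos hε]
    _ = _ := by
        rw [← ENNReal.ofReal_natCast, ← ENNReal.ofReal_mul (by positivity),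
          ← ENNReal.ofReal_mul (by positivity), ← ENNReal.ofReal_mul (by positivity)]
        congr 1
        have : ((j : ℝ) + 2) ^ n = (j + 2) ^ (n - 1) * (j + 2) := by
          rw [← pow_succ, Nat.sub_add_cancel (by omega)]
        rw [this, div_pow]
        push_cast
        ring

/-- The potential of a chain whose first and last legs are bounded below. -/
theorem lintegral_interiorLegs_le {n : ℕ} (hn : 2 ≤ n) :
    ∃ C : ℝ, 0 < C ∧ ∀ (j : ℕ) (τ : ℝ) (z : Euc n), ‖z‖ < τ →
      ∫⁻ y : Fin (j + 1) → Euc n, (∏ i : Fin j, radialWeight (y i.castSucc)) *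
          delayProfile n τ (τ - ∑ i, ‖y i‖ - ‖z - ∑ i, y i‖) ≤
        ENNReal.ofReal (C * (((sphereMeasure n).real univ * τ) ^ j / j.factorial) *
          (√τ ^ (n + 1) * (√(τ - ‖z‖) ^ (n - 1) * coneProfile n ((τ - ‖z‖) / τ)))) := by
  obtain ⟨C, hC, hbase⟩ := lintegral_delay_le hn
  refine ⟨C, hC, fun j τ z hz => ?_⟩
  set s := (sphereMeasure n).real univ with hs
  have hs0 : 0 ≤ s := measureReal_nonneg
  have hτ : 0 < τ := (norm_nonneg z).trans_lt hz
  have hε : 0 < τ - ‖z‖ := by linarith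
  set H : ℝ → ℝ≥0∞ := fun a => if 0 < a then
    ENNReal.ofReal (C * √τ ^ (n + 1) * (√a ^ (n - 1) * coneProfile n (a / τ))) else 0 with hH
  have hH0 : ∀ a ≤ 0, H a = 0 := fun a ha => if_neg (not_lt.2 ha)
  have hHmono : ∀ a b, a ≤ b → b ≤ τ → H a ≤ H b := by
    intro a b hab hb
    rcases le_or_gt a 0 with ha | ha
    · rw [hH0 a ha]; exact zero_le
    · simp only [hH, if_pos ha, if_pos (ha.trans_le hab)]
      apply ENNReal.ofReal_le_ofReal
      gcongr C * √τ ^ (n + 1) * ?_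
      have := sqrt_pow_mul_coneProfile_mono n hn (div_pos ha hτ) (by gcongr : a / τ ≤ b / τ)
        ((div_le_one hτ).2 hb)
      rw [Real.sqrt_div ha.le, Real.sqrt_div (ha.le.trans hab), div_pow, div_pow] at this
      have hsτ := Real.sqrt_pos.2 hτ
      rw [div_mul_eq_mul_div, div_mul_eq_mul_div] at this
      exact (div_le_div_iff_of_pos_right (by positivity)).1 this
  have hchain := lintegral_chain_le hn (q := fun _ => 1) measurable_const
    (measurable_delayProfile (n := n) (T := τ)) hH0 hHmono
    (fun τ' z' h => by simpa only [one_mul] using hbase τ τ' z' h) j τ z le_rfl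
  simp only [mul_one] at hchain
  refine hchain.trans (le_of_eq ?_)
  simp only [hH, if_pos hε]
  rw [← ENNReal.ofReal_mul (by positivity)]
  congr 1
  ring


/-! ### The boundary -/

theorem hasDerivAt_line {n : ℕ} {ρ : Euc n → ℝ} {x : Euc n} (h : DifferentiableAt ℝ ρ x)
    (d : Euc n) : HasDerivAt (fun s : ℝ => ρ (x + s • d)) (inner ℝ (gradient ρ x) d) 0 := by
  have h1 : HasFDerivAt ρ (fderiv ℝ ρ x) (x + (0 : ℝ) • d) := by
    simpa using h.hasFDerivAt
  have h2 : HasDerivAt (fun s : ℝ => x + s • d) d 0 := by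
    simpa using ((hasDerivAt_id' (0 : ℝ)).smul_const d).const_add x
  have h3 := h1.comp_hasDerivAt (0 : ℝ) h2
  have h4 : fderiv ℝ ρ x d = inner ℝ (gradient ρ x) d := by
    rw [gradient, InnerProductSpace.toDual_symm_apply]
  rw [← h4]
  exact h3

theorem eventually_neg_of_deriv_neg {f : ℝ → ℝ} {f' : ℝ} (h : HasDerivAt f f' 0) (h0 : f 0 = 0)
    (hf' : f' < 0) : ∀ᶠ s in 𝓝[>] (0 : ℝ), f s < 0 := by
  have h1 := hasDerivAt_iff_tendsto_slope_zero.1 h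
  have h2 := h1.mono_left (nhdsWithin_mono 0 fun s (hs : 0 < s) => hs.ne')
  filter_upwards [h2.eventually_lt_const hf', self_mem_nhdsWithin] with s hs hs0
  have hs0' : (0 : ℝ) < s := hs0
  simp only [zero_add, h0, sub_zero, smul_eq_mul] at hs
  by_contra hcon
  rw [not_lt] at hcon
  have : 0 ≤ s⁻¹ * f s := by positivity
  linarith

theorem IsOutwardUnitNormal.eventually_mem {n : ℕ} {X : Set (Euc n)} {x N d : Euc n}
    (h : IsOutwardUnitNormal X x N) (hd : inner ℝ N d < 0) :
    ∀ᶠ s in 𝓝[>] (0 : ℝ), x + s • d ∈ X := by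
  obtain ⟨-, ρ, hρ, hx, ⟨c, hc, hgrad⟩, hX⟩ := h
  have h1 := hasDerivAt_line (hρ.differentiableAt (by simp)) d
  rw [hgrad, real_inner_smul_left] at h1
  have h2 := eventually_neg_of_deriv_neg h1 (by simpa using hx) (by nlinarith)
  have h3 : Tendsto (fun s : ℝ => x + s • d) (𝓝[>] 0) (𝓝 x) := by
    have : Continuous fun s : ℝ => x + s • d := by fun_prop
    simpa using (this.tendsto 0).mono_left (nhdsWithin_le_nhds (s := Ioi (0 : ℝ)))
  filter_upwards [h2, h3.eventually hX] with s hs hsX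
  exact hsX.2 hs

theorem IsOutwardUnitNormal.eventually_notMem {n : ℕ} {X : Set (Euc n)} {x N d : Euc n}
    (h : IsOutwardUnitNormal X x N) (hd : 0 < inner ℝ N d) :
    ∀ᶠ s in 𝓝[>] (0 : ℝ), x + s • d ∉ X := by
  obtain ⟨-, ρ, hρ, hx, ⟨c, hc, hgrad⟩, hX⟩ := h
  have h1 := (hasDerivAt_line (hρ.differentiableAt (by simp)) d).neg
  rw [hgrad, real_inner_smul_left] at h1
  have h2 := eventually_neg_of_deriv_neg h1 (by simpa using hx) (by nlinarith)
  have h3 : Tendsto (fun s : ℝ => x + s • d) (𝓝[>] 0) (𝓝 x) := by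
    have : Continuous fun s : ℝ => x + s • d := by fun_prop
    simpa using (this.tendsto 0).mono_left (nhdsWithin_le_nhds (s := Ioi (0 : ℝ)))
  filter_upwards [h2, h3.eventually hX] with s hs hsX hmem
  have := hsX.1 hmem
  simp only [Pi.neg_apply] at hs
  linarith

/-- If the two vectors differed, the direction `N' - N` would enter `X` according to `N` and leave
it according to `N'`. -/
theorem IsOutwardUnitNormal.unique {n : ℕ} {X : Set (Euc n)} {x N N' : Euc n}
    (h : IsOutwardUnitNormal X x N) (h' : IsOutwardUnitNormal X x N') : N = N' := by
  by_contra hne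
  have h1 : inner ℝ N N' < 1 := (inner_lt_one_iff_real_of_norm_eq_one h.1 h'.1).2 hne
  have e1 : inner ℝ N (N' - N) < 0 := by
    rw [inner_sub_right, real_inner_self_eq_norm_sq, h.1]; linarith
  have e2 : 0 < inner ℝ N' (N' - N) := by
    rw [inner_sub_right, real_inner_self_eq_norm_sq, h'.1, real_inner_comm]; linarith
  obtain ⟨s, hs, hs'⟩ := ((h.eventually_mem e1).and (h'.eventually_notMem e2)).exists
  exact hs' hs

theorem HasC1Boundary.normal_spec {n : ℕ} {X : Set (Euc n)} (hX : HasC1Boundary X) {x : Euc n}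
    (hx : x ∈ frontier X) : IsOutwardUnitNormal X x (normal X x) := by
  have h := hX x hx
  rw [normal, dif_pos h]
  exact h.choose_spec

theorem defining_eq_zero {n : ℕ} {X : Set (Euc n)} (hXo : IsOpen X) {ρ : Euc n → ℝ} {y : Euc n}
    (hρ : ContinuousAt ρ y) (hX : ∀ᶠ z in 𝓝 y, (z ∈ X ↔ ρ z < 0)) (hy : y ∈ frontier X) :
    ρ y = 0 := by
  rw [hXo.frontier_eq] at hy
  apply le_antisymm
  · have hfreq : ∃ᶠ z in 𝓝 y, ρ z < 0 :=
      ((mem_closure_iff_frequently.1 hy.1).and_eventually hX).mono fun z hz => hz.2.1 hz.1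
    by_contra hcon
    rw [not_le] at hcon
    exact hfreq ((hρ.eventually_const_lt hcon).mono fun z hz => not_lt.2 hz.le)
  · exact not_lt.1 fun h => hy.2 (hX.self_of_nhds.2 h)

/-- `normal` is obtained by choice at each point separately. Uniqueness identifies it near `x` with
the normalized gradient of one defining function. -/
theorem continuousOn_normal {n : ℕ} {X : Set (Euc n)} (hXo : IsOpen X) (hX : HasC1Boundary X) :
    ContinuousOn (normal X) (frontier X) := by
  intro x hx
  have hN := hX.normal_spec hx
  obtain ⟨hN1, ρ, hρ, hρx, ⟨c, hc, hgrad⟩, hXρ⟩ := hN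
  have hgc : ContinuousAt (gradient ρ) x := by
    have h1 : ContinuousAt (fderiv ℝ ρ) x := hρ.continuousAt_fderiv (by simp)
    exact (InnerProductSpace.toDual ℝ (Euc n)).symm.continuous.continuousAt.comp h1
  have hg0 : gradient ρ x ≠ 0 := by
    rw [hgrad]
    exact smul_ne_zero hc.ne' (norm_ne_zero_iff.1 (by rw [hN1]; exact one_ne_zero))
  have hcont : ContinuousAt (fun y => ‖gradient ρ y‖⁻¹ • gradient ρ y) x :=
    (hgc.norm.inv₀ (norm_ne_zero_iff.2 hg0)).smul hgc
  have hev : ∀ᶠ y in 𝓝 x, y ∈ frontier X → normal X y = ‖gradient ρ y‖⁻¹ • gradient ρ y := by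
    filter_upwards [hρ.eventually (by simp), hXρ.eventually_nhds, hgc.eventually_ne hg0]
      with y hy1 hy2 hy3 hyf
    refine (hX.normal_spec hyf).unique ⟨?_, ρ, hy1, defining_eq_zero hXo hy1.continuousAt hy2 hyf,
      ⟨‖gradient ρ y‖, norm_pos_iff.2 hy3, ?_⟩, hy2⟩
    · rw [norm_smul, norm_inv, norm_norm, inv_mul_cancel₀ (norm_ne_zero_iff.2 hy3)]
    · rw [smul_smul, mul_inv_cancel₀ (norm_ne_zero_iff.2 hy3), one_smul]
  refine (hcont.continuousWithinAt (s := frontier X)).congr_of_eventuallyEq_of_mem ?_ hx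
  filter_upwards [nhdsWithin_le_nhds hev, self_mem_nhdsWithin] with y h1 h2
  exact h1 h2

theorem norm_normal {n : ℕ} {X : Set (Euc n)} (hX : HasC1Boundary X) {x : Euc n}
    (hx : x ∈ frontier X) : ‖normal X x‖ = 1 := (hX.normal_spec hx).1

/-- A `C¹` hypersurface is locally a Lipschitz graph along a transversal direction. -/
theorem frontier_transversal {n : ℕ} {X : Set (Euc n)} (hXo : IsOpen X) (hX : HasC1Boundary X)
    {x : Euc n} (hx : x ∈ frontier X) {v : Euc n} (hv : inner ℝ (normal X x) v ≠ 0) :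
    ∃ U ∈ 𝓝 x, Bornology.IsBounded U ∧ ∃ K : ℝ, 0 ≤ K ∧ ∀ y ∈ frontier X ∩ U, ∀ z ∈ frontier X ∩ U,
      ∀ (p : Euc n) (a : ℝ), y - z = p + a • v → ‖y - z‖ ≤ K * ‖p‖ := by
  obtain ⟨hN1, ρ, hρ, hρx, ⟨c, hc, hgrad⟩, hXρ⟩ := hX.normal_spec hx
  set b := |inner ℝ (normal X x) v| with hb
  have hb0 : 0 < b := abs_pos.2 hv
  have hstrict := hρ.hasStrictFDerivAt (by simp)
  -- The error allowed in strict differentiability is so small that its part proportional to `|a|`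
  -- is at most half of the transversal term `c * b * |a|`.
  set κ : ℝ := c * b / (2 * (‖v‖ + 1)) with hκ
  have hκ0 : 0 < κ := by positivity
  have hlin := hstrict.isLittleO.def hκ0
  rw [nhds_prod_eq] at hlin
  obtain ⟨U₁, hU₁, hU⟩ := (eventually_prod_self_iff (r := fun a b : Euc n =>
    ‖ρ a - ρ b - (fderiv ℝ ρ x) (a - b)‖ ≤ κ * ‖a - b‖)).1 hlin
  have hzero : ∀ᶠ y in 𝓝 x, y ∈ frontier X → ρ y = 0 := by
    filter_upwards [hρ.eventually (by simp), hXρ.eventually_nhds] with y hy1 hy2 hyf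
    exact defining_eq_zero hXo hy1.continuousAt hy2 hyf
  refine ⟨U₁ ∩ {y | y ∈ frontier X → ρ y = 0} ∩ Metric.ball x 1,
    inter_mem (inter_mem hU₁ hzero) (Metric.ball_mem_nhds x one_pos),
    Metric.isBounded_ball.subset inter_subset_right,
    1 + 2 * (c + κ) / (c * b) * ‖v‖, by positivity, ?_⟩
  rintro y ⟨hyf, ⟨hyU, hy0⟩, -⟩ z ⟨hzf, ⟨hzU, hz0⟩, -⟩ p a hyz
  have h1 := hU y hyU z hzU
  have hy0' : ρ y = 0 := hy0 hyf
  have hz0' : ρ z = 0 := hz0 hzf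
  have h4 : fderiv ℝ ρ x (y - z) = c * inner ℝ (normal X x) (y - z) := by
    rw [← real_inner_smul_left, ← hgrad, gradient, InnerProductSpace.toDual_symm_apply]
  rw [hy0', hz0', sub_zero, zero_sub, norm_neg, h4, Real.norm_eq_abs, abs_mul, abs_of_pos hc,
    hyz, inner_add_right, real_inner_smul_right] at h1
  have h5 : |a| * b ≤ |inner ℝ (normal X x) p + a * inner ℝ (normal X x) v| + ‖p‖ := by
    have e1 : |inner ℝ (normal X x) p| ≤ ‖p‖ := by
      have := abs_real_inner_le_norm (normal X x) p
      rwa [hN1, one_mul] at this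
    have e2 : |a * inner ℝ (normal X x) v| = |a| * b := abs_mul _ _
    have e3 := abs_sub (inner ℝ (normal X x) p + a * inner ℝ (normal X x) v)
      (inner ℝ (normal X x) p)
    rw [add_sub_cancel_left, e2] at e3
    linarith
  have h6 : ‖p + a • v‖ ≤ ‖p‖ + |a| * ‖v‖ := by
    refine (norm_add_le _ _).trans ?_
    rw [norm_smul, Real.norm_eq_abs]
  have h7 : κ * ‖v‖ ≤ c * b / 2 := by
    rw [hκ, div_mul_eq_mul_div, div_le_div_iff₀ (by positivity) (by positivity)]
    nlinarith [norm_nonneg v, mul_pos hc hb0]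
  have h8 : |a| * (c * b) ≤ 2 * (c + κ) * ‖p‖ := by
    have e1 : c * (|a| * b) ≤ κ * (‖p‖ + |a| * ‖v‖) + c * ‖p‖ := by
      calc c * (|a| * b) ≤ c * (|inner ℝ (normal X x) p + a * inner ℝ (normal X x) v| + ‖p‖) := by
            gcongr
        _ ≤ κ * (‖p‖ + |a| * ‖v‖) + c * ‖p‖ := by
            have := h1.trans (mul_le_mul_of_nonneg_left h6 hκ0.le)
            linarith
    have e2 : |a| * (κ * ‖v‖) ≤ |a| * (c * b / 2) := by gcongr
    linarith
  have h9 : |a| ≤ 2 * (c + κ) / (c * b) * ‖p‖ := by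
    rw [div_mul_eq_mul_div, le_div_iff₀ (by positivity)]
    exact h8
  rw [hyz]
  calc ‖p + a • v‖ ≤ ‖p‖ + |a| * ‖v‖ := h6
    _ ≤ ‖p‖ + 2 * (c + κ) / (c * b) * ‖p‖ * ‖v‖ := by gcongr
    _ = _ := by ring

/-- The projection along `v`. -/
noncomputable abbrev alongProj {n : ℕ} (v : Euc n) : Euc n →L[ℝ] (Submodule.span ℝ {v})ᗮ :=
  (Submodule.span ℝ {v})ᗮ.orthogonalProjectionOnto

theorem alongProj_add {n : ℕ} {v : Euc n} (hv : ‖v‖ = 1) (x : Euc n) :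
    x = (alongProj v x : Euc n) + inner ℝ v x • v := by
  have h := Submodule.starProjection_unit_singleton ℝ hv x
  have h2 := Submodule.starProjection_add_starProjection_orthogonal (K := Submodule.span ℝ {v}) x
  rw [h] at h2
  conv_lhs => rw [← h2]
  rw [add_comm]
  rfl

/-- In this form the Hausdorff measure of a piece of the boundary is controlled by that of its
projection, which settles both finiteness and null sets. -/
theorem frontier_antilipschitz {n : ℕ} {X : Set (Euc n)} (hXo : IsOpen X) (hX : HasC1Boundary X)
    {x : Euc n} (hx : x ∈ frontier X) {v : Euc n} (hv1 : ‖v‖ = 1)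
    (hv : inner ℝ (normal X x) v ≠ 0) :
    ∃ U ∈ 𝓝 x, Bornology.IsBounded U ∧ ∃ K : NNReal,
      AntilipschitzWith K (fun y : ↥(frontier X ∩ U) => alongProj v (y : Euc n)) := by
  obtain ⟨U, hU, hUb, K, hK, h⟩ := frontier_transversal hXo hX hx hv
  refine ⟨U, hU, hUb, K.toNNReal, AntilipschitzWith.of_le_mul_dist fun y z => ?_⟩
  rw [Subtype.dist_eq, dist_eq_norm, dist_eq_norm, Real.coe_toNNReal _ hK, ← map_sub]
  exact h y y.2 z z.2 _ _ (alongProj_add hv1 _)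

theorem finrank_orthogonal_unit {n : ℕ} (hn : 2 ≤ n) {v : Euc n} (hv : ‖v‖ = 1) :
    Module.finrank ℝ (Submodule.span ℝ {v})ᗮ = n - 1 := by
  have : Fact (Module.finrank ℝ (Euc n) = (n - 1) + 1) := ⟨by
    rw [finrank_euclideanSpace, Fintype.card_fin]; omega⟩
  exact Submodule.finrank_orthogonal_span_singleton (norm_ne_zero_iff.1 (by rw [hv]; simp))

theorem hausdorffMeasure_frontier_le {n : ℕ} {v : Euc n} {S : Set (Euc n)} {K : NNReal}
    (h : AntilipschitzWith K (fun y : ↥S => alongProj v (y : Euc n)))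
    (B : Set (Submodule.span ℝ {v})ᗮ) :
    Measure.hausdorffMeasure ((n - 1 : ℕ) : ℝ) (S ∩ alongProj v ⁻¹' B) ≤
      (K : ℝ≥0∞) ^ ((n - 1 : ℕ) : ℝ) * Measure.hausdorffMeasure ((n - 1 : ℕ) : ℝ) B := by
  have h1 := h.hausdorffMeasure_preimage_le (d := ((n - 1 : ℕ) : ℝ)) (by positivity) B
  have h2 : S ∩ alongProj v ⁻¹' B =
      Subtype.val '' ((fun y : ↥S => alongProj v (y : Euc n)) ⁻¹' B) := by
    ext y
    simp [and_comm]
  rw [h2, isometry_subtype_coe.hausdorffMeasure_image (Or.inl (by positivity))]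
  exact h1

theorem isFiniteMeasure_surfaceMeasure {n : ℕ} (hn : 2 ≤ n) {X : Set (Euc n)} (hXo : IsOpen X)
    (hXb : Bornology.IsBounded X) (hX : HasC1Boundary X) :
    IsFiniteMeasure (surfaceMeasure X) := by
  have hcomp : IsCompact (frontier X) :=
    Metric.isCompact_of_isClosed_isBounded isClosed_frontier
      (hXb.closure.subset frontier_subset_closure)
  refine ⟨?_⟩
  rw [surfaceMeasure, Measure.restrict_apply_univ, Measure.euclideanHausdorffMeasure_def,
    Measure.smul_apply]
  have hfin : (Measure.hausdorffMeasure ((n - 1 : ℕ) : ℝ) : Measure (Euc n)) (frontier X) < ⊤ := by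
    refine hcomp.measure_lt_top_of_nhdsWithin fun x hx => ?_
    have hN := norm_normal hX hx
    obtain ⟨U, hU, hUb, K, hK⟩ := frontier_antilipschitz hXo hX hx hN
      (by rw [real_inner_self_eq_norm_sq, hN]; norm_num)
    refine ⟨frontier X ∩ U, inter_mem_nhdsWithin _ hU, ?_⟩
    set B := alongProj (normal X x) '' (frontier X ∩ U)
    have hle := hausdorffMeasure_frontier_le hK B
    rw [inter_eq_left.2 (subset_preimage_image _ _)] at hle
    refine hle.trans_lt (ENNReal.mul_lt_top (by finiteness) ?_)
    rw [← finrank_orthogonal_unit hn hN]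
    have hB : Bornology.IsBounded B :=
      (alongProj (normal X x)).lipschitz.isBounded_image (hUb.subset inter_subset_right)
    exact hB.measure_lt_top
  exact ENNReal.mul_lt_top ENNReal.coe_lt_top hfin

/-- Fubini in the linear coordinates `p + r v`. A linear isomorphism carries Haar measure to Haar
measure, so null sets correspond. -/
theorem ae_line_of_null {n : ℕ} {v : Euc n} (hv : ‖v‖ = 1) {A : Set (Euc n)}
    (hA : volume A = 0) :
    ∀ᵐ p : (Submodule.span ℝ {v})ᗮ, ∀ᵐ r : ℝ, (p : Euc n) + r • v ∉ A := by
  set V := (Submodule.span ℝ {v})ᗮ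
  let L : (V × ℝ) →L[ℝ] Euc n :=
    V.subtypeL.comp (ContinuousLinearMap.fst ℝ V ℝ) +
      (ContinuousLinearMap.snd ℝ V ℝ).smulRight v
  have hLapp : ∀ p : V × ℝ, L p = (p.1 : Euc n) + p.2 • v := fun p => rfl
  have hbij : Function.Bijective L := by
    constructor
    · rw [injective_iff_map_eq_zero]
      rintro ⟨p, r⟩ h
      rw [hLapp] at h
      have hp : inner ℝ v (p : Euc n) = 0 := Submodule.mem_orthogonal_singleton_iff_inner_right.1 p.2
      have h1 : inner ℝ v ((p : Euc n) + r • v) = 0 := by rw [h, inner_zero_right]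
      rw [inner_add_right, hp, real_inner_smul_right, real_inner_self_eq_norm_sq, hv] at h1
      have hr : r = 0 := by simpa using h1
      subst hr
      simpa using h
    · intro x
      exact ⟨(alongProj v x, inner ℝ v x), (alongProj_add hv x).symm⟩
  let e : (V × ℝ) ≃L[ℝ] Euc n := ContinuousLinearEquiv.ofBijective L
    (LinearMap.ker_eq_bot.2 hbij.1) (LinearMap.range_eq_top.2 hbij.2)
  have hac : (volume.map e : Measure (Euc n)) ≪ volume := by
    have : (volume : Measure (V × ℝ)).IsAddHaarMeasure := by
      rw [Measure.volume_eq_prod]; infer_instance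
    have : (volume.map e : Measure (Euc n)).IsAddHaarMeasure := e.isAddHaarMeasure_map volume
    exact Measure.absolutelyContinuous_isAddHaarMeasure _ _
  have h1 : ∀ᵐ p : V × ℝ, L p ∉ A := by
    have h2 : ∀ᵐ x ∂(volume.map e : Measure (Euc n)), x ∉ A :=
      hac.ae_le (measure_eq_zero_iff_ae_notMem.1 hA)
    exact ae_of_ae_map e.continuous.measurable.aemeasurable h2
  rw [Measure.volume_eq_prod] at h1
  exact Measure.ae_ae_of_ae_prod h1

/-- Lines through a hypersurface in a transversal direction avoid null sets. -/
theorem ae_surface_ae_line {n : ℕ} (hn : 2 ≤ n) {X : Set (Euc n)} (hXo : IsOpen X)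
    (hX : HasC1Boundary X) {A : Set (Euc n)} (hA : volume A = 0) {v : Euc n} (hv1 : ‖v‖ = 1)
    (hv : ∀ᵐ x ∂(surfaceMeasure X), inner ℝ (normal X x) v ≠ 0) :
    ∀ᵐ x ∂(surfaceMeasure X), ∀ᵐ r : ℝ, x + r • v ∉ A := by
  -- `B` collects the bad lines and is null in the hyperplane. Transversal boundary points
  -- projecting to `B` are null because the projection is locally antilipschitz on the boundary.
  set B : Set (Submodule.span ℝ {v})ᗮ := {p | ¬ ∀ᵐ r : ℝ, (p : Euc n) + r • v ∉ A} with hB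
  have hB0 : Measure.hausdorffMeasure ((n - 1 : ℕ) : ℝ) B = 0 := by
    rw [← finrank_orthogonal_unit hn hv1]
    have hac : (Measure.hausdorffMeasure (Module.finrank ℝ (Submodule.span ℝ {v})ᗮ : ℝ) :
        Measure (Submodule.span ℝ {v})ᗮ) ≪ volume :=
      Measure.absolutelyContinuous_isAddHaarMeasure _ _
    exact hac (ae_iff.1 (ae_line_of_null hv1 hA))
  set Z := frontier X ∩ {x | inner ℝ (normal X x) v ≠ 0} ∩ alongProj v ⁻¹' B with hZ
  have hZ0 : Measure.hausdorffMeasure ((n - 1 : ℕ) : ℝ) Z = 0 := by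
    refine measure_null_of_locally_null _ fun x hx => ?_
    obtain ⟨U, hU, -, K, hK⟩ := frontier_antilipschitz hXo hX hx.1.1 hv1 hx.1.2
    refine ⟨Z ∩ U, inter_mem_nhdsWithin _ hU, ?_⟩
    have hle := hausdorffMeasure_frontier_le hK B
    rw [hB0, mul_zero] at hle
    refine measure_mono_null ?_ (le_antisymm hle bot_le)
    rintro y ⟨⟨⟨h1, -⟩, h2⟩, h3⟩
    exact ⟨⟨h1, h3⟩, h2⟩
  have hZs : surfaceMeasure X Z = 0 := by
    refine measure_mono_null (subset_refl Z) (Measure.absolutelyContinuous_of_le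
      Measure.restrict_le_self ?_)
    rw [Measure.euclideanHausdorffMeasure_def, Measure.smul_apply, hZ0, smul_zero]
  have hmem : ∀ᵐ x ∂(surfaceMeasure X), x ∈ frontier X :=
    ae_restrict_mem isClosed_frontier.measurableSet
  filter_upwards [hv, hmem, measure_eq_zero_iff_ae_notMem.1 hZs] with x h1 h2 h3
  have h4 : alongProj v x ∉ B := fun h => h3 ⟨⟨h2, h1⟩, h⟩
  have h5 : ∀ᵐ r : ℝ, (alongProj v x : Euc n) + r • v ∉ A := not_not.1 h4
  have h6 := (quasiMeasurePreserving_add_right volume (inner ℝ v x : ℝ)).ae h5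
  filter_upwards [h6] with r hr
  rwa [alongProj_add hv1 x, add_assoc, ← add_smul, add_comm (inner ℝ v x)]

theorem sphere_equator_null {n : ℕ} {N : Euc n} (hN : N ≠ 0) :
    sphereMeasure n {v | inner ℝ N (v : Euc n) = 0} = 0 := by
  rw [Measure.toSphere_apply' _ (measurableSet_eq_fun (by fun_prop) measurable_const)]
  convert mul_zero _
  refine measure_mono_null (t := ((Submodule.span ℝ {N})ᗮ : Set (Euc n))) ?_
    (Measure.addHaar_submodule _ _ ?_)
  · rintro _ ⟨s, hs, _, ⟨v, hv, rfl⟩, rfl⟩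
    have hv' : inner ℝ N (v : Euc n) = 0 := hv
    simp only [SetLike.mem_coe, Submodule.mem_orthogonal_singleton_iff_inner_right]
    simp only [real_inner_smul_right, hv', mul_zero]
  · intro h
    rw [Submodule.orthogonal_eq_top_iff, Submodule.span_singleton_eq_bot] at h
    exact hN h


/-! ### Almost everywhere statements in iterated form -/

/-- Two "almost every" quantifiers can be exchanged only for measurable predicates. This keeps
measurability under nesting. -/
theorem measurableSet_ae {α β : Type*} [MeasurableSpace α] [MeasurableSpace β] {ν : Measure β}
    [SFinite ν] {P : α → β → Prop} (hP : MeasurableSet {q : α × β | P q.1 q.2}) :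
    MeasurableSet {a | ∀ᵐ b ∂ν, P a b} := by
  have h1 : Measurable fun a => ν (Prod.mk a ⁻¹' {q : α × β | P q.1 q.2}ᶜ) :=
    measurable_measure_prodMk_left hP.compl
  exact h1 (measurableSet_singleton 0)

theorem ae_polar {n : ℕ} (hn : 2 ≤ n) {P : Euc n → Prop} (hP : MeasurableSet {u | P u}) :
    (∀ᵐ u, P u) ↔ ∀ᵐ v : Sph n ∂(sphereMeasure n), ∀ᵐ r : ℝ, 0 < r → P (r • (v : Euc n)) := by
  have hf : Measurable ({u | P u}ᶜ.indicator fun _ => (1 : ℝ≥0∞)) :=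
    measurable_const.indicator hP.compl
  have h1 : (∀ᵐ u, P u) ↔ ∫⁻ u, {u | P u}ᶜ.indicator (fun _ => (1 : ℝ≥0∞)) u = 0 := by
    rw [lintegral_indicator_const hP.compl, one_mul]
    exact ae_iff
  have hm : Measurable fun q : Sph n × ℝ => ENNReal.ofReal (q.2 ^ (n - 1)) *
      {u | P u}ᶜ.indicator (fun _ => (1 : ℝ≥0∞)) (q.2 • (q.1 : Euc n)) := by fun_prop
  rw [h1, lintegral_polar hn hf, lintegral_eq_zero_iff hm.lintegral_prod_right']
  refine eventually_congr (Eventually.of_forall fun v => ?_)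
  rw [Pi.zero_apply, lintegral_eq_zero_iff (by fun_prop)]
  rw [EventuallyEq, ae_restrict_iff' measurableSet_Ioi]
  refine eventually_congr (Eventually.of_forall fun r => ?_)
  refine forall_congr' fun (hr : 0 < r) => ?_
  have : ENNReal.ofReal (r ^ (n - 1)) ≠ 0 := by simpa using pow_pos hr _
  simp [this]

theorem ae_direction {n : ℕ} (hn : 2 ≤ n) {P : Euc n → Prop} (hP : MeasurableSet {u | P u})
    (h : ∀ᵐ v : Sph n ∂(sphereMeasure n), P v) : ∀ᵐ u : Euc n, P (‖u‖⁻¹ • u) := by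
  have hm : Measurable fun u : Euc n => ‖u‖⁻¹ • u := by fun_prop
  refine (ae_polar hn (P := fun u => P (‖u‖⁻¹ • u)) (hm hP)).2 ?_
  filter_upwards [h] with v hv
  refine Eventually.of_forall fun r hr => ?_
  rwa [norm_smul, norm_sph, mul_one, Real.norm_of_nonneg hr.le, smul_smul,
    inv_mul_cancel₀ hr.ne', one_smul]

/-- Fubini in one coordinate of the chain: a measurable set all of whose slices in `y_i` are null is
null. -/
theorem ae_update {n j : ℕ} (i : Fin j) {P : (Fin j → Euc n) → Prop}
    (hP : MeasurableSet {y | P y}) (h : ∀ y, ∀ᵐ u : Euc n, P (Function.update y i u)) :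
    ∀ᵐ y, P y := by
  have h1 : ∫⁻ y, {y | P y}ᶜ.indicator (fun _ => (1 : ℝ≥0∞)) y = 0 := by
    simp only [volume_pi]
    rw [lintegral_eq_of_lmarginal_eq {i} (g := fun _ => 0)
      (measurable_const.indicator hP.compl) measurable_const, lintegral_zero]
    simp only [lmarginal_singleton]
    funext y
    rw [lintegral_zero, lintegral_eq_zero_iff]
    · filter_upwards [h y] with u hu
      simp [hu]
    · exact (measurable_const.indicator hP.compl).comp (measurable_update y)
  rw [lintegral_indicator_const hP.compl, one_mul] at h1
  exact ae_iff.2 h1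

theorem ae_sub_sum {n j : ℕ} (c : Euc n) {P : Euc n → Prop} (h : ∀ᵐ w, P w) :
    ∀ᵐ y : Fin (j + 1) → Euc n, P (c - ∑ i, y i) := by
  -- The predicate is not assumed measurable, so its exceptional set is enclosed in a measurable
  -- null set.
  obtain ⟨A, hA, hAm, hA0⟩ := exists_measurable_superset_of_null (ae_iff.1 h)
  have h' : ∀ᵐ w, w ∉ A := measure_eq_zero_iff_ae_notMem.1 hA0
  have hm : Measurable fun y : Fin (j + 1) → Euc n => c - ∑ i, y i := by fun_prop
  have : ∀ᵐ y : Fin (j + 1) → Euc n, c - ∑ i, y i ∉ A := by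
    refine ae_update 0 (hm hAm.compl) fun y => ?_
    have h1 : ∀ u : Euc n, c - ∑ i, Function.update y 0 u i =
        (c - ∑ i ∈ Finset.univ.erase 0, y i) - u := fun u => by
      have h2 : ∑ i ∈ Finset.univ.erase 0, Function.update y 0 u i =
          ∑ i ∈ Finset.univ.erase 0, y i :=
        Finset.sum_congr rfl fun l hl => by rw [Function.update_of_ne (Finset.ne_of_mem_erase hl)]
      rw [← Finset.add_sum_erase _ _ (Finset.mem_univ 0), Function.update_self, h2]
      abel
    simp only [h1]
    exact (quasiMeasurePreserving_sub_left volume _).ae h'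
  filter_upwards [this] with y hy
  by_contra hcon
  exact hy (hA hcon)

/-! ### The last two legs -/

/-- The length of the second leg of a path of two legs and total length `t` and displacement `w`
whose first leg has the direction `v`. -/
noncomputable def legLength {n : ℕ} (t : ℝ) (w v : Euc n) : ℝ :=
  ‖w - t • v‖ ^ 2 / (2 * (t - inner ℝ w v))

/-- The last collision lies on the ellipsoid with foci at the two ends, so the length of the leg
along `v` is the focal radius. -/
theorem sub_legLength {n : ℕ} {t : ℝ} {w : Euc n} (ht : ‖w‖ < t) (v : Sph n) :
    t - legLength t w v = (t ^ 2 - ‖w‖ ^ 2) / (2 * (t - inner ℝ w (v : Euc n))) := by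
  have := inner_sph_le w v
  have h0 : t - inner ℝ w (v : Euc n) ≠ 0 := by linarith
  rw [legLength, norm_sub_smul_sq]
  field_simp
  ring

theorem sub_legLength_pos {n : ℕ} {t : ℝ} {w : Euc n} (ht : ‖w‖ < t) (v : Sph n) :
    0 < t - legLength t w v := by
  rw [sub_legLength ht]
  exact focalRadius_pos ht v

theorem legLength_pos {n : ℕ} {t : ℝ} {w : Euc n} (ht : ‖w‖ < t) (v : Sph n) :
    0 < legLength t w v := by
  have := inner_sph_le w v
  have h0 : 0 < t - inner ℝ w (v : Euc n) := by linarith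
  refine div_pos (pow_pos (norm_pos_iff.2 fun h => ?_) 2) (by linarith)
  rw [sub_eq_zero] at h
  rw [h, norm_smul, norm_sph, mul_one] at ht
  exact absurd ht (not_lt.2 (le_abs_self t))

theorem norm_sub_legLength {n : ℕ} {t : ℝ} {w : Euc n} (ht : ‖w‖ < t) (v : Sph n) :
    ‖w - (t - legLength t w v) • (v : Euc n)‖ = legLength t w v := by
  have hpos := legLength_pos ht v
  refine (sq_eq_sq₀ (norm_nonneg _) hpos.le).1 ?_
  have h1 := sub_legLength ht v
  have := inner_sph_le w v
  rw [eq_div_iff (by linarith)] at h1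
  rw [norm_sub_smul_sq]
  nlinarith

/-- The total time as a function of the leg length, `l + |w - l v|`, is Lipschitz and therefore maps
null sets to null sets. It recovers `t` from `t - legLength`, so almost every `t` corresponds to a
good length. -/
theorem ae_firstLeg {n : ℕ} (w : Euc n) (v : Sph n) {P : ℝ → Prop} (h : ∀ᵐ l : ℝ, P l) :
    ∀ᵐ t : ℝ, ‖w‖ < t → P (t - legLength t w v) := by
  set φ : ℝ → ℝ := fun l => l + ‖w - l • (v : Euc n)‖
  have hφ : LipschitzWith (1 + 1) φ := by
    refine LipschitzWith.id.add (LipschitzWith.of_dist_le_mul fun a b => ?_)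
    rw [Real.dist_eq, Real.dist_eq, NNReal.coe_one, one_mul]
    refine (abs_norm_sub_norm_le _ _).trans ?_
    rw [sub_sub_sub_cancel_left, ← sub_smul, norm_smul, norm_sph, mul_one, Real.norm_eq_abs,
      abs_sub_comm]
  have h0 : volume (φ '' {l | ¬ P l}) = 0 := by
    have h1 := hφ.hausdorffMeasure_image_le (d := 1) zero_le_one {l | ¬ P l}
    rw [hausdorffMeasure_real, ae_iff.1 h, mul_zero] at h1
    exact le_antisymm h1 bot_le
  filter_upwards [measure_eq_zero_iff_ae_notMem.1 h0] with t ht hwt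
  by_contra hcon
  refine ht ⟨_, hcon, ?_⟩
  simp only [φ, norm_sub_legLength hwt]
  ring

theorem lastLeg_eq {n j : ℕ} (τ : ℝ) (x x' : Euc n) (y : Fin j → Euc n) (v : Euc n) :
    lastLeg τ x x' y v = legLength (leftTime τ y) (leftVec x x' y) v := rfl

theorem mem_ellipsoid_iff {n j : ℕ} {τ : ℝ} {x x' : Euc n} {y : Fin j → Euc n} :
    y ∈ ellipsoid j τ x x' ↔ ‖leftVec x x' y‖ < leftTime τ y := by
  unfold ellipsoid leftVec leftTime
  rw [mem_ofPred_eq]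
  constructor <;> intro h <;> linarith

theorem lastDir_eq {n j : ℕ} {τ : ℝ} {x x' : Euc n} {y : Fin j → Euc n}
    (h : ‖leftVec x x' y‖ < leftTime τ y) (v : Sph n) :
    lastDir τ x x' y v =
      ‖leftVec x x' y - (leftTime τ y - lastLeg τ x x' y v) • (v : Euc n)‖⁻¹ •
        (leftVec x x' y - (leftTime τ y - lastLeg τ x x' y v) • (v : Euc n)) := by
  rw [lastDir, lastLeg_eq, norm_sub_legLength h]

/-! ### Measurability of the geometric quantities -/

section Measurability

variable {α : Type*} [MeasurableSpace α] {n j : ℕ} {τ : α → ℝ} {x x' : α → Euc n}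
  {y : α → Fin j → Euc n} {v : α → Euc n}

@[fun_prop]
theorem measurable_leftTime (hτ : Measurable τ) (hy : Measurable y) :
    Measurable fun a => leftTime (τ a) (y a) := by
  unfold leftTime; fun_prop

@[fun_prop]
theorem measurable_leftVec (hx : Measurable x) (hx' : Measurable x') (hy : Measurable y) :
    Measurable fun a => leftVec (x a) (x' a) (y a) := by
  unfold leftVec; fun_prop

@[fun_prop]
theorem measurable_lastLeg (hτ : Measurable τ) (hx : Measurable x) (hx' : Measurable x')
    (hy : Measurable y) (hv : Measurable v) :
    Measurable fun a => lastLeg (τ a) (x a) (x' a) (y a) (v a) := by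
  unfold lastLeg; fun_prop

@[fun_prop]
theorem measurable_lastPoint (hτ : Measurable τ) (hx : Measurable x) (hx' : Measurable x')
    (hy : Measurable y) (hv : Measurable v) :
    Measurable fun a => lastPoint (τ a) (x a) (x' a) (y a) (v a) := by
  unfold lastPoint; fun_prop

@[fun_prop]
theorem measurable_lastDir (hτ : Measurable τ) (hx : Measurable x) (hx' : Measurable x')
    (hy : Measurable y) (hv : Measurable v) :
    Measurable fun a => lastDir (τ a) (x a) (x' a) (y a) (v a) := by
  unfold lastDir; fun_prop

@[fun_prop]
theorem measurable_earlyPoint (i : Fin j) (hx' : Measurable x') (hy : Measurable y) :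
    Measurable fun a => earlyPoint (x' a) (y a) i := by
  unfold earlyPoint; fun_prop

@[fun_prop]
theorem measurable_points (hτ : Measurable τ) (hx : Measurable x) (hx' : Measurable x')
    (hy : Measurable y) (hv : Measurable v) (i : Fin (j + 1)) :
    Measurable fun a => points (τ a) (x a) (x' a) (y a) (v a) i := by
  unfold points
  refine Fin.cases ?_ (fun i => ?_) i
  · simp only [Fin.cons_zero]; fun_prop
  · simp only [Fin.cons_succ]; fun_prop

@[fun_prop]
theorem measurable_directions (hτ : Measurable τ) (hx : Measurable x) (hx' : Measurable x')
    (hy : Measurable y) (hv : Measurable v) (i : Fin (j + 2)) :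
    Measurable fun a => directions (τ a) (x a) (x' a) (y a) (v a) i := by
  unfold directions
  refine Fin.cases ?_ (fun i => ?_) i
  · simp only [Fin.cons_zero]; fun_prop
  · simp only [Fin.cons_succ]
    refine Fin.cases ?_ (fun i => ?_) i
    · simp only [Fin.cons_zero]; fun_prop
    · simp only [Fin.cons_succ]; fun_prop

@[fun_prop]
theorem measurable_brokenPath (hτ : Measurable τ) (hx : Measurable x) (hx' : Measurable x')
    (hy : Measurable y) (hv : Measurable v) (i : Fin (j + 1 + 2)) :
    Measurable fun a => brokenPath (τ a) (x a) (x' a) (y a) (v a) i := by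
  unfold brokenPath
  refine Fin.cases ?_ (fun i => ?_) i
  · simp only [Fin.cons_zero]; fun_prop
  · simp only [Fin.cons_succ]
    refine Fin.lastCases ?_ (fun i => ?_) i
    · simp only [Fin.snoc_last]; fun_prop
    · simp only [Fin.snoc_castSucc]; fun_prop

end Measurability


/-- The theorem fixes the data first and varies the path afterwards, whereas avoidance of null sets
is easiest to prove with the time varied last. Repeated Fubini converts between the two orders. -/
theorem ae_reorder {α β γ δ ε : Type*} [MeasurableSpace α] [MeasurableSpace β] [MeasurableSpace γ]
    [MeasurableSpace δ] [MeasurableSpace ε] {a : Measure α} {b : Measure β} {c : Measure γ}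
    {d : Measure δ} {e : Measure ε} [SFinite a] [SFinite b] [SFinite c] [SFinite d] [SFinite e]
    {P : α → β → γ → δ → ε → Prop}
    (hP : MeasurableSet {q : (α × β × γ) × (δ × ε) | P q.1.1 q.1.2.1 q.1.2.2 q.2.1 q.2.2})
    (h : ∀ᵐ x' ∂c, ∀ᵐ x ∂b, ∀ᵐ v ∂e, ∀ᵐ y ∂d, ∀ᵐ τ ∂a, P τ x x' y v) :
    ∀ᵐ p ∂(a.prod (b.prod c)), ∀ᵐ q ∂(d.prod e), P p.1 p.2.1 p.2.2 q.1 q.2 := by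
  have hm : ∀ {ζ : Type _} [MeasurableSpace ζ] {f : ζ → (α × β × γ) × (δ × ε)}, Measurable f →
      MeasurableSet {z | P (f z).1.1 (f z).1.2.1 (f z).1.2.2 (f z).2.1 (f z).2.2} :=
    fun hf => hf hP
  have h1 : MeasurableSet {p : α × β × γ | ∀ᵐ q ∂(d.prod e), P p.1 p.2.1 p.2.2 q.1 q.2} :=
    measurableSet_ae hP
  rw [Measure.ae_prod_iff_ae_ae h1, Measure.ae_ae_comm h1]
  have h2 : MeasurableSet {p : β × γ | ∀ᵐ τ ∂a, ∀ᵐ q ∂(d.prod e), P τ p.1 p.2 q.1 q.2} :=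
    measurableSet_ae (P := fun (p : β × γ) (τ : α) =>
      ∀ᵐ q : δ × ε ∂(d.prod e), P τ p.1 p.2 q.1 q.2)
      (measurable_swap h1)
  rw [Measure.ae_prod_iff_ae_ae h2, Measure.ae_ae_comm h2]
  filter_upwards [h] with x' hx'
  filter_upwards [hx'] with x hx
  have h3 : MeasurableSet {p : α × (δ × ε) | P p.1 x x' p.2.1 p.2.2} :=
    hm (f := fun p : α × (δ × ε) => ((p.1, x, x'), p.2)) (by fun_prop)
  rw [Measure.ae_ae_comm (p := fun τ (q : δ × ε) => P τ x x' q.1 q.2) h3]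
  have h4 : MeasurableSet {q : δ × ε | ∀ᵐ τ ∂a, P τ x x' q.1 q.2} :=
    measurableSet_ae (P := fun (q : δ × ε) τ => P τ x x' q.1 q.2) (measurable_swap h3)
  rw [Measure.ae_prod_iff_ae_ae h4, Measure.ae_ae_comm h4]
  exact hx

/-! ### Null sets and transversal lines issuing from the boundary -/

/-- The normal, extended by zero. -/
noncomputable def normalExt {n : ℕ} (X : Set (Euc n)) : Euc n → Euc n :=
  (frontier X).indicator (normal X)

section Boundary

variable {n : ℕ} {X : Set (Euc n)}

theorem measurable_normalExt (hXo : IsOpen X) (hX : HasC1Boundary X) :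
    Measurable (normalExt X) := by
  classical
  rw [normalExt, ← piecewise_eq_indicator]
  exact (continuousOn_normal hXo hX).measurable_piecewise continuousOn_const
    isClosed_frontier.measurableSet

theorem ae_mem_frontier : ∀ᵐ x ∂(surfaceMeasure X), x ∈ frontier X :=
  ae_restrict_mem isClosed_frontier.measurableSet

theorem ae_transversal (hXo : IsOpen X) (hX : HasC1Boundary X) [SFinite (surfaceMeasure X)] :
    ∀ᵐ v : Sph n ∂(sphereMeasure n), ∀ᵐ x ∂(surfaceMeasure X),
      inner ℝ (normal X x) (v : Euc n) ≠ 0 := by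
  have hmeas := measurable_normalExt hXo hX
  have h1 : ∀ᵐ x ∂(surfaceMeasure X), ∀ᵐ v : Sph n ∂(sphereMeasure n),
      inner ℝ (normalExt X x) (v : Euc n) ≠ 0 := by
    filter_upwards [ae_mem_frontier] with x hx
    rw [normalExt, indicator_of_mem hx]
    have hN : normal X x ≠ 0 := norm_ne_zero_iff.1 (by rw [norm_normal hX hx]; exact one_ne_zero)
    exact measure_eq_zero_iff_ae_notMem.1 (sphere_equator_null hN)
  rw [Measure.ae_ae_comm (p := fun x (v : Sph n) => inner ℝ (normalExt X x) (v : Euc n) ≠ 0)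
    (measurableSet_eq_fun (by fun_prop) measurable_const).compl] at h1
  filter_upwards [h1] with v hv
  filter_upwards [hv, ae_mem_frontier] with x hx hxf
  rwa [normalExt, indicator_of_mem hxf] at hx

/-- For almost every `v` the bad positions form a null set of space and almost every boundary point
is transversal to `v`; then `ae_surface_ae_line` applies. -/
theorem ae_sphere_surface_line (hn : 2 ≤ n) (hXo : IsOpen X) (hX : HasC1Boundary X)
    [SFinite (surfaceMeasure X)] {P : Euc n → Euc n → Prop}
    (hP : MeasurableSet {q : Euc n × Euc n | P q.1 q.2})
    (h : ∀ᵐ z : Euc n, ∀ᵐ v : Sph n ∂(sphereMeasure n), P z v) (c : Euc n) :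
    ∀ᵐ v : Sph n ∂(sphereMeasure n), ∀ᵐ x ∂(surfaceMeasure X), ∀ᵐ r : ℝ,
      P (x + r • (v : Euc n) + c) v := by
  have hm : Measurable fun q : Euc n × Sph n => (q.1, (q.2 : Euc n)) := by fun_prop
  rw [Measure.ae_ae_comm (p := fun z (v : Sph n) => P z v) (hm hP)] at h
  filter_upwards [h, ae_transversal hXo hX] with v hv htr
  have hA : volume {z | ¬ P (z + c) v} = 0 :=
    ae_iff.1 ((quasiMeasurePreserving_add_right volume c).ae hv)
  filter_upwards [ae_surface_ae_line hn hXo hX hA (norm_sph v) htr] with x hx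
  filter_upwards [hx] with r hr
  exact not_not.1 hr

theorem earlyPoint_update {j : ℕ} (x' : Euc n) (y : Fin j → Euc n) (i : Fin j) (u : Euc n) :
    earlyPoint x' (Function.update y i u) i = x' + u + ∑ l ∈ Finset.Ioi i, y l := by
  rw [earlyPoint, ← Finset.Ioi_insert, Finset.sum_insert (by simp), Function.update_self,
    ← add_assoc]
  congr 1
  exact Finset.sum_congr rfl fun l hl => by
    rw [Function.update_of_ne (Finset.mem_Ioi.1 hl).ne']

theorem earlyPoint_update_of_lt {j : ℕ} (x' : Euc n) (y : Fin j → Euc n) {i k : Fin j} (h : k < i)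
    (u : Euc n) : earlyPoint x' (Function.update y k u) i = earlyPoint x' y i := by
  rw [earlyPoint, earlyPoint]
  congr 1
  exact Finset.sum_congr rfl fun l hl => by
    rw [Function.update_of_ne (h.trans_le (Finset.mem_Ici.1 hl)).ne']

/-- In polar coordinates `y_i = r v` the collision point is `x' + r v + c`, where `c` comes from the
displacements of larger index. It runs along a line through a translated boundary point, in the very
direction in which the particle arrives. -/
theorem ae_earlyPoint (hn : 2 ≤ n) (hXo : IsOpen X) (hX : HasC1Boundary X)
    [SFinite (surfaceMeasure X)] {P : Euc n → Euc n → Prop}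
    (hP : MeasurableSet {q : Euc n × Euc n | P q.1 q.2})
    (h : ∀ᵐ z : Euc n, ∀ᵐ v : Sph n ∂(sphereMeasure n), P z v) {j : ℕ} (i : Fin j) :
    ∀ᵐ x' ∂(surfaceMeasure X), ∀ᵐ y : Fin j → Euc n, P (earlyPoint x' y i) (‖y i‖⁻¹ • y i) := by
  have hm : Measurable fun q : (Fin j → Euc n) × Euc n =>
      (earlyPoint q.2 q.1 i, ‖q.1 i‖⁻¹ • q.1 i) := by fun_prop
  rw [← Measure.ae_ae_comm (p := fun (y : Fin j → Euc n) x' =>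
    P (earlyPoint x' y i) (‖y i‖⁻¹ • y i)) (hm hP)]
  refine ae_update i (measurableSet_ae (P := fun (y : Fin j → Euc n) x' =>
    P (earlyPoint x' y i) (‖y i‖⁻¹ • y i)) (hm hP)) fun y => ?_
  simp only [earlyPoint_update, Function.update_self]
  set c := ∑ l ∈ Finset.Ioi i, y l
  have hm2 : Measurable fun q : Euc n × Euc n => (q.2 + q.1 + c, ‖q.1‖⁻¹ • q.1) := by fun_prop
  rw [ae_polar hn (measurableSet_ae (P := fun u x' => P (x' + u + c) (‖u‖⁻¹ • u)) (hm2 hP))]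
  filter_upwards [ae_sphere_surface_line hn hXo hX hP h c] with v hv
  have hm3 : Measurable fun q : Euc n × ℝ => (q.1 + q.2 • (v : Euc n) + c, (v : Euc n)) := by
    fun_prop
  rw [Measure.ae_ae_comm (p := fun x (r : ℝ) => P (x + r • (v : Euc n) + c) v) (hm3 hP)] at hv
  filter_upwards [hv] with r hr hr0
  filter_upwards [hr] with x' hx'
  rwa [norm_smul, norm_sph, mul_one, Real.norm_of_nonneg hr0.le, smul_smul,
    inv_mul_cancel₀ hr0.ne', one_smul]

end Boundary

/-! ### Collisions avoid null sets -/

section Collisions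

variable {n : ℕ} {X : Set (Euc n)} {P : Euc n → Euc n → Euc n → Prop}

/-- The collision point `x - l v` lies on a line through the boundary point `x`. For fixed `l` the
incoming direction is that of `w - l v`, which is generic because `w` varies with the displacements;
the time finally determines `l`. -/
theorem ae_lastCollision (hn : 2 ≤ n) (hXo : IsOpen X) (hX : HasC1Boundary X)
    [SFinite (surfaceMeasure X)] (hP : MeasurableSet {q : Euc n × Euc n × Euc n | P q.1 q.2.1 q.2.2})
    (h : ∀ᵐ z : Euc n, ∀ᵐ v : Sph n ∂(sphereMeasure n), ∀ᵐ v' : Sph n ∂(sphereMeasure n), P z v' v)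
    {j : ℕ} (x' : Euc n) :
    ∀ᵐ x ∂(surfaceMeasure X), ∀ᵐ v : Sph n ∂(sphereMeasure n),
      ∀ᵐ y : Fin (j + 1) → Euc n, ∀ᵐ τ : ℝ, y ∈ ellipsoid (j + 1) τ x x' →
        P (lastPoint τ x x' y v) (lastDir τ x x' y v) v := by
  have hm1 : Measurable fun q : (Euc n × Euc n) × Sph n => (q.1.1, (q.2 : Euc n), q.1.2) := by
    fun_prop
  have hmQ : MeasurableSet {q : Euc n × Euc n |
      ∀ᵐ v' : Sph n ∂(sphereMeasure n), P q.1 v' q.2} :=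
    measurableSet_ae (P := fun (q : Euc n × Euc n) (v' : Sph n) => P q.1 v' q.2) (hm1 hP)
  have h1 := ae_sphere_surface_line hn hXo hX (P := fun z v =>
    ∀ᵐ v' : Sph n ∂(sphereMeasure n), P z v' v) hmQ h 0
  have hm2 : Measurable fun q : (Sph n × Euc n) × ℝ =>
      (q.1.2 + q.2 • (q.1.1 : Euc n) + 0, (q.1.1 : Euc n)) := by fun_prop
  have hm3 := measurableSet_ae (ν := (volume : Measure ℝ)) (P := fun (q : Sph n × Euc n) (r : ℝ) =>
    ∀ᵐ v' : Sph n ∂(sphereMeasure n), P (q.2 + r • (q.1 : Euc n) + 0) v' q.1) (hm2 hmQ)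
  rw [Measure.ae_ae_comm (p := fun (v : Sph n) x => ∀ᵐ r : ℝ,
    ∀ᵐ v' : Sph n ∂(sphereMeasure n), P (x + r • (v : Euc n) + 0) v' v) hm3] at h1
  filter_upwards [h1] with x hx
  filter_upwards [hx] with v hv
  have hneg : ∀ᵐ l : ℝ, ∀ᵐ v' : Sph n ∂(sphereMeasure n), P (x - l • (v : Euc n)) v' v := by
    have := (Measure.measurePreserving_neg (volume : Measure ℝ)).quasiMeasurePreserving.ae hv
    filter_upwards [this] with l hl
    simpa only [neg_smul, add_zero, ← sub_eq_add_neg] using hl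
  have hu : ∀ᵐ w : Euc n, ∀ᵐ l : ℝ, P (x - l • (v : Euc n))
      (‖w - l • (v : Euc n)‖⁻¹ • (w - l • (v : Euc n))) v := by
    have hm4 : Measurable fun q : ℝ × Euc n => (x - q.1 • (v : Euc n),
      ‖q.2 - q.1 • (v : Euc n)‖⁻¹ • (q.2 - q.1 • (v : Euc n)), (v : Euc n)) := by fun_prop
    rw [← Measure.ae_ae_comm (p := fun (l : ℝ) (w : Euc n) => P (x - l • (v : Euc n))
      (‖w - l • (v : Euc n)‖⁻¹ • (w - l • (v : Euc n))) v) (hm4 hP)]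
    filter_upwards [hneg] with l hl
    have hm5 : Measurable fun u : Euc n => (x - l • (v : Euc n), u, (v : Euc n)) := by fun_prop
    exact (measurePreserving_sub_right volume (l • (v : Euc n))).quasiMeasurePreserving.ae
      (ae_direction hn (P := fun u => P (x - l • (v : Euc n)) u v) (hm5 hP) hl)
  filter_upwards [ae_sub_sum (j := j) (x - x') hu] with y hy
  have hy2 := (measurePreserving_sub_right volume (∑ i, ‖y i‖)).quasiMeasurePreserving.ae (ae_firstLeg (leftVec x x' y) v hy)
  filter_upwards [hy2] with τ hτ hell
  rw [mem_ellipsoid_iff] at hell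
  rw [lastDir_eq hell]
  exact hτ hell

/-- The point and the incoming direction do not involve `τ`, `x` or `v`. The outgoing direction is
that of `w - l v`, and `(l, v)` are polar coordinates of a generic vector. -/
theorem ae_secondCollision (hn : 2 ≤ n) (hXo : IsOpen X) (hX : HasC1Boundary X)
    [SFinite (surfaceMeasure X)] (hP : MeasurableSet {q : Euc n × Euc n × Euc n | P q.1 q.2.1 q.2.2})
    (h : ∀ᵐ z : Euc n, ∀ᵐ v' : Sph n ∂(sphereMeasure n), ∀ᵐ v : Sph n ∂(sphereMeasure n), P z v' v)
    {j : ℕ} (i : Fin j) :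
    ∀ᵐ x' ∂(surfaceMeasure X), ∀ x, ∀ᵐ v : Sph n ∂(sphereMeasure n),
      ∀ᵐ y : Fin j → Euc n, ∀ᵐ τ : ℝ, y ∈ ellipsoid j τ x x' →
        P (earlyPoint x' y i) (‖y i‖⁻¹ • y i) (lastDir τ x x' y v) := by
  have hm1 : Measurable fun q : (Euc n × Euc n) × Sph n => (q.1.1, q.1.2, (q.2 : Euc n)) := by
    fun_prop
  have hmQ : MeasurableSet {q : Euc n × Euc n |
      ∀ᵐ v : Sph n ∂(sphereMeasure n), P q.1 q.2 v} :=
    measurableSet_ae (P := fun (q : Euc n × Euc n) (v : Sph n) => P q.1 q.2 v) (hm1 hP)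
  have h1 := ae_earlyPoint hn hXo hX (P := fun z v' =>
    ∀ᵐ v : Sph n ∂(sphereMeasure n), P z v' v) hmQ h i
  filter_upwards [h1] with x' hx' x
  have hmE : Measurable fun q : ((Fin j → Euc n) × Sph n) × ℝ =>
      ‖leftVec x x' q.1.1‖ := by fun_prop
  have hm2 : MeasurableSet {q : ((Fin j → Euc n) × Sph n) × ℝ | q.1.1 ∈ ellipsoid j q.2 x x' →
      P (earlyPoint x' q.1.1 i) (‖q.1.1 i‖⁻¹ • q.1.1 i) (lastDir q.2 x x' q.1.1 q.1.2)} := by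
    simp only [mem_ellipsoid_iff]
    refine MeasurableSet.imp (measurableSet_lt (by fun_prop) (by fun_prop)) ?_
    have : Measurable fun q : ((Fin j → Euc n) × Sph n) × ℝ => (earlyPoint x' q.1.1 i,
      ‖q.1.1 i‖⁻¹ • q.1.1 i, lastDir q.2 x x' q.1.1 q.1.2) := by fun_prop
    exact this hP
  have hm3 := measurableSet_ae (ν := (volume : Measure ℝ))
    (P := fun (q : (Fin j → Euc n) × Sph n) (τ : ℝ) => q.1 ∈ ellipsoid j τ x x' →
      P (earlyPoint x' q.1 i) (‖q.1 i‖⁻¹ • q.1 i) (lastDir τ x x' q.1 q.2)) hm2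
  rw [← Measure.ae_ae_comm (p := fun (y : Fin j → Euc n) (v : Sph n) => ∀ᵐ τ : ℝ,
    y ∈ ellipsoid j τ x x' → P (earlyPoint x' y i) (‖y i‖⁻¹ • y i) (lastDir τ x x' y v)) hm3]
  filter_upwards [hx'] with y hy
  have hm4 : Measurable fun u : Euc n => (earlyPoint x' y i, ‖y i‖⁻¹ • y i, u) := by fun_prop
  have h2 : ∀ᵐ u : Euc n, P (earlyPoint x' y i) (‖y i‖⁻¹ • y i)
      (‖leftVec x x' y - u‖⁻¹ • (leftVec x x' y - u)) :=
    (quasiMeasurePreserving_sub_left volume (leftVec x x' y)).ae (ae_direction hn (P := fun u =>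
      P (earlyPoint x' y i) (‖y i‖⁻¹ • y i) u) (hm4 hP) hy)
  have hm5 : Measurable fun u : Euc n => (earlyPoint x' y i, ‖y i‖⁻¹ • y i,
    ‖leftVec x x' y - u‖⁻¹ • (leftVec x x' y - u)) := by fun_prop
  filter_upwards [(ae_polar hn (P := fun u => P (earlyPoint x' y i) (‖y i‖⁻¹ • y i)
    (‖leftVec x x' y - u‖⁻¹ • (leftVec x x' y - u))) (hm5 hP)).1 h2] with v hv
  have hy2 := (measurePreserving_sub_right volume (∑ i, ‖y i‖)).quasiMeasurePreserving.ae
    (ae_firstLeg (leftVec x x' y) v hv)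
  filter_upwards [hy2] with τ hτ hell
  rw [mem_ellipsoid_iff] at hell
  rw [lastDir_eq hell]
  exact hτ hell (sub_legLength_pos hell v)

/-- For `k < i` the point and incoming direction do not depend on `y k`, so the outgoing direction
`y k / |y k|` is free and generic. -/
theorem ae_earlyCollision (hn : 2 ≤ n) (hXo : IsOpen X) (hX : HasC1Boundary X)
    [SFinite (surfaceMeasure X)] (hP : MeasurableSet {q : Euc n × Euc n × Euc n | P q.1 q.2.1 q.2.2})
    (h : ∀ᵐ z : Euc n, ∀ᵐ v' : Sph n ∂(sphereMeasure n), ∀ᵐ v : Sph n ∂(sphereMeasure n), P z v' v)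
    {j : ℕ} {i k : Fin j} (hki : k < i) :
    ∀ᵐ x' ∂(surfaceMeasure X), ∀ᵐ y : Fin j → Euc n,
      P (earlyPoint x' y i) (‖y i‖⁻¹ • y i) (‖y k‖⁻¹ • y k) := by
  have hm1 : Measurable fun q : (Euc n × Euc n) × Sph n => (q.1.1, q.1.2, (q.2 : Euc n)) := by
    fun_prop
  have hmQ : MeasurableSet {q : Euc n × Euc n |
      ∀ᵐ v : Sph n ∂(sphereMeasure n), P q.1 q.2 v} :=
    measurableSet_ae (P := fun (q : Euc n × Euc n) (v : Sph n) => P q.1 q.2 v) (hm1 hP)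
  have h1 := ae_earlyPoint hn hXo hX (P := fun z v' =>
    ∀ᵐ v : Sph n ∂(sphereMeasure n), P z v' v) hmQ h i
  filter_upwards [h1] with x' hx'
  have hm2 : Measurable fun y : Fin j → Euc n => (earlyPoint x' y i, ‖y i‖⁻¹ • y i) := by fun_prop
  have hm3 : Measurable fun y : Fin j → Euc n =>
    (earlyPoint x' y i, ‖y i‖⁻¹ • y i, ‖y k‖⁻¹ • y k) := by fun_prop
  have h2 : ∀ᵐ y : Fin j → Euc n,
      (∀ᵐ v : Sph n ∂(sphereMeasure n), P (earlyPoint x' y i) (‖y i‖⁻¹ • y i) v) →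
      P (earlyPoint x' y i) (‖y i‖⁻¹ • y i) (‖y k‖⁻¹ • y k) := by
    refine ae_update k (MeasurableSet.imp (hm2 hmQ) (hm3 hP)) fun y => ?_
    simp only [earlyPoint_update_of_lt x' y hki, Function.update_self,
      Function.update_of_ne hki.ne']
    by_cases hgood : ∀ᵐ v : Sph n ∂(sphereMeasure n), P (earlyPoint x' y i) (‖y i‖⁻¹ • y i) v
    · have hm4 : Measurable fun u : Euc n => (earlyPoint x' y i, ‖y i‖⁻¹ • y i, u) := by fun_prop
      filter_upwards [ae_direction hn (P := fun u =>
        P (earlyPoint x' y i) (‖y i‖⁻¹ • y i) u) (hm4 hP) hgood] with u hu _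
      exact hu
    · exact Eventually.of_forall fun u hu => absurd hu hgood
  filter_upwards [hx', h2] with y hy hy2
  exact hy2 hy

/-- Almost all broken paths avoid a given null set of collisions. -/
theorem ae_collisions (hn : 2 ≤ n) (hXo : IsOpen X) (hX : HasC1Boundary X)
    [SFinite (surfaceMeasure X)] (hP : MeasurableSet {q : Euc n × Euc n × Euc n | P q.1 q.2.1 q.2.2})
    (h : ∀ᵐ q : Euc n × Sph n × Sph n ∂((volume : Measure (Euc n)).prod
      ((sphereMeasure n).prod (sphereMeasure n))), P q.1 q.2.1 q.2.2) (j : ℕ) (T : ℝ) :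
    ∀ᵐ p ∂(dataMeasure X T), ∀ᵐ q ∂((volume : Measure (Fin (j + 1) → Euc n)).prod
      (sphereMeasure n)), q.1 ∈ ellipsoid (j + 1) p.1 p.2.1 p.2.2 → ∀ i : Fin (j + 2),
        P (points p.1 p.2.1 p.2.2 q.1 q.2 i) (directions p.1 p.2.1 p.2.2 q.1 q.2 i.succ)
          (directions p.1 p.2.1 p.2.2 q.1 q.2 i.castSucc) := by
  have h1 : ∀ᵐ z : Euc n, ∀ᵐ v' : Sph n ∂(sphereMeasure n), ∀ᵐ v : Sph n ∂(sphereMeasure n),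
      P z v' v := by
    filter_upwards [Measure.ae_ae_of_ae_prod h] with z hz
    exact Measure.ae_ae_of_ae_prod hz
  have h2 : ∀ᵐ z : Euc n, ∀ᵐ v : Sph n ∂(sphereMeasure n), ∀ᵐ v' : Sph n ∂(sphereMeasure n),
      P z v' v := by
    filter_upwards [h1] with z hz
    have hm : Measurable fun q : Sph n × Sph n => (z, (q.1 : Euc n), (q.2 : Euc n)) := by fun_prop
    rwa [Measure.ae_ae_comm (p := fun v' v : Sph n => P z v' v) (hm hP)] at hz
  rw [dataMeasure]
  refine ae_reorder (P := fun τ x x' (y : Fin (j + 1) → Euc n) (v : Sph n) =>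
    y ∈ ellipsoid (j + 1) τ x x' → ∀ i : Fin (j + 2), P (points τ x x' y v i)
      (directions τ x x' y v i.succ) (directions τ x x' y v i.castSucc)) ?_ ?_
  · simp only [mem_ellipsoid_iff]
    refine MeasurableSet.imp (measurableSet_lt (by fun_prop) (by fun_prop)) ?_
    rw [ofPred_forall]
    refine MeasurableSet.iInter fun i => ?_
    have : Measurable fun q : (ℝ × Euc n × Euc n) × ((Fin (j + 1) → Euc n) × Sph n) =>
      (points q.1.1 q.1.2.1 q.1.2.2 q.2.1 q.2.2 i, directions q.1.1 q.1.2.1 q.1.2.2 q.2.1 q.2.2 i.succ,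
        directions q.1.1 q.1.2.1 q.1.2.2 q.2.1 q.2.2 i.castSucc) := by fun_prop
    exact this hP
  · have e2 : ∀ᵐ x' ∂(surfaceMeasure X), ∀ m : Fin j, ∀ᵐ y : Fin (j + 1) → Euc n,
        P (earlyPoint x' y m.succ) (‖y m.succ‖⁻¹ • y m.succ) (‖y m.castSucc‖⁻¹ • y m.castSucc) :=
      ae_all_iff.2 fun m => ae_earlyCollision hn hXo hX hP h1 m.castSucc_lt_succ
    filter_upwards [ae_secondCollision hn hXo hX hP h1 (0 : Fin (j + 1)), e2] with x' a1 a2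
    filter_upwards [ae_lastCollision hn hXo hX hP h2 (j := j) x'] with x b0
    filter_upwards [b0, a1 x] with v c0 c1
    filter_upwards [c0, c1, ae_all_iff.2 a2] with y d0 d1 d2
    -- The last collision and the one before it involve `lastDir`; all earlier ones join two
    -- consecutive displacements.
    filter_upwards [ae_restrict_of_ae d0, ae_restrict_of_ae d1] with τ f0 f1 hell
    refine Fin.cases (f0 hell) (fun l => ?_)
    refine Fin.cases (f1 hell) (fun m => ?_) l
    exact d2 m

end Collisions


/-! ### Visibility and attenuation -/

section Visibility

variable {n : ℕ} {X : Set (Euc n)}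

theorem visible_nonneg (a b : Euc n) : 0 ≤ visible X a b := by
  unfold visible; split_ifs <;> norm_num

theorem visible_le_one (a b : Euc n) : visible X a b ≤ 1 := by
  unfold visible; split_ifs <;> norm_num

theorem mem_of_visible_ne_zero {a b : Euc n} (h : visible X a b ≠ 0) {p : ℝ} (hp : p ∈ Ioc (0 : ℝ) 1) :
    a + p • (b - a) ∈ X := by
  unfold visible at h
  split_ifs at h with h1
  · exact h1 p hp
  · exact absurd rfl h

/-- Over the half-open parameter interval visibility is not an open condition. Over each compact
interval `[1/(m+1), 1]` it is, so the whole set is a countable intersection of open sets. -/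
theorem measurable_visible (hXo : IsOpen X) :
    Measurable fun q : Euc n × Euc n => visible X q.1 q.2 := by
  have hset : {q : Euc n × Euc n | ∀ p ∈ Ioc (0 : ℝ) 1, q.1 + p • (q.2 - q.1) ∈ X} =
      ⋂ m : ℕ, {q : Euc n × Euc n | ∀ p ∈ Icc (1 / ((m : ℝ) + 1)) 1, q.1 + p • (q.2 - q.1) ∈ X} := by
    ext q
    simp only [mem_ofPred_eq, mem_iInter]
    constructor
    · intro h m p hp
      exact h p ⟨lt_of_lt_of_le (by positivity) hp.1, hp.2⟩
    · intro h p hp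
      obtain ⟨m, hm⟩ := exists_nat_one_div_lt hp.1
      exact h m p ⟨hm.le, hp.2⟩
  have hmeas : MeasurableSet
      {q : Euc n × Euc n | ∀ p ∈ Ioc (0 : ℝ) 1, q.1 + p • (q.2 - q.1) ∈ X} := by
    rw [hset]
    refine MeasurableSet.iInter fun m => IsOpen.measurableSet (isOpen_iff_eventually.2 fun q hq => ?_)
    refine isCompact_Icc.eventually_forall_of_forall_eventually
      (P := fun (q : Euc n × Euc n) (p : ℝ) => q.1 + p • (q.2 - q.1) ∈ X) fun p hp => ?_
    have hc : Continuous fun z : (Euc n × Euc n) × ℝ => z.1.1 + z.2 • (z.1.2 - z.1.1) := by fun_prop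
    exact hc.continuousAt.eventually (hXo.mem_nhds (hq p hp))
  classical
  unfold visible
  exact Measurable.ite hmeas measurable_const measurable_const

/-- A visible point is reached before the boundary. -/
theorem lt_travelTimeBack (hXo : IsOpen X) (hXb : Bornology.IsBounded X) {x : Euc n} {v : Sph n}
    {l : ℝ} (hl : 0 < l) (h : visible X x (x - l • (v : Euc n)) ≠ 0) :
    l < travelTimeBack X x v := by
  have hseg : ∀ s ∈ Ioc (0 : ℝ) l, x - s • (v : Euc n) ∈ X := by
    intro s hs
    have := mem_of_visible_ne_zero h (p := s / l)
      ⟨div_pos hs.1 hl, (div_le_one hl).2 hs.2⟩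
    rwa [sub_sub_cancel_left, smul_neg, smul_smul, div_mul_cancel₀ _ hl.ne', ← sub_eq_add_neg] at this
  have hcont : Continuous fun s : ℝ => x - s • (v : Euc n) := by fun_prop
  obtain ⟨ε, hε, hball⟩ := Metric.mem_nhds_iff.1
    (hcont.continuousAt.preimage_mem_nhds (hXo.mem_nhds (hseg l ⟨hl, le_rfl⟩)))
  obtain ⟨R, hR⟩ := hXb.subset_closedBall x
  have hne : {s : ℝ | 0 < s ∧ x - s • (v : Euc n) ∉ X}.Nonempty := by
    refine ⟨|R| + 1, by positivity, fun hmem => ?_⟩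
    have h1 := hR hmem
    rw [mem_closedBall_iff_norm, sub_sub_cancel_left, norm_neg, norm_smul, norm_sph, mul_one,
      Real.norm_of_nonneg (by positivity)] at h1
    linarith [le_abs_self R]
  have : l + ε ≤ travelTimeBack X x v := by
    refine le_csInf hne fun s hs => ?_
    by_contra hcon
    rw [not_le] at hcon
    rcases le_or_gt s l with hsl | hsl
    · exact hs.2 (hseg s ⟨hs.1, hsl⟩)
    · refine hs.2 (hball (?_ : s ∈ Metric.ball l ε))
      rw [Metric.mem_ball, Real.dist_eq, abs_of_pos (by linarith)]
      linarith
  linarith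

theorem opticalLength_eq_integral {σ : Euc n → Euc n → ℝ} (a b : Euc n) :
    opticalLength σ a b = ∫ s in Ioo 0 ‖a - b‖,
      σ (a - s • (‖a - b‖⁻¹ • (a - b))) (‖a - b‖⁻¹ • (a - b)) := by
  rw [opticalLength, intervalIntegral.integral_of_le (norm_nonneg _), integral_Ioc_eq_integral_Ioo]

theorem opticalLength_congr {σ σ' : Euc n → Euc n → ℝ}
    (hσ : ∀ x ∈ X, ∀ v : Sph n, σ x v = σ' x v) {a b : Euc n}
    (h : ∀ r ∈ Ioo (0 : ℝ) 1, a + r • (b - a) ∈ X) :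
    opticalLength σ a b = opticalLength σ' a b := by
  rw [opticalLength_eq_integral, opticalLength_eq_integral]
  refine setIntegral_congr_fun measurableSet_Ioo fun s hs => ?_
  have hL : 0 < ‖a - b‖ := hs.1.trans hs.2
  have hmem : a - s • (‖a - b‖⁻¹ • (a - b)) ∈ X := by
    have := h (s / ‖a - b‖) ⟨div_pos hs.1 hL, (div_lt_one hL).2 hs.2⟩
    convert this using 1
    rw [smul_smul, div_eq_mul_inv, ← neg_sub a b, smul_neg, sub_eq_add_neg]
  have hunit : ‖a - b‖⁻¹ • (a - b) ∈ Metric.sphere (0 : Euc n) 1 := by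
    rw [mem_sphere_zero_iff_norm, norm_smul, norm_inv, norm_norm, inv_mul_cancel₀ hL.ne']
  exact hσ _ hmem ⟨_, hunit⟩

theorem opticalLength_nonneg {σ : Euc n → Euc n → ℝ} (hσ : ∀ x v, 0 ≤ σ x v) (a b : Euc n) :
    0 ≤ opticalLength σ a b := by
  rw [opticalLength_eq_integral]
  exact integral_nonneg fun s => hσ _ _

theorem measurable_opticalLength {σ : Euc n → Euc n → ℝ}
    (hσ : Measurable fun q : Euc n × Euc n => σ q.1 q.2) :
    Measurable fun q : Euc n × Euc n => opticalLength σ q.1 q.2 := by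
  simp only [opticalLength_eq_integral]
  have h1 : ∀ q : Euc n × Euc n, ∫ s in Ioo 0 ‖q.1 - q.2‖,
      σ (q.1 - s • (‖q.1 - q.2‖⁻¹ • (q.1 - q.2))) (‖q.1 - q.2‖⁻¹ • (q.1 - q.2)) =
      ∫ s : ℝ, if 0 < s ∧ s < ‖q.1 - q.2‖ then
        σ (q.1 - s • (‖q.1 - q.2‖⁻¹ • (q.1 - q.2))) (‖q.1 - q.2‖⁻¹ • (q.1 - q.2)) else 0 := by
    intro q
    rw [← integral_indicator measurableSet_Ioo]
    refine integral_congr_ae (Eventually.of_forall fun s => ?_)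
    simp only [indicator_apply, mem_Ioo]
  simp only [h1]
  have hm : Measurable fun z : (Euc n × Euc n) × ℝ => if 0 < z.2 ∧ z.2 < ‖z.1.1 - z.1.2‖ then
      σ (z.1.1 - z.2 • (‖z.1.1 - z.1.2‖⁻¹ • (z.1.1 - z.1.2)))
        (‖z.1.1 - z.1.2‖⁻¹ • (z.1.1 - z.1.2)) else 0 := by
    have hm1 : Measurable fun z : (Euc n × Euc n) × ℝ => ‖z.1.1 - z.1.2‖ := by fun_prop
    refine Measurable.ite ?_ ?_ measurable_const
    · exact (measurableSet_lt measurable_const measurable_snd).inter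
        (measurableSet_lt measurable_snd hm1)
    · have : Measurable fun z : (Euc n × Euc n) × ℝ =>
          (z.1.1 - z.2 • (‖z.1.1 - z.1.2‖⁻¹ • (z.1.1 - z.1.2)),
            ‖z.1.1 - z.1.2‖⁻¹ • (z.1.1 - z.1.2)) := by fun_prop
      exact hσ.comp this
  exact (hm.stronglyMeasurable.integral_prod_right' (ν := volume)).measurable

theorem measurable_attenuation (hXo : IsOpen X) {σ : Euc n → Euc n → ℝ}
    (hσ : Measurable fun q : Euc n × Euc n => σ q.1 q.2) {N : ℕ} :
    Measurable fun p : Fin (N + 2) → Euc n => attenuation X σ p := by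
  have h1 (i k : Fin (N + 2)) : Measurable fun p : Fin (N + 2) → Euc n =>
      opticalLength σ (p i) (p k) :=
    Measurable.comp (g := fun q : Euc n × Euc n => opticalLength σ q.1 q.2)
      (f := fun p : Fin (N + 2) → Euc n => (p i, p k)) (measurable_opticalLength hσ)
      ((measurable_pi_apply i).prodMk (measurable_pi_apply k))
  have h2 (i k : Fin (N + 2)) : Measurable fun p : Fin (N + 2) → Euc n =>
      visible X (p i) (p k) :=
    Measurable.comp (g := fun q : Euc n × Euc n => visible X q.1 q.2)
      (f := fun p : Fin (N + 2) → Euc n => (p i, p k)) (measurable_visible hXo)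
      ((measurable_pi_apply i).prodMk (measurable_pi_apply k))
  unfold attenuation
  exact ((Real.measurable_exp.comp (Finset.measurable_sum _ fun i _ => h1 _ _).neg).mul
    (h2 _ _)).mul (Finset.measurable_prod _ fun i _ => h2 _ _)

theorem visible_of_attenuation_ne_zero {σ : Euc n → Euc n → ℝ} {N : ℕ} {p : Fin (N + 2) → Euc n}
    (h : attenuation X σ p ≠ 0) :
    visible X (p (Fin.last (N + 1))) (p (Fin.last N).castSucc) ≠ 0 ∧
      ∀ i : Fin N, visible X (p i.castSucc.castSucc) (p i.succ.castSucc) ≠ 0 := by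
  unfold attenuation at h
  refine ⟨right_ne_zero_of_mul (left_ne_zero_of_mul h), fun i => ?_⟩
  exact Finset.prod_ne_zero_iff.1 (right_ne_zero_of_mul h) i (Finset.mem_univ i)

/-- Visibility keeps the interior of every segment inside `X`, where the two absorption coefficients
agree; if it fails, both sides vanish. -/
theorem attenuation_congr {σ σ' : Euc n → Euc n → ℝ}
    (hσ : ∀ x ∈ X, ∀ v : Sph n, σ x v = σ' x v) {N : ℕ} (p : Fin (N + 2) → Euc n) :
    attenuation X σ p = attenuation X σ' p := by
  by_cases hvis : visible X (p (Fin.last (N + 1))) (p (Fin.last N).castSucc) ≠ 0 ∧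
      ∀ i : Fin N, visible X (p i.castSucc.castSucc) (p i.succ.castSucc) ≠ 0
  · have : ∀ i : Fin (N + 1), opticalLength σ (p i.castSucc) (p i.succ) =
        opticalLength σ' (p i.castSucc) (p i.succ) := by
      refine Fin.lastCases ?_ fun i => ?_
      · refine opticalLength_congr hσ fun r hr => ?_
        -- The last segment is tested from its end `x'`, which lies outside `X` when it is a
        -- boundary point; hence the reversed parameter.
        have := mem_of_visible_ne_zero hvis.1 (p := 1 - r) ⟨by linarith [hr.2], by linarith [hr.1]⟩
        rw [Fin.succ_last]
        convert this using 1
        module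
      · refine opticalLength_congr hσ fun r hr => ?_
        rw [Fin.succ_castSucc]
        exact mem_of_visible_ne_zero (hvis.2 i) ⟨hr.1, hr.2.le⟩
    unfold attenuation
    simp only [this]
  · have h0 : ∀ s : Euc n → Euc n → ℝ, attenuation X s p = 0 := fun s => by
      by_contra h
      exact hvis (visible_of_attenuation_ne_zero h)
    rw [h0, h0]

theorem abs_attenuation_le_one {σ : Euc n → Euc n → ℝ} (hσ : ∀ x v, 0 ≤ σ x v) {N : ℕ}
    (p : Fin (N + 2) → Euc n) : |attenuation X σ p| ≤ 1 := by
  have h1 : Real.exp (-∑ i : Fin (N + 1), opticalLength σ (p i.castSucc) (p i.succ)) ≤ 1 :=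
    Real.exp_le_one_iff.2 (neg_nonpos.2 (Finset.sum_nonneg fun i _ => opticalLength_nonneg hσ _ _))
  have h2 : 0 ≤ ∏ i : Fin N, visible X (p i.castSucc.castSucc) (p i.succ.castSucc) :=
    Finset.prod_nonneg fun i _ => visible_nonneg _ _
  have h3 : ∏ i : Fin N, visible X (p i.castSucc.castSucc) (p i.succ.castSucc) ≤ 1 :=
    Finset.prod_le_one (fun i _ => visible_nonneg _ _) fun i _ => visible_le_one _ _
  have h4 := visible_nonneg (X := X) (p (Fin.last (N + 1))) (p (Fin.last N).castSucc)
  have h5 := visible_le_one (X := X) (p (Fin.last (N + 1))) (p (Fin.last N).castSucc)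
  unfold attenuation
  rw [abs_of_nonneg (by positivity)]
  exact mul_le_one₀ (mul_le_one₀ h1 h4 h5) h2 h3

variable {j : ℕ} {τ : ℝ} {x x' : Euc n} {y : Fin j → Euc n} {v : Euc n}

theorem visible_lastPoint {σ : Euc n → Euc n → ℝ}
    (h : attenuation X σ (brokenPath τ x x' y v) ≠ 0) :
    visible X x (lastPoint τ x x' y v) ≠ 0 := by
  have := (visible_of_attenuation_ne_zero h).2 0
  rw [brokenPath, Fin.castSucc_zero, Fin.castSucc_zero, Fin.cons_zero, ← Fin.succ_castSucc,
    Fin.cons_succ, Fin.snoc_castSucc] at this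
  exact this

theorem visible_firstPoint {σ : Euc n → Euc n → ℝ}
    (h : attenuation X σ (brokenPath τ x x' y v) ≠ 0) :
    visible X x' (points τ x x' y v (Fin.last j)) ≠ 0 := by
  have := (visible_of_attenuation_ne_zero h).1
  rwa [brokenPath, ← Fin.succ_last, Fin.cons_succ, Fin.snoc_last, ← Fin.succ_last,
    ← Fin.succ_castSucc, Fin.cons_succ, Fin.snoc_castSucc] at this

end Visibility

theorem earlyPoint_last {n j : ℕ} (x' : Euc n) (y : Fin (j + 1) → Euc n) :
    earlyPoint x' y (Fin.last j) = x' + y (Fin.last j) := by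
  have : Finset.Ici (Fin.last j) = {Fin.last j} := by
    ext l
    simp [Fin.last_le_iff]
  rw [earlyPoint, this, Finset.sum_singleton]

/-- A direction into the domain points inwards. -/
theorem inner_normal_nonpos {n : ℕ} {X : Set (Euc n)} (hX : HasC1Boundary X) {x u : Euc n}
    (hx : x ∈ frontier X) (h : visible X x (x + u) ≠ 0) : inner ℝ (normal X x) u ≤ 0 := by
  by_contra hcon
  rw [not_le] at hcon
  have h1 := (hX.normal_spec hx).eventually_notMem hcon
  have h2 : ∀ᶠ s in 𝓝[>] (0 : ℝ), s ∈ Ioc (0 : ℝ) 1 := Ioc_mem_nhdsGT one_pos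
  obtain ⟨s, hs1, hs2⟩ := (h1.and h2).exists
  have := mem_of_visible_ne_zero h hs2
  rw [add_sub_cancel_left] at this
  exact hs1 this


variable {n : ℕ} {X : Set (Euc n)}

/-! ### Globally defined measurable coefficients -/

/-- The coefficients are measurable and bounded everywhere, and the collision kernel vanishes at
distance less than `δ` from the boundary. -/
structure RegularCoefficients (X : Set (Euc n)) (σ : Euc n → Euc n → ℝ)
    (k : Euc n → Euc n → Euc n → ℝ) (S W : Euc n → Euc n → ℝ) (δ K A : ℝ) : Prop where
  absorption_measurable : Measurable fun q : Euc n × Euc n => σ q.1 q.2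
  absorption_nonneg : ∀ x v, 0 ≤ σ x v
  collision_measurable : Measurable fun q : Euc n × Euc n × Euc n => k q.1 q.2.1 q.2.2
  collision_bound : ∀ z v' v, |k z v' v| ≤ K
  collision_support : ∀ z v' v, k z v' v ≠ 0 → δ ≤ Metric.infDist z (frontier X)
  source_measurable : Measurable fun q : Euc n × Euc n => S q.1 q.2
  source_bound : ∀ x v, |S x v| ≤ A
  window_measurable : Measurable fun q : Euc n × Euc n => W q.1 q.2
  window_bound : ∀ x v, |W x v| ≤ A

theorem exists_measurable_absorption (hXo : IsOpen X) {σ : Euc n → Euc n → ℝ}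
    (hσ : ∀ x ∈ X, ∀ v : Sph n, 0 ≤ σ x v)
    (hm : Measurable fun p : ↥X × Sph n => σ p.1 p.2) :
    ∃ σ' : Euc n → Euc n → ℝ, (Measurable fun q : Euc n × Euc n => σ' q.1 q.2) ∧
      (∀ x v, 0 ≤ σ' x v) ∧ ∀ x ∈ X, ∀ v : Sph n, σ x v = σ' x v := by
  have he : MeasurableEmbedding (Prod.map Subtype.val Subtype.val : ↥X × Sph n → Euc n × Euc n) :=
    (MeasurableEmbedding.subtype_coe hXo.measurableSet).prodMap
      (MeasurableEmbedding.subtype_coe Metric.isClosed_sphere.measurableSet)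
  obtain ⟨g, hg, hge⟩ := he.exists_measurable_extend hm fun _ => ⟨0⟩
  refine ⟨fun x v => max (g (x, v)) 0, hg.max measurable_const, fun x v => le_max_right _ _,
    fun x hx v => ?_⟩
  have h1 : g (x, v) = σ x v := congrFun hge (⟨x, hx⟩, v)
  simp only [h1, max_eq_left (hσ x hx v)]

/-- A Borel extension is set to zero wherever it exceeds the essential bound or is nonzero too near
the boundary. On `X` this alters `k` only on a null set of collisions, the complement of `P`, which
broken paths generically avoid. -/
theorem exists_measurable_collision (hXo : IsOpen X) {k : Euc n → Euc n → Euc n → ℝ}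
    (hm : Measurable fun p : ↥X × Sph n × Sph n => k p.1 p.2.1 p.2.2)
    (hb : MemLp (fun p : Euc n × Sph n × Sph n => k p.1 p.2.1 p.2.2) ∞ (collisionMeasure X))
    {δ : ℝ} (hδ : ∀ᵐ p ∂(collisionMeasure X),
      Metric.infDist p.1 (frontier X) < δ → k p.1 p.2.1 p.2.2 = 0) :
    ∃ (K : ℝ) (k' : Euc n → Euc n → Euc n → ℝ) (P : Euc n → Euc n → Euc n → Prop),
      (Measurable fun q : Euc n × Euc n × Euc n => k' q.1 q.2.1 q.2.2) ∧
      (∀ z v' v, |k' z v' v| ≤ K) ∧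
      (∀ z v' v, k' z v' v ≠ 0 → δ ≤ Metric.infDist z (frontier X)) ∧
      MeasurableSet {q : Euc n × Euc n × Euc n | P q.1 q.2.1 q.2.2} ∧
      (∀ᵐ q : Euc n × Sph n × Sph n ∂((volume : Measure (Euc n)).prod
        ((sphereMeasure n).prod (sphereMeasure n))), P q.1 q.2.1 q.2.2) ∧
      ∀ z ∈ X, ∀ v' v : Sph n, P z v' v → k z v' v = k' z v' v := by
  classical
  have hs : MeasurableEmbedding (Subtype.val : Sph n → Euc n) :=
    MeasurableEmbedding.subtype_coe Metric.isClosed_sphere.measurableSet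
  have he : MeasurableEmbedding (Prod.map Subtype.val (Prod.map Subtype.val Subtype.val) :
      ↥X × Sph n × Sph n → Euc n × Euc n × Euc n) :=
    (MeasurableEmbedding.subtype_coe hXo.measurableSet).prodMap (hs.prodMap hs)
  obtain ⟨g, hg, hge⟩ := he.exists_measurable_extend hm fun _ => ⟨0⟩
  have hgk : ∀ z ∈ X, ∀ v' v : Sph n, g (z, (v' : Euc n), (v : Euc n)) = k z v' v :=
    fun z hz v' v => congrFun hge (⟨z, hz⟩, v', v)
  set K : ℝ := (eLpNormEssSup (fun p : Euc n × Sph n × Sph n => k p.1 p.2.1 p.2.2)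
    (collisionMeasure X)).toReal with hK
  have hfin : eLpNormEssSup (fun p : Euc n × Sph n × Sph n => k p.1 p.2.1 p.2.2)
      (collisionMeasure X) ≠ ∞ := by
    have := hb.2.ne
    rwa [eLpNorm_exponent_top] at this
  have hae : ∀ᵐ p ∂(collisionMeasure X), |k p.1 p.2.1 p.2.2| ≤ K := by
    filter_upwards [ae_le_eLpNormEssSup (f := fun p : Euc n × Sph n × Sph n => k p.1 p.2.1 p.2.2)
      (μ := collisionMeasure X)] with p hp
    have := ENNReal.toReal_mono hfin hp
    rwa [toReal_enorm, Real.norm_eq_abs] at this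
  set Q : Set (Euc n × Euc n × Euc n) :=
    {q | δ ≤ Metric.infDist q.1 (frontier X) ∧ |g q| ≤ K} with hQ
  have hQm : MeasurableSet Q :=
    (measurableSet_le measurable_const
      ((Metric.continuous_infDist_pt _).measurable.comp measurable_fst)).inter
      (measurableSet_le hg.abs measurable_const)
  have hk'm : Measurable (Q.indicator g) := hg.indicator hQm
  refine ⟨K, fun z v' v => Q.indicator g (z, v', v),
    fun z v' v => z ∈ X → g (z, v', v) = Q.indicator g (z, v', v), hk'm, fun z v' v => ?_,
    fun z v' v h => (mem_of_indicator_ne_zero h).1, ?_, ?_, fun z hz v' v h => ?_⟩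
  · by_cases h : (z, v', v) ∈ Q
    · simpa only [indicator_of_mem h] using h.2
    · simp only [indicator_of_notMem h, abs_zero]
      exact ENNReal.toReal_nonneg
  · exact (measurable_fst hXo.measurableSet).imp (measurableSet_eq_fun hg hk'm)
  · have hres : collisionMeasure X = ((volume : Measure (Euc n)).prod
        ((sphereMeasure n).prod (sphereMeasure n))).restrict (X ×ˢ univ) := by
      rw [← Measure.prod_restrict, Measure.restrict_univ, collisionMeasure]
    rw [hres, ae_restrict_iff' (hXo.measurableSet.prod MeasurableSet.univ)] at hae hδ
    filter_upwards [hae, hδ] with q h1 h2 hq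
    have h3 := hgk q.1 hq q.2.1 q.2.2
    by_cases hd : Metric.infDist q.1 (frontier X) < δ
    · have h4 := h2 ⟨hq, mem_univ _⟩ hd
      rw [indicator_of_notMem fun hmem => absurd hmem.1 (not_le.2 hd), h3, h4]
    · rw [indicator_of_mem]
      refine ⟨not_lt.1 hd, ?_⟩
      rw [h3]
      exact h1 ⟨hq, mem_univ _⟩
  · rw [← hgk z hz, h hz]

theorem exists_measurable_extension {s : Set (Euc n × Euc n)} (hs : MeasurableSet s)
    {F : Euc n → Euc n → ℝ} (hF : ContinuousOn (fun p : Euc n × Euc n => F p.1 p.2) s)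
    (hb : ∃ C : ℝ, ∀ p ∈ s, |F p.1 p.2| ≤ C) :
    ∃ (C : ℝ) (F' : Euc n → Euc n → ℝ), (Measurable fun p : Euc n × Euc n => F' p.1 p.2) ∧
      (∀ x v, |F' x v| ≤ C) ∧ ∀ x v, (x, v) ∈ s → F x v = F' x v := by
  classical
  obtain ⟨C, hC⟩ := hb
  refine ⟨max C 0, fun x v => s.indicator (fun p : Euc n × Euc n => F p.1 p.2) (x, v), ?_,
    fun x v => ?_, fun x v h => ?_⟩
  · change Measurable (s.indicator (fun p : Euc n × Euc n => F p.1 p.2))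
    rw [← piecewise_eq_indicator]
    exact hF.measurable_piecewise continuousOn_const hs
  · by_cases h : (x, v) ∈ s
    · simp only [indicator_of_mem h]
      exact (hC _ h).trans (le_max_left _ _)
    · simp only [indicator_of_notMem h, abs_zero]
      exact le_max_right _ _
  · simp only [indicator_of_mem h]

theorem normalExt_of_mem {x : Euc n} (hx : x ∈ frontier X) : normalExt X x = normal X x :=
  indicator_of_mem hx _

theorem measurable_inner_normalExt (hXo : IsOpen X) (hX : HasC1Boundary X) :
    Measurable fun p : Euc n × Euc n => (inner ℝ (normalExt X p.1) p.2 : ℝ) :=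
  ((measurable_normalExt hXo hX).comp measurable_fst).inner measurable_snd

theorem measurableSet_outgoing (hXo : IsOpen X) (hX : HasC1Boundary X) :
    MeasurableSet (outgoing X) := by
  have : outgoing X = Prod.fst ⁻¹' frontier X ∩ (Prod.snd ⁻¹' Metric.sphere 0 1 ∩
      {p : Euc n × Euc n | 0 < inner ℝ (normalExt X p.1) p.2}) := by
    ext p
    refine and_congr_right fun hp => ?_
    simp only [mem_inter_iff, mem_preimage, mem_sphere_zero_iff_norm, mem_ofPred_eq,
      normalExt_of_mem hp]
  rw [this]
  exact (measurable_fst isClosed_frontier.measurableSet).inter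
    ((measurable_snd Metric.isClosed_sphere.measurableSet).inter
      (measurableSet_lt measurable_const (measurable_inner_normalExt hXo hX)))

theorem measurableSet_incoming (hXo : IsOpen X) (hX : HasC1Boundary X) :
    MeasurableSet (incoming X) := by
  have : incoming X = Prod.fst ⁻¹' frontier X ∩ (Prod.snd ⁻¹' Metric.sphere 0 1 ∩
      {p : Euc n × Euc n | inner ℝ (normalExt X p.1) p.2 < 0}) := by
    ext p
    refine and_congr_right fun hp => ?_
    simp only [mem_inter_iff, mem_preimage, mem_sphere_zero_iff_norm, mem_ofPred_eq,
      normalExt_of_mem hp]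
  rw [this]
  exact (measurable_fst isClosed_frontier.measurableSet).inter
    ((measurable_snd Metric.isClosed_sphere.measurableSet).inter
      (measurableSet_lt (measurable_inner_normalExt hXo hX) measurable_const))

theorem measurable_apply₂ {α β γ δ : Type*} [MeasurableSpace α] [MeasurableSpace β]
    [MeasurableSpace γ] [MeasurableSpace δ] {F : β → γ → δ}
    (hF : Measurable fun q : β × γ => F q.1 q.2) {f : α → β} {g : α → γ} (hf : Measurable f)
    (hg : Measurable g) : Measurable fun a => F (f a) (g a) :=
  hF.comp (hf.prodMk hg)

theorem measurable_apply₃ {α β γ δ ε : Type*} [MeasurableSpace α] [MeasurableSpace β]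
    [MeasurableSpace γ] [MeasurableSpace δ] [MeasurableSpace ε] {F : β → γ → δ → ε}
    (hF : Measurable fun q : β × γ × δ => F q.1 q.2.1 q.2.2) {f : α → β} {g : α → γ} {h : α → δ}
    (hf : Measurable f) (hg : Measurable g) (hh : Measurable h) :
    Measurable fun a => F (f a) (g a) (h a) :=
  hF.comp (hf.prodMk (hg.prodMk hh))

/-! ### The integrand with regular coefficients -/

open Classical in
/-- The integrand of `γ_{j+1}`, extended by zero, without the cut-off at the travel time and with
the normal extended by zero. -/
noncomputable def regularIntegrand (X : Set (Euc n)) (σ : Euc n → Euc n → ℝ)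
    (k : Euc n → Euc n → Euc n → ℝ) (S W : Euc n → Euc n → ℝ) (j : ℕ)
    (p : ℝ × Euc n × Euc n) (q : (Fin j → Euc n) × Sph n) : ℝ :=
  if ‖leftVec p.2.1 p.2.2 q.1‖ < leftTime p.1 q.1 ∧ (∀ i, earlyPoint p.2.2 q.1 i ∈ X) ∧
      0 < inner ℝ (normalExt X p.2.1) (q.2 : Euc n) then
    inner ℝ (normalExt X p.2.1) (q.2 : Euc n) * W p.2.1 q.2 *
      (scatterDensity (leftTime p.1 q.1) (leftVec p.2.1 p.2.2 q.1) q.2 /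
        ∏ i, ‖q.1 i‖ ^ (n - 1)) *
      attenuation X σ (brokenPath p.1 p.2.1 p.2.2 q.1 q.2) *
      (∏ i : Fin (j + 1), k (points p.1 p.2.1 p.2.2 q.1 q.2 i)
        (directions p.1 p.2.1 p.2.2 q.1 q.2 i.succ)
        (directions p.1 p.2.1 p.2.2 q.1 q.2 i.castSucc)) *
      S p.2.2 (directions p.1 p.2.1 p.2.2 q.1 q.2 (Fin.last (j + 1))) *
      |inner ℝ (normalExt X p.2.2) (directions p.1 p.2.1 p.2.2 q.1 q.2 (Fin.last (j + 1)))|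
  else 0

@[fun_prop]
theorem measurable_scatterDensity {α : Type*} [MeasurableSpace α] {t : α → ℝ} {w : α → Euc n}
    {v : α → Sph n} (ht : Measurable t) (hw : Measurable w) (hv : Measurable v) :
    Measurable fun a => scatterDensity (t a) (w a) (v a) := by
  unfold scatterDensity
  fun_prop

theorem RegularCoefficients.measurable_regularIntegrand (hXo : IsOpen X) (hX : HasC1Boundary X)
    {σ : Euc n → Euc n → ℝ} {k : Euc n → Euc n → Euc n → ℝ} {S W : Euc n → Euc n → ℝ} {δ K A : ℝ}
    (h : RegularCoefficients X σ k S W δ K A) (j : ℕ) :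
    Measurable fun z : (ℝ × Euc n × Euc n) × ((Fin j → Euc n) × Sph n) =>
      regularIntegrand X σ k S W j z.1 z.2 := by
  have hv : Measurable fun z : (ℝ × Euc n × Euc n) × ((Fin j → Euc n) × Sph n) =>
      (z.2.2 : Euc n) := by fun_prop
  have hd : ∀ i, Measurable fun z : (ℝ × Euc n × Euc n) × ((Fin j → Euc n) × Sph n) =>
      directions z.1.1 z.1.2.1 z.1.2.2 z.2.1 (z.2.2 : Euc n) i := fun i => by fun_prop
  have hp : ∀ i, Measurable fun z : (ℝ × Euc n × Euc n) × ((Fin j → Euc n) × Sph n) =>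
      points z.1.1 z.1.2.1 z.1.2.2 z.2.1 (z.2.2 : Euc n) i := fun i => by fun_prop
  have hb : Measurable fun z : (ℝ × Euc n × Euc n) × ((Fin j → Euc n) × Sph n) =>
      brokenPath z.1.1 z.1.2.1 z.1.2.2 z.2.1 (z.2.2 : Euc n) :=
    measurable_pi_lambda _ fun i => by fun_prop
  have hx : Measurable fun z : (ℝ × Euc n × Euc n) × ((Fin j → Euc n) × Sph n) => z.1.2.1 := by
    fun_prop
  have hx' : Measurable fun z : (ℝ × Euc n × Euc n) × ((Fin j → Euc n) × Sph n) => z.1.2.2 := by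
    fun_prop
  have hN := measurable_normalExt hXo hX
  have hN1 : Measurable fun z : (ℝ × Euc n × Euc n) × ((Fin j → Euc n) × Sph n) =>
      inner ℝ (normalExt X z.1.2.1) (z.2.2 : Euc n) := (hN.comp hx).inner hv
  have hN2 : Measurable fun z : (ℝ × Euc n × Euc n) × ((Fin j → Euc n) × Sph n) =>
      inner ℝ (normalExt X z.1.2.2)
        (directions z.1.1 z.1.2.1 z.1.2.2 z.2.1 (z.2.2 : Euc n) (Fin.last (j + 1))) :=
    (hN.comp hx').inner (hd _)
  have hW : Measurable fun z : (ℝ × Euc n × Euc n) × ((Fin j → Euc n) × Sph n) =>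
      W z.1.2.1 z.2.2 := measurable_apply₂ h.window_measurable hx hv
  have hS : Measurable fun z : (ℝ × Euc n × Euc n) × ((Fin j → Euc n) × Sph n) =>
      S z.1.2.2 (directions z.1.1 z.1.2.1 z.1.2.2 z.2.1 (z.2.2 : Euc n) (Fin.last (j + 1))) :=
    measurable_apply₂ h.source_measurable hx' (hd _)
  have hk : ∀ i : Fin (j + 1), Measurable
      fun z : (ℝ × Euc n × Euc n) × ((Fin j → Euc n) × Sph n) =>
      k (points z.1.1 z.1.2.1 z.1.2.2 z.2.1 (z.2.2 : Euc n) i)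
        (directions z.1.1 z.1.2.1 z.1.2.2 z.2.1 (z.2.2 : Euc n) i.succ)
        (directions z.1.1 z.1.2.1 z.1.2.2 z.2.1 (z.2.2 : Euc n) i.castSucc) := fun i =>
    measurable_apply₃ h.collision_measurable (hp i) (hd i.succ) (hd i.castSucc)
  have hE : Measurable fun z : (ℝ × Euc n × Euc n) × ((Fin j → Euc n) × Sph n) =>
      attenuation X σ (brokenPath z.1.1 z.1.2.1 z.1.2.2 z.2.1 (z.2.2 : Euc n)) :=
    (measurable_attenuation hXo h.absorption_measurable).comp hb
  have hR : Measurable fun z : (ℝ × Euc n × Euc n) × ((Fin j → Euc n) × Sph n) =>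
      scatterDensity (leftTime z.1.1 z.2.1) (leftVec z.1.2.1 z.1.2.2 z.2.1) z.2.2 /
        ∏ i, ‖z.2.1 i‖ ^ (n - 1) := by fun_prop
  unfold regularIntegrand
  refine Measurable.ite ?_ (((((((hN1.mul hW).mul hR).mul hE).mul
    (Finset.measurable_prod _ fun i _ => hk i)).mul hS).mul hN2.abs)) measurable_const
  have h1 : Measurable fun z : (ℝ × Euc n × Euc n) × ((Fin j → Euc n) × Sph n) =>
      ‖leftVec z.1.2.1 z.1.2.2 z.2.1‖ := by fun_prop
  have h2 : Measurable fun z : (ℝ × Euc n × Euc n) × ((Fin j → Euc n) × Sph n) =>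
      leftTime z.1.1 z.2.1 := by fun_prop
  refine (measurableSet_lt h1 h2).inter (MeasurableSet.inter ?_
    (measurableSet_lt measurable_const hN1))
  change MeasurableSet {z : (ℝ × Euc n × Euc n) × ((Fin j → Euc n) × Sph n) |
    ∀ i, earlyPoint z.1.2.2 z.2.1 i ∈ X}
  rw [ofPred_forall]
  refine MeasurableSet.iInter fun i => ?_
  have h3 : Measurable fun z : (ℝ × Euc n × Euc n) × ((Fin j → Euc n) × Sph n) =>
      earlyPoint z.1.2.2 z.2.1 i := by fun_prop
  exact h3 hXo.measurableSet


theorem points_zero {j : ℕ} (τ : ℝ) (x x' : Euc n) (y : Fin j → Euc n) (v : Euc n) :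
    points τ x x' y v 0 = lastPoint τ x x' y v := rfl

theorem points_succ {j : ℕ} (τ : ℝ) (x x' : Euc n) (y : Fin j → Euc n) (v : Euc n) (i : Fin j) :
    points τ x x' y v i.succ = earlyPoint x' y i := rfl

theorem points_last {j : ℕ} (τ : ℝ) (x x' : Euc n) (y : Fin (j + 1) → Euc n) (v : Euc n) :
    points τ x x' y v (Fin.last (j + 1)) = x' + y (Fin.last j) := by
  rw [← Fin.succ_last, points_succ, earlyPoint_last]

theorem directions_last {j : ℕ} (τ : ℝ) (x x' : Euc n) (y : Fin (j + 1) → Euc n) (v : Euc n) :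
    directions τ x x' y v (Fin.last (j + 2)) = ‖y (Fin.last j)‖⁻¹ • y (Fin.last j) := rfl

theorem directions_mem_sphere {j : ℕ} {τ : ℝ} {x x' : Euc n} {y : Fin j → Euc n}
    (h : ‖leftVec x x' y‖ < leftTime τ y) (hy : ∀ i, y i ≠ 0) (v : Sph n) (i : Fin (j + 2)) :
    directions τ x x' y v i ∈ Metric.sphere (0 : Euc n) 1 := by
  have hunit : ∀ u : Euc n, u ≠ 0 → ‖u‖⁻¹ • u ∈ Metric.sphere (0 : Euc n) 1 := fun u hu => by
    rw [mem_sphere_zero_iff_norm, norm_smul, norm_inv, norm_norm,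
      inv_mul_cancel₀ (norm_ne_zero_iff.2 hu)]
  refine Fin.cases v.2 (fun i => Fin.cases ?_ (fun i => ?_) i) i
  · change lastDir τ x x' y v ∈ _
    rw [lastDir_eq h]
    refine hunit _ (norm_ne_zero_iff.1 ?_)
    rw [lastLeg_eq, norm_sub_legLength h]
    exact (legLength_pos h v).ne'
  · exact hunit _ (hy i)

/-- Wherever the attenuation is nonzero, visibility places all collisions in `X`, makes the travel
time cut-off redundant and forces the initial direction to point inwards, so the coefficients are
only evaluated where they agree. -/
theorem indicator_kernelIntegrand_eq (hn : 2 ≤ n) (hXo : IsOpen X) (hXb : Bornology.IsBounded X)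
    (hX : HasC1Boundary X) {σ σ' : Euc n → Euc n → ℝ} {k k' : Euc n → Euc n → Euc n → ℝ}
    {S S' W W' : Euc n → Euc n → ℝ} {P : Euc n → Euc n → Euc n → Prop}
    (hσ : ∀ x ∈ X, ∀ v : Sph n, σ x v = σ' x v)
    (hk : ∀ z ∈ X, ∀ v' v : Sph n, P z v' v → k z v' v = k' z v' v)
    (hS : ∀ x v, (x, v) ∈ incoming X → S x v = S' x v)
    (hW : ∀ x v, (x, v) ∈ outgoing X → W x v = W' x v) {j : ℕ} {p : ℝ × Euc n × Euc n}
    (hx : p.2.1 ∈ frontier X) (hx' : p.2.2 ∈ frontier X) {q : (Fin (j + 1) → Euc n) × Sph n}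
    (hP : q.1 ∈ ellipsoid (j + 1) p.1 p.2.1 p.2.2 → ∀ i : Fin (j + 2),
      P (points p.1 p.2.1 p.2.2 q.1 q.2 i) (directions p.1 p.2.1 p.2.2 q.1 q.2 i.succ)
        (directions p.1 p.2.1 p.2.2 q.1 q.2 i.castSucc)) :
    (kernelDomain X (j + 1) p.1 p.2.1 p.2.2).indicator
      (fun q => kernelIntegrand X σ k S W (j + 1) p.1 p.2.1 p.2.2 q.1 q.2) q =
      regularIntegrand X σ' k' S' W' (j + 1) p q := by
  obtain ⟨τ, x, x'⟩ := p
  obtain ⟨y, v⟩ := q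
  simp only at hx hx' hP ⊢
  by_cases hq : (y, v) ∈ kernelDomain X (j + 1) τ x x'
  swap
  · rw [indicator_of_notMem hq, regularIntegrand, if_neg]
    rintro ⟨h1, h2, h3⟩
    rw [normalExt_of_mem hx] at h3
    exact hq ⟨mem_ellipsoid_iff.2 h1, h2, h3⟩
  have hwt := mem_ellipsoid_iff.1 hq.1
  simp only at hwt
  rw [indicator_of_mem hq, regularIntegrand, if_pos]
  swap
  · simp only [normalExt_of_mem hx]
    exact ⟨hwt, hq.2.1, hq.2.2⟩
  have hratio : 2 ^ (n - 2) * (leftTime τ y - inner ℝ (leftVec x x' y) (v : Euc n)) ^ ((n : ℤ) - 3) /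
      ((∏ i, ‖y i‖ ^ (n - 1)) * ‖leftVec x x' y - leftTime τ y • (v : Euc n)‖ ^ (2 * n - 4)) =
      scatterDensity (leftTime τ y) (leftVec x x' y) v / ∏ i, ‖y i‖ ^ (n - 1) := by
    rw [scatterDensity, div_div, mul_comm (∏ i, ‖y i‖ ^ (n - 1))]
  simp only [kernelIntegrand, hratio, normalExt_of_mem hx, normalExt_of_mem hx', attenuation_congr hσ]
  -- If some displacement is zero its direction is not a unit vector, but both sides are 0 since
  -- division by zero gives 0.
  by_cases hy : ∀ i, y i ≠ 0
  swap
  · push Not at hy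
    obtain ⟨i, hi⟩ := hy
    have : ∏ i, ‖y i‖ ^ (n - 1) = 0 := by
      refine Finset.prod_eq_zero (Finset.mem_univ i) ?_
      rw [hi, norm_zero, zero_pow (by omega)]
    simp only [this, div_zero, mul_zero, zero_mul]
  by_cases hE : attenuation X σ' (brokenPath τ x x' y v) = 0
  · simp only [hE, mul_zero, zero_mul]
  have hdir := directions_mem_sphere hwt hy v
  have hvis := visible_lastPoint hE
  have hite : leftTime τ y - lastLeg τ x x' y v ∈ Ioo 0 (travelTimeBack X x v) :=
    ⟨sub_legLength_pos hwt v, lt_travelTimeBack hXo hXb (sub_legLength_pos hwt v) hvis⟩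
  have hpt : ∀ i : Fin (j + 2), points τ x x' y v i ∈ X := by
    refine Fin.cases ?_ fun i => ?_
    · have := mem_of_visible_ne_zero hvis (p := 1) ⟨one_pos, le_rfl⟩
      rwa [one_smul, add_sub_cancel] at this
    · exact hq.2.1 i
  have hprod : ∏ i : Fin (j + 1 + 1), k (points τ x x' y v i) (directions τ x x' y v i.succ)
      (directions τ x x' y v i.castSucc) =
      ∏ i : Fin (j + 1 + 1), k' (points τ x x' y v i) (directions τ x x' y v i.succ)
      (directions τ x x' y v i.castSucc) :=
    Finset.prod_congr rfl fun i _ => hk _ (hpt i) ⟨_, hdir i.succ⟩ ⟨_, hdir i.castSucc⟩ (hP hq.1 i)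
  have hWv : W x v = W' x v := hW x v ⟨hx, norm_sph v, hq.2.2⟩
  -- For tangential `u` the two sources may differ, but the factor `|ν(x')·u|` vanishes.
  have hsource : ∀ u : Euc n, ‖u‖ = 1 → inner ℝ (normal X x') u ≤ 0 →
      S x' u * |inner ℝ (normal X x') u| = S' x' u * |inner ℝ (normal X x') u| := by
    intro u hu hle
    rcases hle.lt_or_eq with h4 | h4
    · rw [hS x' u ⟨hx', hu, h4⟩]
    · rw [h4, abs_zero, mul_zero, mul_zero]
  have hlast : S x' (directions τ x x' y v (Fin.last (j + 1 + 1))) *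
      |inner ℝ (normal X x') (directions τ x x' y v (Fin.last (j + 1 + 1)))| =
      S' x' (directions τ x x' y v (Fin.last (j + 1 + 1))) *
      |inner ℝ (normal X x') (directions τ x x' y v (Fin.last (j + 1 + 1)))| := by
    have h1 := visible_firstPoint hE
    rw [points_last] at h1
    have h2 := inner_normal_nonpos hX hx' h1
    have h3 : inner ℝ (normal X x') (directions τ x x' y v (Fin.last (j + 1 + 1))) ≤ 0 := by
      rw [directions_last, inner_smul_right]
      exact mul_nonpos_of_nonneg_of_nonpos (by positivity) h2
    exact hsource _ (mem_sphere_zero_iff_norm.1 (hdir _)) h3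
  rw [if_pos hite, hprod, hWv, mul_one, mul_assoc _ (S x' _), hlast, ← mul_assoc]

/-! ### Bounds for the regular integrand -/

section Bounds

variable {σ : Euc n → Euc n → ℝ} {k : Euc n → Euc n → Euc n → ℝ} {S W : Euc n → Euc n → ℝ}
  {δ K A : ℝ}

theorem norm_normalExt_le (hX : HasC1Boundary X) (x : Euc n) : ‖normalExt X x‖ ≤ 1 := by
  by_cases h : x ∈ frontier X
  · rw [normalExt_of_mem h, norm_normal hX h]
  · rw [normalExt, indicator_of_notMem h, norm_zero]
    exact zero_le_one

theorem abs_inner_normalExt_le (hX : HasC1Boundary X) (x : Euc n) {u : Euc n} (hu : ‖u‖ ≤ 1) :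
    |inner ℝ (normalExt X x) u| ≤ 1 :=
  (abs_real_inner_le_norm _ _).trans (mul_le_one₀ (norm_normalExt_le hX x) (norm_nonneg _) hu)

theorem scatterDensity_nonneg {t : ℝ} {w : Euc n} (h : ‖w‖ < t) (v : Sph n) :
    0 ≤ scatterDensity t w v := by
  have := inner_sph_le w v
  have : 0 < t - inner ℝ w (v : Euc n) := by linarith
  unfold scatterDensity
  positivity

theorem RegularCoefficients.enorm_regularIntegrand_le (hn : 2 ≤ n) (hX : HasC1Boundary X)
    (h : RegularCoefficients X σ k S W δ K A) {j : ℕ} {p : ℝ × Euc n × Euc n}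
    {y : Fin (j + 1) → Euc n} (hwt : ‖leftVec p.2.1 p.2.2 y‖ < leftTime p.1 y) (v : Sph n) :
    ‖regularIntegrand X σ k S W (j + 1) p (y, v)‖ₑ ≤
      ENNReal.ofReal (A ^ 2 * K ^ (j + 2)) * (∏ i, radialWeight (y i)) *
        ENNReal.ofReal (scatterDensity (leftTime p.1 y) (leftVec p.2.1 p.2.2 y) v) := by
  obtain ⟨τ, x, x'⟩ := p
  simp only at hwt ⊢
  have hA : 0 ≤ A := (abs_nonneg _).trans (h.source_bound 0 0)
  have hK : 0 ≤ K := (abs_nonneg _).trans (h.collision_bound 0 0 0)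
  have hd := scatterDensity_nonneg hwt v
  rw [regularIntegrand]
  split_ifs with hcond
  swap
  · rw [enorm_zero]; exact zero_le
  -- At a zero displacement the extended weight is infinite while the real quotient is 0, so the two
  -- products can only be identified off this case.
  by_cases hy : ∀ i, y i ≠ 0
  swap
  · push Not at hy
    obtain ⟨i, hi⟩ := hy
    have : ∏ i, ‖y i‖ ^ (n - 1) = 0 := by
      refine Finset.prod_eq_zero (Finset.mem_univ i) ?_
      rw [hi, norm_zero, zero_pow (by omega)]
    simp only [this, div_zero, mul_zero, zero_mul, enorm_zero]
    exact zero_le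
  have hpos : ∀ i, 0 < ‖y i‖ ^ (n - 1) := fun i => pow_pos (norm_pos_iff.2 (hy i)) _
  have hprod : ∏ i, radialWeight (y i) = ENNReal.ofReal ((∏ i, ‖y i‖ ^ (n - 1))⁻¹) := by
    rw [← Finset.prod_inv_distrib, ENNReal.ofReal_prod_of_nonneg fun i _ => by positivity]
    exact Finset.prod_congr rfl fun i _ => by rw [radialWeight, ENNReal.ofReal_inv_of_pos (hpos i)]
  have hP0 : 0 < ∏ i, ‖y i‖ ^ (n - 1) := Finset.prod_pos fun i _ => hpos i
  rw [hprod, ← ENNReal.ofReal_mul (by positivity), ← ENNReal.ofReal_mul (by positivity),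
    Real.enorm_eq_ofReal_abs]
  apply ENNReal.ofReal_le_ofReal
  have hdir := directions_mem_sphere hwt hy v
  have h1 := abs_inner_normalExt_le hX x (norm_sph v).le
  have h2 := abs_inner_normalExt_le hX x' (mem_sphere_zero_iff_norm.1 (hdir (Fin.last (j + 2)))).le
  have h3 := h.window_bound x v
  have h4 := h.source_bound x' (directions τ x x' y v (Fin.last (j + 2)))
  have h5 := abs_attenuation_le_one (X := X) h.absorption_nonneg (brokenPath τ x x' y v)
  have h6 : |∏ i : Fin (j + 1 + 1), k (points τ x x' y v i) (directions τ x x' y v i.succ)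
      (directions τ x x' y v i.castSucc)| ≤ K ^ (j + 2) := by
    rw [Finset.abs_prod]
    refine (Finset.prod_le_prod (fun _ _ => abs_nonneg _)
      fun i _ => h.collision_bound _ _ _).trans_eq ?_
    rw [Finset.prod_const, Finset.card_univ, Fintype.card_fin]
  have h7 : |scatterDensity (leftTime τ y) (leftVec x x' y) v / ∏ i, ‖y i‖ ^ (n - 1)| =
      (∏ i, ‖y i‖ ^ (n - 1))⁻¹ * scatterDensity (leftTime τ y) (leftVec x x' y) v := by
    rw [abs_of_nonneg (by positivity), div_eq_inv_mul]
  simp only [abs_mul, abs_abs, h7]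
  calc _ ≤ 1 * A * ((∏ i, ‖y i‖ ^ (n - 1))⁻¹ *
        scatterDensity (leftTime τ y) (leftVec x x' y) v) * 1 * K ^ (j + 2) * A * 1 := by gcongr
    _ = _ := by ring

/-- A nonzero integrand forces the first and the last collision to be at distance at least δ from
the boundary. The first leg joins one of them to `x'`, and the leg joining the other to `x` is part
of the final duration. -/
theorem RegularCoefficients.le_of_regularIntegrand_ne_zero
    (h : RegularCoefficients X σ k S W δ K A) {j : ℕ} {p : ℝ × Euc n × Euc n}
    (hx : p.2.1 ∈ frontier X) (hx' : p.2.2 ∈ frontier X) {y : Fin (j + 1) → Euc n} {v : Sph n}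
    (hne : regularIntegrand X σ k S W (j + 1) p (y, v) ≠ 0) :
    δ ≤ leftTime p.1 y ∧ δ ≤ ‖y (Fin.last j)‖ := by
  obtain ⟨τ, x, x'⟩ := p
  rw [regularIntegrand] at hne
  split_ifs at hne with hcond
  swap
  · exact absurd rfl hne
  have hwt := hcond.1
  simp only at hwt hx hx' ⊢
  have hprod := right_ne_zero_of_mul (left_ne_zero_of_mul (left_ne_zero_of_mul hne))
  rw [Finset.prod_ne_zero_iff] at hprod
  refine ⟨?_, ?_⟩
  · have h1 := h.collision_support _ _ _ (hprod 0 (Finset.mem_univ _))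
    refine h1.trans ((Metric.infDist_le_dist_of_mem hx).trans ?_)
    rw [points_zero, lastPoint, dist_eq_norm, sub_sub_cancel_left, norm_neg, norm_smul, norm_sph,
      mul_one, lastLeg_eq, Real.norm_of_nonneg (sub_legLength_pos hwt v).le]
    linarith [legLength_pos hwt v]
  · have h1 := h.collision_support _ _ _ (hprod (Fin.last (j + 1)) (Finset.mem_univ _))
    refine h1.trans ((Metric.infDist_le_dist_of_mem hx').trans ?_)
    simp only [points_last]
    rw [dist_eq_norm, add_sub_cancel_left]

theorem regularIntegrand_eq_zero {j : ℕ} {p : ℝ × Euc n × Euc n} {y : Fin j → Euc n} {v : Sph n}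
    (h : ¬ ‖leftVec p.2.1 p.2.2 y‖ < leftTime p.1 y) :
    regularIntegrand X σ k S W j p (y, v) = 0 := by
  rw [regularIntegrand, if_neg fun hcond => h hcond.1]

theorem lintegral_regularIntegrand_sphere_le (hn : 2 ≤ n) :
    ∃ C : ℝ, 0 < C ∧ ∀ {X : Set (Euc n)} {σ : Euc n → Euc n → ℝ} {k : Euc n → Euc n → Euc n → ℝ}
      {S W : Euc n → Euc n → ℝ} {δ K A : ℝ}, HasC1Boundary X →
      RegularCoefficients X σ k S W δ K A → ∀ (j : ℕ) (p : ℝ × Euc n × Euc n)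
      (y : Fin (j + 1) → Euc n),
      ∫⁻ v : Sph n, ‖regularIntegrand X σ k S W (j + 1) p (y, v)‖ₑ ∂(sphereMeasure n) ≤
        ENNReal.ofReal (C * (A ^ 2 * K ^ (j + 2))) *
          ((ENNReal.ofReal (leftTime p.1 y ^ (n - 1)))⁻¹ * (∏ i, radialWeight (y i)) *
            delayProfile n p.1 (leftTime p.1 y - ‖leftVec p.2.1 p.2.2 y‖)) := by
  obtain ⟨C, hC, hle⟩ := lintegral_scatterDensity_le hn
  refine ⟨C, hC, fun {X σ k S W δ K A} hX h j p y => ?_⟩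
  have hA : 0 ≤ A := (abs_nonneg _).trans (h.source_bound 0 0)
  have hK : 0 ≤ K := (abs_nonneg _).trans (h.collision_bound 0 0 0)
  by_cases hwt : ‖leftVec p.2.1 p.2.2 y‖ < leftTime p.1 y
  swap
  · simp only [regularIntegrand_eq_zero hwt, enorm_zero, lintegral_zero]
    exact zero_le
  set t := leftTime p.1 y with ht
  set w := leftVec p.2.1 p.2.2 y with hw
  have ht0 : 0 < t := (norm_nonneg w).trans_lt hwt
  have htτ : t ≤ p.1 := by
    rw [ht, leftTime]
    linarith [Finset.sum_nonneg fun i (_ : i ∈ Finset.univ) => norm_nonneg (y i)]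
  have hτ0 : 0 < p.1 := ht0.trans_le htτ
  -- The profile is taken at scale `τ` instead of `t`, at the price of enlarging it. It then depends
  -- on the delay alone, as the chain estimates require.
  have hcone : coneProfile n ((t - ‖w‖) / t) ≤ coneProfile n ((t - ‖w‖) / p.1) :=
    coneProfile_anti n (div_pos (sub_pos.2 hwt) hτ0)
      (div_le_div_of_nonneg_left (sub_pos.2 hwt).le ht0 htτ)
  have hpow : 0 < t ^ (n - 1) := pow_pos ht0 _
  have hv : Measurable fun v : Sph n => scatterDensity t w v := by fun_prop
  calc ∫⁻ v : Sph n, ‖regularIntegrand X σ k S W (j + 1) p (y, v)‖ₑ ∂(sphereMeasure n)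
      ≤ ∫⁻ v : Sph n, ENNReal.ofReal (A ^ 2 * K ^ (j + 2)) * (∏ i, radialWeight (y i)) *
        ENNReal.ofReal (scatterDensity t w v) ∂(sphereMeasure n) :=
        lintegral_mono fun v => h.enorm_regularIntegrand_le hn hX hwt v
    _ = ENNReal.ofReal (A ^ 2 * K ^ (j + 2)) * (∏ i, radialWeight (y i)) *
        ∫⁻ v : Sph n, ENNReal.ofReal (scatterDensity t w v) ∂(sphereMeasure n) :=
        lintegral_const_mul _ hv.ennreal_ofReal
    _ ≤ ENNReal.ofReal (A ^ 2 * K ^ (j + 2)) * (∏ i, radialWeight (y i)) *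
        ENNReal.ofReal (C * (t ^ (n - 1))⁻¹ * coneProfile n ((t - ‖w‖) / p.1)) := by
        gcongr
        exact (hle t w hwt).trans (ENNReal.ofReal_le_ofReal (by gcongr))
    _ = _ := by
        rw [delayProfile, if_pos (sub_pos.2 hwt),
          ENNReal.ofReal_mul (p := C * (t ^ (n - 1))⁻¹) (by positivity),
          ENNReal.ofReal_mul (p := C) (q := (t ^ (n - 1))⁻¹) hC.le,
          ENNReal.ofReal_mul (p := C) (q := A ^ 2 * K ^ (j + 2)) hC.le,
          ENNReal.ofReal_inv_of_pos hpow]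
        ring

end Bounds


section IntegratedBounds

variable {σ : Euc n → Euc n → ℝ} {k : Euc n → Euc n → Euc n → ℝ}
  {S W : Euc n → Euc n → ℝ} {δ K A : ℝ}

theorem regularIntegrand_eq_zero_of_le {j : ℕ} {p : ℝ × Euc n × Euc n}
    (h : p.1 ≤ ‖p.2.1 - p.2.2‖) (q : (Fin j → Euc n) × Sph n) :
    regularIntegrand X σ k S W j p q = 0 := by
  refine regularIntegrand_eq_zero (y := q.1) (v := q.2) (not_lt.2 ?_)
  have h1 := norm_sub_norm_le (p.2.1 - p.2.2) (∑ i, q.1 i)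
  have h2 := norm_sum_le Finset.univ q.1
  rw [leftTime, leftVec]
  linarith

theorem lintegral_regularIntegrand_le (hn : 2 ≤ n) :
    ∃ C : ℝ, 0 < C ∧ ∀ {X : Set (Euc n)} {σ : Euc n → Euc n → ℝ} {k : Euc n → Euc n → Euc n → ℝ}
      {S W : Euc n → Euc n → ℝ} {δ K A : ℝ}, HasC1Boundary X →
      RegularCoefficients X σ k S W δ K A → ∀ (j : ℕ) (p : ℝ × Euc n × Euc n),
      ‖p.2.1 - p.2.2‖ < p.1 →
      ∫⁻ y : Fin (j + 1) → Euc n, (∫⁻ v : Sph n,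
        ‖regularIntegrand X σ k S W (j + 1) p (y, v)‖ₑ ∂(sphereMeasure n)) ≤
      ENNReal.ofReal (K ^ (j + 2) *
        ((j + 2) ^ n * (((sphereMeasure n).real univ * p.1) ^ j / j.factorial)) *
        (C * A ^ 2 * ((p.1 ^ (n - 1))⁻¹ * ((p.1 - ‖p.2.1 - p.2.2‖) *
          coneProfile n ((p.1 - ‖p.2.1 - p.2.2‖) / p.1) ^ 2)))) := by
  obtain ⟨C₁, hC₁, h₁⟩ := lintegral_regularIntegrand_sphere_le hn
  obtain ⟨C₂, hC₂, h₂⟩ := lintegral_multipleLegs_le hn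
  refine ⟨C₁ * C₂, mul_pos hC₁ hC₂, fun {X σ k S W δ K A} hX h j p hp => ?_⟩
  have hK : 0 ≤ K := (abs_nonneg _).trans (h.collision_bound 0 0 0)
  refine (lintegral_mono fun y => h₁ hX h j p y).trans ?_
  rw [lintegral_const_mul' _ _ ENNReal.ofReal_ne_top]
  refine (mul_le_mul_right (h₂ j p.1 (p.2.1 - p.2.2) hp) _).trans (le_of_eq ?_)
  rw [← ENNReal.ofReal_mul (by positivity)]
  congr 1
  ring

theorem lintegral_regularIntegrand_interior_le (hn : 2 ≤ n) :
    ∃ C : ℝ, 0 < C ∧ ∀ {X : Set (Euc n)} {σ : Euc n → Euc n → ℝ} {k : Euc n → Euc n → Euc n → ℝ}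
      {S W : Euc n → Euc n → ℝ} {δ K A : ℝ}, HasC1Boundary X →
      RegularCoefficients X σ k S W δ K A → 0 < δ → ∀ (j : ℕ) (p : ℝ × Euc n × Euc n),
      p.2.1 ∈ frontier X → p.2.2 ∈ frontier X → ‖p.2.1 - p.2.2‖ < p.1 →
      ∫⁻ y : Fin (j + 1) → Euc n, (∫⁻ v : Sph n,
        ‖regularIntegrand X σ k S W (j + 1) p (y, v)‖ₑ ∂(sphereMeasure n)) ≤
      ENNReal.ofReal (K ^ (j + 2) *
        (((sphereMeasure n).real univ * p.1) ^ j / j.factorial) *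
        (C * A ^ 2 * ((δ ^ (n - 1))⁻¹ ^ 2) * (√p.1 ^ (n + 1) * (√(p.1 - ‖p.2.1 - p.2.2‖) ^ (n - 1) *
          coneProfile n ((p.1 - ‖p.2.1 - p.2.2‖) / p.1))))) := by
  obtain ⟨C₁, hC₁, h₁⟩ := lintegral_regularIntegrand_sphere_le hn
  obtain ⟨C₂, hC₂, h₂⟩ := lintegral_interiorLegs_le hn
  refine ⟨C₁ * C₂, mul_pos hC₁ hC₂, fun {X σ k S W δ K A} hX h hδ j p hx hx' hp => ?_⟩
  have hK : 0 ≤ K := (abs_nonneg _).trans (h.collision_bound 0 0 0)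
  have hδn : 0 < δ ^ (n - 1) := pow_pos hδ _
  have hle : ∀ y : Fin (j + 1) → Euc n, (∫⁻ v : Sph n,
      ‖regularIntegrand X σ k S W (j + 1) p (y, v)‖ₑ ∂(sphereMeasure n)) ≤
      ENNReal.ofReal (C₁ * (A ^ 2 * K ^ (j + 2)) * (δ ^ (n - 1))⁻¹ ^ 2) *
        ((∏ i : Fin j, radialWeight (y i.castSucc)) *
          delayProfile n p.1 (leftTime p.1 y - ‖leftVec p.2.1 p.2.2 y‖)) := by
    intro y
    by_cases hex : ∃ v : Sph n, regularIntegrand X σ k S W (j + 1) p (y, v) ≠ 0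
    swap
    · push Not at hex
      simp only [hex, enorm_zero, lintegral_zero]
      exact zero_le
    obtain ⟨v, hv⟩ := hex
    obtain ⟨ht, hy⟩ := h.le_of_regularIntegrand_ne_zero hx hx' hv
    -- Used twice, for the remaining time and for the first leg. The last displacement of the chain
    -- thereby loses its weight, which is the case `q = 1` of `lintegral_chain_le`.
    have hinv : ∀ r : ℝ, δ ≤ r → (ENNReal.ofReal (r ^ (n - 1)))⁻¹ ≤
        ENNReal.ofReal ((δ ^ (n - 1))⁻¹) := fun r hr => by
      rw [ENNReal.ofReal_inv_of_pos hδn]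
      gcongr
    refine (h₁ hX h j p y).trans ?_
    rw [Fin.prod_univ_castSucc]
    calc _ ≤ ENNReal.ofReal (C₁ * (A ^ 2 * K ^ (j + 2))) * (ENNReal.ofReal ((δ ^ (n - 1))⁻¹) *
          ((∏ i : Fin j, radialWeight (y i.castSucc)) * ENNReal.ofReal ((δ ^ (n - 1))⁻¹)) *
          delayProfile n p.1 (leftTime p.1 y - ‖leftVec p.2.1 p.2.2 y‖)) := by
          gcongr
          · exact hinv _ ht
          · exact hinv _ hy
      _ = _ := by
          rw [ENNReal.ofReal_mul (p := C₁ * (A ^ 2 * K ^ (j + 2))) (by positivity),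
            ENNReal.ofReal_pow (by positivity)]
          ring
  refine (lintegral_mono hle).trans ?_
  rw [lintegral_const_mul' _ _ ENNReal.ofReal_ne_top]
  refine (mul_le_mul_right (h₂ j p.1 (p.2.1 - p.2.2) hp) _).trans (le_of_eq ?_)
  rw [← ENNReal.ofReal_mul (by positivity)]
  congr 1
  ring

end IntegratedBounds

/-! ### Summation over the number of collisions -/

/-- The polynomial factor is at most `n! e^(i+2)`, so an exponential series dominates. -/
theorem summable_collisionSeries (n : ℕ) {a K : ℝ} (ha : 0 ≤ a) (hK : 0 ≤ K) :
    Summable fun i : ℕ => K ^ (i + 2) * ((i + 2 : ℝ) ^ n * (a ^ i / i.factorial)) := by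
  refine Summable.of_nonneg_of_le (fun i => by positivity) (fun i => ?_)
    ((Real.summable_pow_div_factorial (K * a * Real.exp 1)).mul_left
      (K ^ 2 * n.factorial * Real.exp 2))
  have h1 : ((i : ℝ) + 2) ^ n ≤ n.factorial * Real.exp (i + 2) := by
    have := Real.pow_div_factorial_le_exp ((i : ℝ) + 2) (by positivity) n
    rwa [div_le_iff₀' (by positivity)] at this
  have h2 : Real.exp ((i : ℝ) + 2) = Real.exp 1 ^ i * Real.exp 2 := by
    rw [Real.exp_add, ← Real.exp_nat_mul, mul_one]
  calc K ^ (i + 2) * ((i + 2 : ℝ) ^ n * (a ^ i / i.factorial))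
      ≤ K ^ (i + 2) * (n.factorial * Real.exp (i + 2) * (a ^ i / i.factorial)) := by gcongr
    _ = _ := by rw [h2, mul_pow, mul_pow]; ring

theorem measurableSet_kernelDomain (hXo : IsOpen X) (j : ℕ) (τ : ℝ) (x x' : Euc n) :
    MeasurableSet (kernelDomain X j τ x x') := by
  have h1 : MeasurableSet {q : (Fin j → Euc n) × Sph n | q.1 ∈ ellipsoid j τ x x'} := by
    simp only [mem_ellipsoid_iff]
    exact measurableSet_lt (by fun_prop) (by fun_prop)
  have h2 : MeasurableSet {q : (Fin j → Euc n) × Sph n | ∀ i, earlyPoint x' q.1 i ∈ X} := by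
    rw [ofPred_forall]
    refine MeasurableSet.iInter fun i => ?_
    have h3 : Measurable fun q : (Fin j → Euc n) × Sph n => earlyPoint x' q.1 i := by fun_prop
    exact h3 hXo.measurableSet
  have h3 : MeasurableSet {q : (Fin j → Euc n) × Sph n |
      0 < (inner ℝ (normal X x) (q.2 : Euc n) : ℝ)} :=
    measurableSet_lt measurable_const (by fun_prop)
  exact h1.inter (h2.inter h3)

/-- A majorant `c i * B p` with summable `c` yields everything at once: integrability of each term,
absolute summability, and the bound for the sum. Measurability of the sum follows since it is an
almost everywhere limit of partial sums of parameter integrals of Borel functions. -/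
theorem scatteringSeries_bound (hXo : IsOpen X) (hX : HasC1Boundary X)
    [SFinite (surfaceMeasure X)] {σ σ' : Euc n → Euc n → ℝ}
    {k k' : Euc n → Euc n → Euc n → ℝ} {S S' W W' : Euc n → Euc n → ℝ} {δ K A T : ℝ}
    (h : RegularCoefficients X σ' k' S' W' δ K A)
    (heq : ∀ᵐ p ∂(dataMeasure X T), ∀ i : ℕ, ∀ᵐ q ∂((volume : Measure (Fin (i + 1) → Euc n)).prod
      (sphereMeasure n)), (kernelDomain X (i + 1) p.1 p.2.1 p.2.2).indicator
        (fun q => kernelIntegrand X σ k S W (i + 1) p.1 p.2.1 p.2.2 q.1 q.2) q =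
        regularIntegrand X σ' k' S' W' (i + 1) p q)
    {c : ℕ → ℝ} {B : ℝ × Euc n × Euc n → ℝ} (hc : Summable c) (hc0 : ∀ i, 0 ≤ c i)
    (hB0 : ∀ᵐ p ∂(dataMeasure X T), 0 ≤ B p)
    (hB : ∀ᵐ p ∂(dataMeasure X T), ∀ i, ∫⁻ y : Fin (i + 1) → Euc n, (∫⁻ v : Sph n,
        ‖regularIntegrand X σ' k' S' W' (i + 1) p (y, v)‖ₑ ∂(sphereMeasure n)) ≤
      ENNReal.ofReal (c i * B p)) :
    (∀ᵐ p ∂(dataMeasure X T),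
      (∀ i : ℕ, KernelConverges X σ k S W (i + 1) p.1 p.2.1 p.2.2) ∧
      Summable fun i : ℕ => scatteringKernel X σ k S W (i + 1) p.1 p.2.1 p.2.2) ∧
    AEStronglyMeasurable
      (fun p : ℝ × Euc n × Euc n => multipleScattering X σ k S W p.1 p.2.1 p.2.2)
      (dataMeasure X T) ∧
    ∀ᵐ p ∂(dataMeasure X T),
      |multipleScattering X σ k S W p.1 p.2.1 p.2.2| ≤ (∑' i, c i) * B p := by
  have hG : ∀ i, Measurable fun z : (ℝ × Euc n × Euc n) × ((Fin (i + 1) → Euc n) × Sph n) =>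
      regularIntegrand X σ' k' S' W' (i + 1) z.1 z.2 :=
    fun i => h.measurable_regularIntegrand hXo hX (i + 1)
  have hγ : ∀ᵐ p ∂(dataMeasure X T), ∀ i : ℕ, scatteringKernel X σ k S W (i + 1) p.1 p.2.1 p.2.2 =
      ∫ q, regularIntegrand X σ' k' S' W' (i + 1) p q
        ∂((volume : Measure (Fin (i + 1) → Euc n)).prod (sphereMeasure n)) := by
    filter_upwards [heq] with p hp i
    rw [scatteringKernel, ← integral_indicator (measurableSet_kernelDomain hXo _ _ _ _)]
    exact integral_congr_ae (hp i)
  have hint : ∀ᵐ p ∂(dataMeasure X T), ∀ i : ℕ,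
      ∫⁻ q, ‖regularIntegrand X σ' k' S' W' (i + 1) p q‖ₑ
        ∂((volume : Measure (Fin (i + 1) → Euc n)).prod (sphereMeasure n)) ≤
      ENNReal.ofReal (c i * B p) := by
    filter_upwards [hB] with p hp i
    exact (lintegral_prod_le _).trans (hp i)
  have hbound : ∀ᵐ p ∂(dataMeasure X T), ∀ i : ℕ,
      |scatteringKernel X σ k S W (i + 1) p.1 p.2.1 p.2.2| ≤ c i * B p := by
    filter_upwards [hγ, hint, hB0] with p h1 h2 h3 i
    rw [h1 i, ← Real.norm_eq_abs]
    exact (norm_integral_le_lintegral_norm _).trans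
      (ENNReal.toReal_le_of_le_ofReal (mul_nonneg (hc0 i) h3)
        ((lintegral_congr fun q => ofReal_norm _).trans_le (h2 i)))
  have hsum : ∀ᵐ p ∂(dataMeasure X T),
      Summable fun i : ℕ => scatteringKernel X σ k S W (i + 1) p.1 p.2.1 p.2.2 := by
    filter_upwards [hbound] with p hp
    exact Summable.of_norm_bounded (hc.mul_right (B p)) hp
  refine ⟨?_, ?_, ?_⟩
  · filter_upwards [heq, hint, hsum] with p h1 h2 h3
    refine ⟨fun i => ?_, h3⟩
    rw [KernelConverges, ← integrable_indicator_iff (measurableSet_kernelDomain hXo _ _ _ _),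
      integrable_congr (h1 i)]
    exact ⟨((hG i).comp measurable_prodMk_left).aestronglyMeasurable,
      (h2 i).trans_lt ENNReal.ofReal_lt_top⟩
  · have hmeas : ∀ i : ℕ, AEStronglyMeasurable (fun p : ℝ × Euc n × Euc n =>
        scatteringKernel X σ k S W (i + 1) p.1 p.2.1 p.2.2) (dataMeasure X T) := fun i => by
      have : SFinite ((volume : Measure (Fin (i + 1) → Euc n)).prod (sphereMeasure n)) :=
        Measure.prod.instSFinite
      have : StronglyMeasurable fun p : ℝ × Euc n × Euc n =>
          ∫ q, regularIntegrand X σ' k' S' W' (i + 1) p q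
            ∂((volume : Measure (Fin (i + 1) → Euc n)).prod (sphereMeasure n)) :=
        StronglyMeasurable.integral_prod_right' (hG i).stronglyMeasurable
      refine this.aestronglyMeasurable.congr ?_
      filter_upwards [hγ] with p hp
      exact (hp i).symm
    refine aestronglyMeasurable_of_tendsto_ae atTop
      (f := fun (N : ℕ) (p : ℝ × Euc n × Euc n) =>
        ∑ i ∈ Finset.range N, scatteringKernel X σ k S W (i + 1) p.1 p.2.1 p.2.2)
      (fun N => Finset.aestronglyMeasurable_fun_sum _ fun i _ => hmeas i) ?_
    filter_upwards [hsum] with p hp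
    exact hp.hasSum.tendsto_sum_nat
  · filter_upwards [hbound] with p hp
    rw [← tsum_mul_right, ← Real.norm_eq_abs, multipleScattering]
    exact tsum_of_norm_bounded (hc.mul_right (B p)).hasSum hp


/-! ### The majorants compared with the weights of the theorem -/

/-- The bound for the multiple scattering kernel at delay `τ - d`, for general collision kernels. -/
noncomputable def scatteringProfile (n : ℕ) (τ d : ℝ) : ℝ :=
  if d < τ then (τ ^ (n - 1))⁻¹ * ((τ - d) * coneProfile n ((τ - d) / τ) ^ 2) else 0

/-- The bound for the multiple scattering kernel at delay `τ - d`, for collision kernels that vanish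
near the boundary. -/
noncomputable def interiorProfile (n : ℕ) (τ d : ℝ) : ℝ :=
  if d < τ then √(τ - d) ^ (n - 1) * coneProfile n ((τ - d) / τ) else 0

theorem coneProfile_pos (n : ℕ) {τ d : ℝ} (hd : 0 ≤ d) (h : d < τ) :
    0 < coneProfile n ((τ - d) / τ) := by
  have hτ : 0 < τ := hd.trans_lt h
  exact one_pos.trans_le (one_le_coneProfile n (div_pos (sub_pos.2 h) hτ)
    ((div_le_one hτ).2 (by linarith)))

theorem scatteringProfile_nonneg (n : ℕ) {τ d : ℝ} (hd : 0 ≤ d) : 0 ≤ scatteringProfile n τ d := by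
  rw [scatteringProfile]
  split_ifs with h
  · have := hd.trans_lt h
    have := sub_pos.2 h
    positivity
  · exact le_rfl

theorem interiorProfile_nonneg (n : ℕ) {τ d : ℝ} (hd : 0 ≤ d) : 0 ≤ interiorProfile n τ d := by
  rw [interiorProfile]
  split_ifs with h
  · have := (coneProfile_pos n hd h).le
    positivity
  · exact le_rfl

theorem one_le_logWeight {τ d : ℝ} (hd : 0 ≤ d) (h : d < τ) :
    1 ≤ 1 + Real.log ((τ + d) / (τ - d)) := by
  have : 0 ≤ Real.log ((τ + d) / (τ - d)) :=
    Real.log_nonneg ((one_le_div (sub_pos.2 h)).2 (by linarith))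
  linarith

/-- `τ/(τ-d) ≤ (τ+d)/(τ-d)` replaces the logarithm of the profile by the one of the theorem. -/
theorem coneProfile_three_le {τ d : ℝ} (hd : 0 ≤ d) (h : d < τ) :
    coneProfile 3 ((τ - d) / τ) ≤ 2 * (1 + Real.log ((τ + d) / (τ - d))) := by
  have hτ : 0 < τ := hd.trans_lt h
  have hε := sub_pos.2 h
  have h1 := one_le_logWeight hd h
  have h2 : -Real.log ((τ - d) / τ) ≤ Real.log ((τ + d) / (τ - d)) := by
    rw [← Real.log_inv, inv_div]
    exact Real.log_le_log (by positivity) (by gcongr; linarith)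
  have h3 : coneProfile 3 ((τ - d) / τ) = 2 - Real.log ((τ - d) / τ) := by
    simp [coneProfile]
  rw [h3]
  linarith

/-- In dimension 2 the squared profile is `τ/(τ-d)` and cancels the other factors exactly, so no
weight is needed. -/
theorem scatteringProfile_two_le {τ d : ℝ} (hd : 0 ≤ d) : scatteringProfile 2 τ d ≤ 1 := by
  rw [scatteringProfile]
  split_ifs with h
  · have hτ : 0 < τ := hd.trans_lt h
    have hε := sub_pos.2 h
    have h3 : coneProfile 2 ((τ - d) / τ) = (√((τ - d) / τ))⁻¹ := by simp [coneProfile]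
    rw [h3, inv_pow, Real.sq_sqrt (by positivity)]
    apply le_of_eq
    field_simp
    norm_num
  · exact zero_le_one

theorem weight_mul_scatteringProfile_three_le {τ d : ℝ} (hd : 0 ≤ d) :
    |τ * d / ((τ - d) * (1 + Real.log ((τ + d) / (τ - d))) ^ 2)| * scatteringProfile 3 τ d ≤ 4 := by
  rw [scatteringProfile]
  split_ifs with h
  swap
  · rw [mul_zero]; norm_num
  have hτ : 0 < τ := hd.trans_lt h
  have hε := sub_pos.2 h
  have h1 := one_le_logWeight hd h
  have h2 := coneProfile_three_le hd h
  have h3 := coneProfile_pos 3 hd h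
  set L := 1 + Real.log ((τ + d) / (τ - d))
  have hL : 0 < L := one_pos.trans_le h1
  rw [abs_of_nonneg (by positivity)]
  calc _ ≤ τ * d / ((τ - d) * L ^ 2) * ((τ ^ (3 - 1))⁻¹ * ((τ - d) * (2 * L) ^ 2)) := by gcongr
    _ = 4 * (d / τ) := by field_simp; norm_num; ring
    _ ≤ 4 * 1 := by gcongr; exact (div_le_one hτ).2 h.le
    _ = 4 := mul_one 4

theorem weight_mul_scatteringProfile_le {n : ℕ} (hn : 4 ≤ n) {τ d : ℝ} (hd : 0 ≤ d) :
    |τ * d ^ (n - 2) / (τ - d)| * scatteringProfile n τ d ≤ 1 := by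
  rw [scatteringProfile]
  split_ifs with h
  swap
  · rw [mul_zero]; norm_num
  have hτ : 0 < τ := hd.trans_lt h
  have hε := sub_pos.2 h
  have h3 : coneProfile n ((τ - d) / τ) = 1 := by
    rw [coneProfile, if_neg (by omega), if_neg (by omega)]
  rw [abs_of_nonneg (by positivity), h3]
  calc _ = (d / τ) ^ (n - 2) := by
        rw [show n - 1 = n - 2 + 1 by omega, div_pow]
        field_simp
        ring
    _ ≤ 1 := pow_le_one₀ (by positivity) ((div_le_one hτ).2 h.le)

theorem weight_mul_interiorProfile_three_le {τ d : ℝ} (hd : 0 ≤ d) :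
    |(τ - d)⁻¹ * (1 + Real.log ((τ + d) / (τ - d)))⁻¹| * interiorProfile 3 τ d ≤ 2 := by
  rw [interiorProfile]
  split_ifs with h
  swap
  · rw [mul_zero]; norm_num
  have hε := sub_pos.2 h
  have h1 := one_le_logWeight hd h
  have h2 := coneProfile_three_le hd h
  set L := 1 + Real.log ((τ + d) / (τ - d))
  have hL : 0 < L := one_pos.trans_le h1
  rw [abs_of_nonneg (by positivity), show 3 - 1 = 2 from rfl, Real.sq_sqrt hε.le]
  calc _ ≤ (τ - d)⁻¹ * L⁻¹ * ((τ - d) * (2 * L)) := by gcongr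
    _ = 2 := by field_simp

theorem weight_mul_interiorProfile_le {n : ℕ} (hn : 4 ≤ n) {τ d : ℝ} :
    |(τ - d) ^ ((1 - (n : ℝ)) / 2)| * interiorProfile n τ d ≤ 1 := by
  rw [interiorProfile]
  split_ifs with h
  swap
  · rw [mul_zero]; norm_num
  have hε := sub_pos.2 h
  have h3 : coneProfile n ((τ - d) / τ) = 1 := by
    rw [coneProfile, if_neg (by omega), if_neg (by omega)]
  rw [abs_of_nonneg (by positivity), h3, mul_one, Real.sqrt_eq_rpow, ← Real.rpow_natCast,
    ← Real.rpow_mul hε.le, ← Real.rpow_add hε, Nat.cast_sub (by omega)]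
  apply le_of_eq
  rw [show (1 - (n : ℝ)) / 2 + 1 / 2 * ((n : ℝ) - (1 : ℕ)) = 0 by push_cast; ring, Real.rpow_zero]

theorem memLp_top_weight_mul {α : Type*} [MeasurableSpace α] {μ : Measure α} {f ω b : α → ℝ}
    {C C' : ℝ} (hC : 0 ≤ C) (hf : AEStronglyMeasurable f μ) (hω : Measurable ω)
    (hfb : ∀ᵐ a ∂μ, |f a| ≤ C * b a) (hb : ∀ a, |ω a| * b a ≤ C') :
    MemLp (fun a => ω a * f a) ∞ μ := by
  refine memLp_top_of_bound (hω.aestronglyMeasurable.mul hf) (C * C') ?_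
  filter_upwards [hfb] with a ha
  rw [Real.norm_eq_abs, abs_mul]
  calc |ω a| * |f a| ≤ |ω a| * (C * b a) := by gcongr
    _ = C * (|ω a| * b a) := by ring
    _ ≤ C * C' := by gcongr; exact hb a

/-! ### Assembly of the bounds for the multiple scattering kernel -/

section Main

variable {T : ℝ} {σ : Euc n → Euc n → ℝ}
  {k : Euc n → Euc n → Euc n → ℝ} {S W : Euc n → Euc n → ℝ}

theorem ae_points_mem_frontier [SFinite (surfaceMeasure X)] :
    ∀ᵐ p ∂(dataMeasure X T), p.2.1 ∈ frontier X ∧ p.2.2 ∈ frontier X := by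
  have h1 : ∀ᵐ p ∂((surfaceMeasure X).prod (surfaceMeasure X)),
      p.1 ∈ frontier X ∧ p.2 ∈ frontier X :=
    (Measure.quasiMeasurePreserving_fst.ae ae_mem_frontier).and
      (Measure.quasiMeasurePreserving_snd.ae ae_mem_frontier)
  exact Measure.quasiMeasurePreserving_snd.ae h1

theorem ae_time_mem : ∀ᵐ p ∂(dataMeasure X T), p.1 ∈ Ioo 0 T :=
  Measure.quasiMeasurePreserving_fst.ae (ae_restrict_mem measurableSet_Ioo)

theorem exists_regularCoefficients (hn : 2 ≤ n) (hXo : IsOpen X) (hXb : Bornology.IsBounded X)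
    (hX : HasC1Boundary X) (T : ℝ) (hσ : ∀ x ∈ X, ∀ v : Sph n, 0 ≤ σ x v)
    (hσm : Measurable fun p : ↥X × Sph n => σ p.1 p.2)
    (hkm : Measurable fun p : ↥X × Sph n × Sph n => k p.1 p.2.1 p.2.2)
    (hkb : MemLp (fun p : Euc n × Sph n × Sph n => k p.1 p.2.1 p.2.2) ∞ (collisionMeasure X))
    (hS : ContinuousOn (fun p : Euc n × Euc n => S p.1 p.2) (incoming X))
    (hSb : ∃ C : ℝ, ∀ p ∈ incoming X, |S p.1 p.2| ≤ C)
    (hW : ContinuousOn (fun p : Euc n × Euc n => W p.1 p.2) (outgoing X))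
    (hWb : ∃ C : ℝ, ∀ p ∈ outgoing X, |W p.1 p.2| ≤ C)
    {δ : ℝ} (hδ : ∀ᵐ p ∂(collisionMeasure X),
      Metric.infDist p.1 (frontier X) < δ → k p.1 p.2.1 p.2.2 = 0) :
    ∃ (σ' : Euc n → Euc n → ℝ) (k' : Euc n → Euc n → Euc n → ℝ) (S' W' : Euc n → Euc n → ℝ)
      (K A : ℝ), RegularCoefficients X σ' k' S' W' δ K A ∧
      ∀ᵐ p ∂(dataMeasure X T), ∀ i : ℕ, ∀ᵐ q ∂((volume : Measure (Fin (i + 1) → Euc n)).prod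
        (sphereMeasure n)), (kernelDomain X (i + 1) p.1 p.2.1 p.2.2).indicator
          (fun q => kernelIntegrand X σ k S W (i + 1) p.1 p.2.1 p.2.2 q.1 q.2) q =
          regularIntegrand X σ' k' S' W' (i + 1) p q := by
  have := isFiniteMeasure_surfaceMeasure hn hXo hXb hX
  obtain ⟨σ', hσ'm, hσ'0, hσ'⟩ := exists_measurable_absorption hXo hσ hσm
  obtain ⟨K, k', P, hk'm, hk'K, hk'δ, hPm, hP, hk'⟩ := exists_measurable_collision hXo hkm hkb hδ
  obtain ⟨A₁, S', hS'm, hS'A, hS'⟩ :=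
    exists_measurable_extension (measurableSet_incoming hXo hX) hS hSb
  obtain ⟨A₂, W', hW'm, hW'A, hW'⟩ :=
    exists_measurable_extension (measurableSet_outgoing hXo hX) hW hWb
  refine ⟨σ', k', S', W', K, max A₁ A₂, ⟨hσ'm, hσ'0, hk'm, hk'K, hk'δ, hS'm,
    fun x v => (hS'A x v).trans (le_max_left _ _), hW'm,
    fun x v => (hW'A x v).trans (le_max_right _ _)⟩, ?_⟩
  filter_upwards [ae_points_mem_frontier, ae_all_iff.2 fun i => ae_collisions hn hXo hX hPm hP i T] with p hp hq i
  filter_upwards [hq i] with q hqi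
  exact indicator_kernelIntegrand_eq hn hXo hXb hX hσ' hk' hS' hW' hp.1 hp.2 hqi

theorem exists_scatteringProfile_bound (hn : 2 ≤ n) (hXo : IsOpen X)
    (hXb : Bornology.IsBounded X) (hX : HasC1Boundary X) (hσ : ∀ x ∈ X, ∀ v : Sph n, 0 ≤ σ x v)
    (hσm : Measurable fun p : ↥X × Sph n => σ p.1 p.2)
    (hkm : Measurable fun p : ↥X × Sph n × Sph n => k p.1 p.2.1 p.2.2)
    (hkb : MemLp (fun p : Euc n × Sph n × Sph n => k p.1 p.2.1 p.2.2) ∞ (collisionMeasure X))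
    (hS : ContinuousOn (fun p : Euc n × Euc n => S p.1 p.2) (incoming X))
    (hSb : ∃ C : ℝ, ∀ p ∈ incoming X, |S p.1 p.2| ≤ C)
    (hW : ContinuousOn (fun p : Euc n × Euc n => W p.1 p.2) (outgoing X))
    (hWb : ∃ C : ℝ, ∀ p ∈ outgoing X, |W p.1 p.2| ≤ C) (hT : 0 < T) :
    (∀ᵐ p ∂(dataMeasure X T),
      (∀ i : ℕ, KernelConverges X σ k S W (i + 1) p.1 p.2.1 p.2.2) ∧
      Summable fun i : ℕ => scatteringKernel X σ k S W (i + 1) p.1 p.2.1 p.2.2) ∧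
    AEStronglyMeasurable
      (fun p : ℝ × Euc n × Euc n => multipleScattering X σ k S W p.1 p.2.1 p.2.2)
      (dataMeasure X T) ∧
    ∃ C : ℝ, 0 ≤ C ∧ ∀ᵐ p ∂(dataMeasure X T), |multipleScattering X σ k S W p.1 p.2.1 p.2.2| ≤
      C * scatteringProfile n p.1 ‖p.2.1 - p.2.2‖ := by
  have := isFiniteMeasure_surfaceMeasure hn hXo hXb hX
  -- With δ = 0 the condition on the support is void, so one structure serves both halves of the
  -- theorem.
  obtain ⟨σ', k', S', W', K, A, h, heq⟩ := exists_regularCoefficients hn hXo hXb hX T hσ hσm hkm hkb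
    hS hSb hW hWb (δ := 0) (Eventually.of_forall fun p hp =>
      absurd hp (not_lt.2 Metric.infDist_nonneg))
  obtain ⟨C, hC, hle⟩ := lintegral_regularIntegrand_le hn
  have hK : 0 ≤ K := (abs_nonneg _).trans (h.collision_bound 0 0 0)
  set s := (sphereMeasure n).real univ with hs
  have hs0 : 0 ≤ s := measureReal_nonneg
  have hB : ∀ᵐ p ∂(dataMeasure X T), ∀ i : ℕ, ∫⁻ y : Fin (i + 1) → Euc n, (∫⁻ v : Sph n,
        ‖regularIntegrand X σ' k' S' W' (i + 1) p (y, v)‖ₑ ∂(sphereMeasure n)) ≤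
      ENNReal.ofReal (K ^ (i + 2) * ((i + 2 : ℝ) ^ n * ((s * T) ^ i / i.factorial)) *
        (C * A ^ 2 * scatteringProfile n p.1 ‖p.2.1 - p.2.2‖)) := by
    filter_upwards [ae_time_mem] with p hp i
    by_cases hlt : ‖p.2.1 - p.2.2‖ < p.1
    swap
    · simp only [regularIntegrand_eq_zero_of_le (not_lt.1 hlt), enorm_zero, lintegral_zero]
      exact zero_le
    refine (hle hX h i p hlt).trans (ENNReal.ofReal_le_ofReal ?_)
    have hnn := scatteringProfile_nonneg n (τ := p.1) (norm_nonneg (p.2.1 - p.2.2))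
    have hp0 := hp.1.le
    rw [scatteringProfile, if_pos hlt] at hnn ⊢
    gcongr
    exact hp.2.le
  obtain ⟨h1, h2, h3⟩ := scatteringSeries_bound hXo hX h heq
    (c := fun i : ℕ => K ^ (i + 2) * ((i + 2 : ℝ) ^ n * ((s * T) ^ i / i.factorial)))
    (B := fun p => C * A ^ 2 * scatteringProfile n p.1 ‖p.2.1 - p.2.2‖)
    (summable_collisionSeries n (by positivity) hK) (fun i => by positivity)
    (Eventually.of_forall fun p =>
      mul_nonneg (by positivity) (scatteringProfile_nonneg n (norm_nonneg _))) hB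
  refine ⟨h1, h2, _, ?_, h3.mono fun p hp => hp.trans_eq (mul_assoc _ _ _).symm⟩
  exact mul_nonneg (tsum_nonneg fun i => by positivity) (by positivity)

theorem exists_interiorProfile_bound (hn : 2 ≤ n) (hXo : IsOpen X)
    (hXb : Bornology.IsBounded X) (hX : HasC1Boundary X) (hσ : ∀ x ∈ X, ∀ v : Sph n, 0 ≤ σ x v)
    (hσm : Measurable fun p : ↥X × Sph n => σ p.1 p.2)
    (hkm : Measurable fun p : ↥X × Sph n × Sph n => k p.1 p.2.1 p.2.2)
    (hkb : MemLp (fun p : Euc n × Sph n × Sph n => k p.1 p.2.1 p.2.2) ∞ (collisionMeasure X))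
    (hS : ContinuousOn (fun p : Euc n × Euc n => S p.1 p.2) (incoming X))
    (hSb : ∃ C : ℝ, ∀ p ∈ incoming X, |S p.1 p.2| ≤ C)
    (hW : ContinuousOn (fun p : Euc n × Euc n => W p.1 p.2) (outgoing X))
    (hWb : ∃ C : ℝ, ∀ p ∈ outgoing X, |W p.1 p.2| ≤ C) (hT : 0 < T)
    (hk : VanishesNearBoundary X k) :
    ∃ C : ℝ, 0 ≤ C ∧ ∀ᵐ p ∂(dataMeasure X T), |multipleScattering X σ k S W p.1 p.2.1 p.2.2| ≤
      C * interiorProfile n p.1 ‖p.2.1 - p.2.2‖ := by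
  have := isFiniteMeasure_surfaceMeasure hn hXo hXb hX
  obtain ⟨δ, hδ, hk⟩ := hk
  obtain ⟨σ', k', S', W', K, A, h, heq⟩ := exists_regularCoefficients hn hXo hXb hX T hσ hσm hkm hkb
    hS hSb hW hWb hk
  obtain ⟨C, hC, hle⟩ := lintegral_regularIntegrand_interior_le hn
  have hK : 0 ≤ K := (abs_nonneg _).trans (h.collision_bound 0 0 0)
  set s := (sphereMeasure n).real univ with hs
  have hs0 : 0 ≤ s := measureReal_nonneg
  -- The exponent 0 is used: with both end legs bounded below, no factor `(i+2)^n` arises from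
  -- choosing a long leg.
  have hsummable : Summable fun i : ℕ => K ^ (i + 2) * ((s * T) ^ i / i.factorial) := by
    simpa only [pow_zero, one_mul] using
      summable_collisionSeries 0 (a := s * T) (K := K) (by positivity) hK
  have hB : ∀ᵐ p ∂(dataMeasure X T), ∀ i : ℕ, ∫⁻ y : Fin (i + 1) → Euc n, (∫⁻ v : Sph n,
        ‖regularIntegrand X σ' k' S' W' (i + 1) p (y, v)‖ₑ ∂(sphereMeasure n)) ≤
      ENNReal.ofReal (K ^ (i + 2) * ((s * T) ^ i / i.factorial) *
        (C * A ^ 2 * ((δ ^ (n - 1))⁻¹ ^ 2) * √T ^ (n + 1) * interiorProfile n p.1 ‖p.2.1 - p.2.2‖)) := by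
    filter_upwards [ae_time_mem, ae_points_mem_frontier] with p hp hfr i
    by_cases hlt : ‖p.2.1 - p.2.2‖ < p.1
    swap
    · simp only [regularIntegrand_eq_zero_of_le (not_lt.1 hlt), enorm_zero, lintegral_zero]
      exact zero_le
    refine (hle hX h hδ i p hfr.1 hfr.2 hlt).trans (ENNReal.ofReal_le_ofReal ?_)
    have hnn := interiorProfile_nonneg n (τ := p.1) (norm_nonneg (p.2.1 - p.2.2))
    have hp0 := hp.1.le
    rw [interiorProfile, if_pos hlt] at hnn ⊢
    rw [mul_assoc (C * A ^ 2 * ((δ ^ (n - 1))⁻¹ ^ 2)) (√T ^ (n + 1))]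
    gcongr
    · exact hp.2.le
    · exact hp.2.le
  obtain ⟨h1, h2, h3⟩ := scatteringSeries_bound hXo hX h heq
    (c := fun i : ℕ => K ^ (i + 2) * ((s * T) ^ i / i.factorial))
    (B := fun p => C * A ^ 2 * ((δ ^ (n - 1))⁻¹ ^ 2) * √T ^ (n + 1) *
      interiorProfile n p.1 ‖p.2.1 - p.2.2‖) hsummable (fun i => by positivity)
    (Eventually.of_forall fun p =>
      mul_nonneg (by positivity) (interiorProfile_nonneg n (norm_nonneg _))) hB
  refine ⟨_, ?_, h3.mono fun p hp => hp.trans_eq (mul_assoc _ _ _).symm⟩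
  exact mul_nonneg (tsum_nonneg fun i => by positivity) (by positivity)

end Main

end Transport

open Transport in
theorem theorem3p3 (n : ℕ) (hn : 2 ≤ n)
    (X : Set (Euc n)) (hXopen : IsOpen X) (hXbdd : Bornology.IsBounded X) (hXbdy : HasC1Boundary X)
    (T : ℝ) (hT : 0 < T)
    (σ : Euc n → Euc n → ℝ)
    (hσ_nonneg : ∀ x ∈ X, ∀ v : Sph n, 0 ≤ σ x v)
    (hσ_meas : Measurable fun p : ↥X × Sph n => σ p.1 p.2)
    (hσ_bdd : MemLp (fun p : Euc n × Sph n => σ p.1 p.2) ∞ (phaseMeasure X))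
    (k : Euc n → Euc n → Euc n → ℝ)
    (hk_nonneg : ∀ x ∈ X, ∀ v' v : Sph n, 0 ≤ k x v' v)
    (hk_meas : Measurable fun p : ↥X × Sph n × Sph n => k p.1 p.2.1 p.2.2)
    (hk_bdd : MemLp (fun p : Euc n × Sph n × Sph n => k p.1 p.2.1 p.2.2) ∞ (collisionMeasure X))
    (S W : Euc n → Euc n → ℝ)
    (hS_cont : ContinuousOn (fun p : Euc n × Euc n => S p.1 p.2) (incoming X))
    (hS_bdd : ∃ C : ℝ, ∀ p ∈ incoming X, |S p.1 p.2| ≤ C)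
    (hW_cont : ContinuousOn (fun p : Euc n × Euc n => W p.1 p.2) (outgoing X))
    (hW_bdd : ∃ C : ℝ, ∀ p ∈ outgoing X, |W p.1 p.2| ≤ C) :
    -- the integrals that define `γ_m`, `m ≥ 2`, and the series `Γ₂` converge absolutely
    (∀ᵐ p ∂(dataMeasure X T),
      (∀ i : ℕ, KernelConverges X σ k S W (i + 1) p.1 p.2.1 p.2.2) ∧
      Summable fun i : ℕ => scatteringKernel X σ k S W (i + 1) p.1 p.2.1 p.2.2) ∧
    (n = 2 →
      MemLp (fun p : ℝ × Euc n × Euc n => multipleScattering X σ k S W p.1 p.2.1 p.2.2) ∞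
        (dataMeasure X T)) ∧
    (n = 3 →
      MemLp (fun p : ℝ × Euc n × Euc n =>
        p.1 * ‖p.2.1 - p.2.2‖ * multipleScattering X σ k S W p.1 p.2.1 p.2.2 /
          ((p.1 - ‖p.2.1 - p.2.2‖) *
            (1 + Real.log ((p.1 + ‖p.2.1 - p.2.2‖) / (p.1 - ‖p.2.1 - p.2.2‖))) ^ 2)) ∞
        (dataMeasure X T)) ∧
    (4 ≤ n →
      MemLp (fun p : ℝ × Euc n × Euc n =>
        p.1 * ‖p.2.1 - p.2.2‖ ^ (n - 2) / (p.1 - ‖p.2.1 - p.2.2‖) *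
          multipleScattering X σ k S W p.1 p.2.1 p.2.2) ∞
        (dataMeasure X T)) ∧
    (VanishesNearBoundary X k →
      (n = 3 →
        MemLp (fun p : ℝ × Euc n × Euc n =>
          (p.1 - ‖p.2.1 - p.2.2‖)⁻¹ *
            (1 + Real.log ((p.1 + ‖p.2.1 - p.2.2‖) / (p.1 - ‖p.2.1 - p.2.2‖)))⁻¹ *
            multipleScattering X σ k S W p.1 p.2.1 p.2.2) ∞
          (dataMeasure X T)) ∧
      (4 ≤ n →
        MemLp (fun p : ℝ × Euc n × Euc n =>
          (p.1 - ‖p.2.1 - p.2.2‖) ^ ((1 - (n : ℝ)) / 2) *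
            multipleScattering X σ k S W p.1 p.2.1 p.2.2) ∞
          (dataMeasure X T))) := by
  obtain ⟨hconv, hmeas, C, hC, hle⟩ := exists_scatteringProfile_bound hn hXopen hXbdd hXbdy hσ_nonneg
    hσ_meas hk_meas hk_bdd hS_cont hS_bdd hW_cont hW_bdd hT
  refine ⟨hconv, ?_, ?_, ?_, fun hk => ?_⟩
  · rintro rfl
    have := memLp_top_weight_mul hC hmeas (ω := fun _ => 1) measurable_const hle (C' := 1)
      fun p => by
        rw [abs_one, one_mul]
        exact scatteringProfile_two_le (norm_nonneg _)
    simpa only [one_mul] using this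
  · rintro rfl
    have := memLp_top_weight_mul hC hmeas (ω := fun p : ℝ × Euc 3 × Euc 3 =>
      p.1 * ‖p.2.1 - p.2.2‖ / ((p.1 - ‖p.2.1 - p.2.2‖) *
        (1 + Real.log ((p.1 + ‖p.2.1 - p.2.2‖) / (p.1 - ‖p.2.1 - p.2.2‖))) ^ 2)) (by fun_prop) hle
      fun p => weight_mul_scatteringProfile_three_le (norm_nonneg _)
    simpa only [div_mul_eq_mul_div] using this
  · intro hn4
    exact memLp_top_weight_mul hC hmeas (ω := fun p : ℝ × Euc n × Euc n =>
      p.1 * ‖p.2.1 - p.2.2‖ ^ (n - 2) / (p.1 - ‖p.2.1 - p.2.2‖)) (by fun_prop) hle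
      fun p => weight_mul_scatteringProfile_le hn4 (norm_nonneg _)
  · obtain ⟨C', hC', hle'⟩ := exists_interiorProfile_bound hn hXopen hXbdd hXbdy hσ_nonneg
      hσ_meas hk_meas hk_bdd hS_cont hS_bdd hW_cont hW_bdd hT hk
    refine ⟨?_, fun hn4 => ?_⟩
    · rintro rfl
      exact memLp_top_weight_mul hC' hmeas (ω := fun p : ℝ × Euc 3 × Euc 3 =>
        (p.1 - ‖p.2.1 - p.2.2‖)⁻¹ *
          (1 + Real.log ((p.1 + ‖p.2.1 - p.2.2‖) / (p.1 - ‖p.2.1 - p.2.2‖)))⁻¹) (by fun_prop) hle'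
        fun p => weight_mul_interiorProfile_three_le (norm_nonneg _)
    · exact memLp_top_weight_mul hC' hmeas (ω := fun p : ℝ × Euc n × Euc n =>
        (p.1 - ‖p.2.1 - p.2.2‖) ^ ((1 - (n : ℝ)) / 2)) (by fun_prop) hle'
        fun p => weight_mul_interiorProfile_le hn4
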